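/- Let $m\ge 1$ and $n>2m$. A configuration $\Lambda=(\Lambda_1,\dots,\Lambda_n)$ of vectors of $\mathbb C^m\simeq\mathbb R^{2m}$ is \emph{admissible} if $0$ lies in the convex hull of $\Lambda_1,\dots,\Lambda_n$ and $0$ lies in the convex hull of no $2m$ of them; $\Lambda_i$ is \emph{indispensable} if the configuration with $\Lambda_i$ removed is not admissible (it violates one of these two conditions), and $k$ is the number of indispensable points. Put $$\mathcal S_\Lambda=\{z\in\mathbb C^n : 0\in \mathrm{conv}(\Lambda_i : z_i\ne 0)\}.$$ Let $\mathbb C^*\times\mathbb C^m$ act on $\mathbb C^n$ by $(c,T)\cdot z=(c\,z_i\exp\langle\Lambda_i,T\rangle)_i$, where $\langle Z,W\rangle=\sum_j Z_jW_j$. The LVM manifold $N_\Lambda$ is the quotient of $\mathcal S_\Lambda$ by this action, with the quotient complex structure. It is an equivariant compactification of the commutative complex Lie group $G_\Lambda$, the quotient of $(\mathbb C^*)^n$ by the same action. $N_\Lambda$ and $N_{\Lambda'}$ are \emph{$G$-biholomorphic} if there are an isomorphism of complex Lie groups $\psi:G_\Lambda\to G_{\Lambda'}$ and a biholomorphism $F:N_\Lambda\to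 N_{\Lambda'}$ with $F(g x)=\psi(g)F(x)$. Let $\Lambda$ be admissible. Let $\mathcal C_\Lambda\subset(\mathbb C^m)^n$ be the set of admissible configurations $\Lambda'$ such that $\mathcal S_{\Lambda'}=\mathcal S_\Lambda$ up to a permutation of the coordinates of $\mathbb C^n$, and which are numbered so that $\Lambda'_1,\dots,\Lambda'_{m+1}$ are affinely independent over $\mathbb C$ and the indispensable points of $\Lambda'$ are the first ones. Let $\mathcal M_\Lambda$ be the set of $G$-biholomorphism classes of the manifolds $N_{\Lambda'}$, $\Lambda'\in\mathcal C_\Lambda$, with the quotient topology from $\mathcal C_\Lambda$. \textbf{Proposition.} If the number $k$ of indispensable points of $\Lambda$ is less than $m+1$, then the moduli space $\mathcal M_\Lambda$ is a complex orbifold of dimension $m(n-m-1)$: it is Hausdorff and second countable and it has an atlas of complex orbifold charts (connected open subsets of $\mathbb C^{m(n-m-1)}$ modulo finite groups of biholomorphisms, any two charts being related by local biholomorphisms over $\mathcal M_\Lambda$) to which the map $\Lambda'\mapsto[N_{\Lambda'}]$ lifts locally by holomorphic submersions. The local group of this orbifold at $[N_{\Lambda'}]$ is isomorphic to the group of automorphisms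 of $G_{\Lambda'}$ that are induced by $G$-biholomorphisms of $N_{\Lambda'}$ onto itself. These groups are finite, being isomorphic to subgroups of the permutation group of the set of indices $i$ such that $\Lambda'_i$ is not indispensable. -/

import Mathlib

open Topology

namespace LVM

variable {m n : ℕ}

/-- Configurations of `n` vectors in `ℂ^m`. -/
abbrev Config (m n : ℕ) : Type := Fin n → Fin m → ℂ

/-- The sub-configuration `(Λ_i)_{i ∈ I}` is admissible: it satisfies the Siegel condition and the
weak hyperbolicity condition. -/
def AdmissibleOn (Λ : Config m n) (I : Set (Fin n)) : Prop :=
  (0 : Fin m → ℂ) ∈ convexHull ℝ (Λ '' I) ∧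
    ∀ J : Finset (Fin n), (J : Set (Fin n)) ⊆ I → J.card = 2 * m →
      (0 : Fin m → ℂ) ∉ convexHull ℝ (Λ '' (J : Set (Fin n)))

/-- Admissible configurations. -/
def Admissible (Λ : Config m n) : Prop := AdmissibleOn Λ Set.univ

/-- The point `Λ_i` is indispensable: the configuration without it is not admissible. -/
def Indispensable (Λ : Config m n) (i : Fin n) : Prop := ¬ AdmissibleOn Λ {i}ᶜ

/-- The number `k` of indispensable points. -/
noncomputable def numIndispensable (Λ : Config m n) : ℕ := {i | Indispensable Λ i}.ncard

/-- The open set `S_Λ = {z ∈ ℂ^n | 0 ∈ H(Λ_{I_z})}`, where `I_z = {i | z_i ≠ 0}`. -/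
def siegel (Λ : Config m n) : Set (Fin n → ℂ) :=
  {z | (0 : Fin m → ℂ) ∈ convexHull ℝ (Λ '' {i | z i ≠ 0})}

/-- The torus `(ℂ^*)^n` acts on `S_Λ` by coordinatewise multiplication. -/
instance torusAction (Λ : Config m n) : MulAction (Fin n → ℂˣ) (siegel Λ) where
  smul u z := ⟨fun i => (u i : ℂ) * z.1 i, by
    have hz := z.2
    simpa only [siegel, Set.mem_ofPred_eq, ne_eq, mul_eq_zero, Units.ne_zero, false_or] using hz⟩
  one_smul z := Subtype.ext (funext fun i => by
    change ((1 : ℂˣ) : ℂ) * z.1 i = z.1 i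
    simp)
  mul_smul u v z := Subtype.ext (funext fun i => by
    change ((u i * v i : ℂˣ) : ℂ) * z.1 i = (u i : ℂ) * ((v i : ℂ) * z.1 i)
    simp [mul_assoc])

/-- The subgroup of `(ℂ^*)^n` through which `ℂ^* × ℂ^m` acts on `ℂ^n`: the scalars `c ∈ ℂ^*` act by
homotheties and `T ∈ ℂ^m` acts by `z_i ↦ z_i exp ⟨Λ_i, T⟩`, with `⟨-,-⟩` the bilinear product. -/
def leafGroup (Λ : Config m n) : Subgroup (Fin n → ℂˣ) where
  carrier := {u | ∃ (c : ℂˣ) (T : Fin m → ℂ),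
    ∀ i, (u i : ℂ) = (c : ℂ) * Complex.exp (∑ j, Λ i j * T j)}
  one_mem' := ⟨1, 0, fun i => by simp⟩
  mul_mem' := by
    rintro u v ⟨c, T, hu⟩ ⟨d, T', hv⟩
    refine ⟨c * d, T + T', fun i => ?_⟩
    simp only [Pi.mul_apply, Units.val_mul, hu i, hv i, Pi.add_apply, mul_add,
      Finset.sum_add_distrib, Complex.exp_add]
    ring
  inv_mem' := by
    rintro u ⟨c, T, hu⟩
    refine ⟨c⁻¹, -T, fun i => ?_⟩
    simp only [Pi.inv_apply, Units.val_inv_eq_inv_val, hu i, Pi.neg_apply, mul_neg,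
      Finset.sum_neg_distrib, Complex.exp_neg, mul_inv]

/-- The LVM manifold `N_Λ`, the quotient of `ℙ(S_Λ)` by the action of `ℂ^m`, that is, of `S_Λ` by
the action of `ℂ^* × ℂ^m`, with the quotient topology. -/
abbrev Manifold (Λ : Config m n) : Type := MulAction.orbitRel.Quotient (leafGroup Λ) (siegel Λ)

/-- The projection `S_Λ → N_Λ`. -/
def proj (Λ : Config m n) (z : siegel Λ) : Manifold Λ := Quotient.mk _ z

/-- The commutative group `G_Λ`, the quotient of `(ℂ^*)^n` by the same action, with the quotient
topology. -/
abbrev G (Λ : Config m n) : Type := (Fin n → ℂˣ) ⧸ leafGroup Λ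

lemma proj_eq_iff (Λ : Config m n) (z w : siegel Λ) :
    proj Λ z = proj Λ w ↔ ∃ u ∈ leafGroup Λ, u • w = z := by
  unfold proj
  rw [Quotient.eq, MulAction.orbitRel_apply, MulAction.mem_orbit_iff]
  constructor
  · rintro ⟨u, hu⟩
    exact ⟨u.1, u.2, hu⟩
  · rintro ⟨u, hu, h⟩
    exact ⟨⟨u, hu⟩, h⟩

/-- The action of `G_Λ` on `N_Λ` induced by that of `(ℂ^*)^n` on `S_Λ`. -/
instance gAction (Λ : Config m n) : MulAction (G Λ) (Manifold Λ) where
  smul g x := Quotient.liftOn₂' g x (fun u z => proj Λ (u • z)) (by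
    intro u z v w huv hzw
    have huv' : u⁻¹ * v ∈ leafGroup Λ := QuotientGroup.leftRel_apply.1 huv
    obtain ⟨a, ha, hz⟩ := (proj_eq_iff Λ z w).1 (Quotient.sound hzw)
    refine (proj_eq_iff Λ _ _).2 ⟨(u⁻¹ * v)⁻¹ * a, mul_mem (inv_mem huv') ha, ?_⟩
    rw [← hz, smul_smul, smul_smul]
    congr 1
    rw [mul_inv, inv_inv]
    calc u * v⁻¹ * a * v = u * a * (v⁻¹ * v) := by
          rw [mul_assoc (u * v⁻¹), mul_comm (u * v⁻¹), mul_comm u v⁻¹]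
          simp [mul_comm, mul_left_comm]
      _ = u * a := by simp)
  one_smul x := by
    induction x using Quotient.inductionOn with
    | h z => exact congrArg (proj Λ) (one_smul (Fin n → ℂˣ) z)
  mul_smul g h x := by
    induction g using Quotient.inductionOn with
    | h u =>
      induction h using Quotient.inductionOn with
      | h v =>
        induction x using Quotient.inductionOn with
        | h z => exact congrArg (proj Λ) (mul_smul u v z)

lemma mk_smul_proj (Λ : Config m n) (u : Fin n → ℂˣ) (z : siegel Λ) :
    (QuotientGroup.mk u : G Λ) • proj Λ z = proj Λ (u • z) := rfl

/-- Let `P`, `P'` be identified by `c`, `c'` with open subsets of `ℂ^n`, and let `Q`, `Q'` be their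
quotients by free and proper holomorphic group actions, with projections `p`, `p'`. These are
holomorphic submersions, so that a continuous map `F : Q → Q'` is holomorphic for the quotient
complex structures if and only if `F ∘ p` lifts locally through `p'` to holomorphic maps. -/
def Holomorphic {P P' Q Q' : Type} [TopologicalSpace Q] [TopologicalSpace Q']
    (c : P → Fin n → ℂ) (p : P → Q) (c' : P' → Fin n → ℂ) (p' : P' → Q') (F : Q → Q') : Prop :=
  Continuous F ∧ ∀ x : P, ∃ O ∈ 𝓝 (c x), ∃ f : (Fin n → ℂ) → Fin n → ℂ,
    DifferentiableOn ℂ f O ∧ ∀ y : P, c y ∈ O → ∃ y' : P', c' y' = f (c y) ∧ F (p y) = p' y'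

/-- Holomorphic maps `N_Λ → N_Λ'`. -/
def HolomorphicN (Λ Λ' : Config m n) (F : Manifold Λ → Manifold Λ') : Prop :=
  Holomorphic (Subtype.val : siegel Λ → _) (proj Λ) (Subtype.val : siegel Λ' → _) (proj Λ') F

/-- Holomorphic maps `G_Λ → G_Λ'`. -/
def HolomorphicG (Λ Λ' : Config m n) (F : G Λ → G Λ') : Prop :=
  Holomorphic (fun (u : Fin n → ℂˣ) i => (u i : ℂ)) QuotientGroup.mk
    (fun (u : Fin n → ℂˣ) i => (u i : ℂ)) QuotientGroup.mk F

/-- `F` is a biholomorphism `N_Λ → N_Λ'` which is equivariant with respect to the isomorphism of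
complex Lie groups `ψ : G_Λ → G_Λ'`. -/
structure IsEquivariantBiholomorphism (Λ Λ' : Config m n) (ψ : G Λ ≃* G Λ')
    (F : Manifold Λ ≃ Manifold Λ') : Prop where
  holo : HolomorphicN Λ Λ' F
  holo_symm : HolomorphicN Λ' Λ F.symm
  group_holo : HolomorphicG Λ Λ' ψ
  group_holo_symm : HolomorphicG Λ' Λ ψ.symm
  equivariant : ∀ (g : G Λ) (x : Manifold Λ), F (g • x) = ψ g • F x

/-- `N_Λ` and `N_Λ'` are `G`-biholomorphic. -/
def GBiholomorphic (Λ Λ' : Config m n) : Prop :=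
  ∃ (ψ : G Λ ≃* G Λ') (F : Manifold Λ ≃ Manifold Λ'), IsEquivariantBiholomorphism Λ Λ' ψ F

lemma Holomorphic.id {P Q : Type} [TopologicalSpace Q] (c : P → Fin n → ℂ) (p : P → Q) :
    Holomorphic c p c p (fun x => x) :=
  ⟨continuous_id, fun _ => ⟨Set.univ, Filter.univ_mem, fun z => z, differentiableOn_id,
    fun y _ => ⟨y, rfl, rfl⟩⟩⟩

lemma Holomorphic.comp {P P' P'' Q Q' Q'' : Type} [TopologicalSpace Q] [TopologicalSpace Q']
    [TopologicalSpace Q''] {c : P → Fin n → ℂ} {p : P → Q} {c' : P' → Fin n → ℂ} {p' : P' → Q'}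
    {c'' : P'' → Fin n → ℂ} {p'' : P'' → Q''} {F' : Q' → Q''} {F : Q → Q'}
    (hF' : Holomorphic c' p' c'' p'' F') (hF : Holomorphic c p c' p' F) :
    Holomorphic c p c'' p'' (fun x => F' (F x)) := by
  refine ⟨hF'.1.comp hF.1, fun x => ?_⟩
  obtain ⟨O, hO, f, hf, hlift⟩ := hF.2 x
  obtain ⟨x', hx', -⟩ := hlift x (mem_of_mem_nhds hO)
  obtain ⟨O', hO', f', hf', hlift'⟩ := hF'.2 x'
  have hcont : ContinuousAt f (c x) := (hf.continuousOn).continuousAt hO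
  refine ⟨O ∩ f ⁻¹' O', Filter.inter_mem hO (hcont (hx' ▸ hO')), fun z => f' (f z),
    hf'.comp (hf.mono Set.inter_subset_left) (fun z hz => hz.2), fun y hy => ?_⟩
  obtain ⟨y', hy', hFy⟩ := hlift y hy.1
  obtain ⟨y'', hy'', hFy'⟩ := hlift' y' (by rw [hy']; exact hy.2)
  exact ⟨y'', by rw [hy'', hy'], (congrArg F' hFy).trans hFy'⟩

lemma IsEquivariantBiholomorphism.refl (Λ : Config m n) :
    IsEquivariantBiholomorphism Λ Λ (MulEquiv.refl _) (Equiv.refl _) :=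
  ⟨Holomorphic.id _ _, Holomorphic.id _ _, Holomorphic.id _ _, Holomorphic.id _ _,
    fun _ _ => rfl⟩

lemma IsEquivariantBiholomorphism.symm {Λ Λ' : Config m n} {ψ : G Λ ≃* G Λ'}
    {F : Manifold Λ ≃ Manifold Λ'} (h : IsEquivariantBiholomorphism Λ Λ' ψ F) :
    IsEquivariantBiholomorphism Λ' Λ ψ.symm F.symm :=
  ⟨h.holo_symm, h.holo, h.group_holo_symm, h.group_holo, fun g x => by
    rw [Equiv.symm_apply_eq, h.equivariant, MulEquiv.apply_symm_apply, Equiv.apply_symm_apply]⟩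

lemma IsEquivariantBiholomorphism.trans {Λ Λ' Λ'' : Config m n} {ψ : G Λ ≃* G Λ'}
    {F : Manifold Λ ≃ Manifold Λ'} {ψ' : G Λ' ≃* G Λ''} {F' : Manifold Λ' ≃ Manifold Λ''}
    (h : IsEquivariantBiholomorphism Λ Λ' ψ F) (h' : IsEquivariantBiholomorphism Λ' Λ'' ψ' F') :
    IsEquivariantBiholomorphism Λ Λ'' (ψ.trans ψ') (F.trans F') :=
  { holo := Holomorphic.comp (F' := F') (F := F) h'.holo h.holo
    holo_symm := Holomorphic.comp (F' := F.symm) (F := F'.symm) h.holo_symm h'.holo_symm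
    group_holo := Holomorphic.comp (F' := ψ') (F := ψ) h'.group_holo h.group_holo
    group_holo_symm :=
      Holomorphic.comp (F' := ψ.symm) (F := ψ'.symm) h.group_holo_symm h'.group_holo_symm
    equivariant := fun g x => by simp [h.equivariant, h'.equivariant] }

/-- The isotropy group of `N_Λ`: the automorphisms of `G_Λ` which come from a `G`-biholomorphism of
`N_Λ` onto itself. -/
def isotropy (Λ : Config m n) : Subgroup (MulAut (G Λ)) where
  carrier := {ψ | ∃ F : Manifold Λ ≃ Manifold Λ, IsEquivariantBiholomorphism Λ Λ ψ F}
  one_mem' := ⟨_, IsEquivariantBiholomorphism.refl Λ⟩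
  mul_mem' := by
    rintro ψ φ ⟨F, hF⟩ ⟨F', hF'⟩
    exact ⟨_, hF'.trans hF⟩
  inv_mem' := by
    rintro ψ ⟨F, hF⟩
    exact ⟨_, hF.symm⟩

/-- The numbering conventions: the first `m + 1` vectors are affinely independent over `ℂ` (the
matrix with columns `(Λ_i, 1)`, `i ≤ m + 1`, has rank `m + 1`), and the indispensable points are
the first `k` vectors. -/
def WellNumbered (Λ : Config m n) : Prop :=
  AffineIndependent ℂ (fun i : {i : Fin n // (i : ℕ) < m + 1} => Λ i) ∧
    ∀ i : Fin n, Indispensable Λ i ↔ (i : ℕ) < numIndispensable Λ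

/-- The configurations parametrizing the moduli space of `Λ`: the well-numbered admissible `Λ'` for
which `S_Λ'` equals `S_Λ` up to a permutation of the coordinates of `ℂ^n`. -/
def moduliConfig (Λ : Config m n) : Set (Config m n) :=
  {Λ' | Admissible Λ' ∧ WellNumbered Λ' ∧
    ∃ σ : Equiv.Perm (Fin n), ∀ z : Fin n → ℂ, z ∈ siegel Λ' ↔ z ∘ σ ∈ siegel Λ}

/-- `G`-biholomorphism as an equivalence relation. -/
def moduliSetoid (Λ : Config m n) : Setoid (moduliConfig Λ) where
  r Λ₁ Λ₂ := GBiholomorphic Λ₁.1 Λ₂.1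
  iseqv :=
    { refl := fun Λ₁ => ⟨_, _, IsEquivariantBiholomorphism.refl Λ₁.1⟩
      symm := fun ⟨_, _, h⟩ => ⟨_, _, h.symm⟩
      trans := fun ⟨_, _, h⟩ ⟨_, _, h'⟩ => ⟨_, _, h.trans h'⟩ }

/-- The moduli space `M_Λ` of `G`-biholomorphism classes, with the quotient topology. -/
abbrev Moduli (Λ : Config m n) : Type := Quotient (moduliSetoid Λ)

/-- The class of `N_Λ'` in the moduli space. -/
def Moduli.mk (Λ : Config m n) (Λ' : moduliConfig Λ) : Moduli Λ := Quotient.mk _ Λ'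

/-- A complex orbifold chart of dimension `d` on `X`: a connected open subset of `ℂ^d`, a finite
group of biholomorphisms of it, and a continuous open map to `X` whose fibres are the orbits (so
that it induces a homeomorphism of the quotient onto an open subset of `X`). -/
structure OrbifoldChart (d : ℕ) (X : Type) [TopologicalSpace X] where
  domain : Set (Fin d → ℂ)
  isOpen_domain : IsOpen domain
  isConnected_domain : IsConnected domain
  group : Subgroup (Equiv.Perm domain)
  finite_group : Finite group
  holomorphic : ∀ h ∈ group, ∃ f : (Fin d → ℂ) → Fin d → ℂ,
    DifferentiableOn ℂ f domain ∧ ∀ x : domain, f x = h x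
  map : domain → X
  continuous_map : Continuous map
  isOpenMap_map : IsOpenMap map
  map_eq_iff : ∀ x y : domain, map x = map y ↔ ∃ h ∈ group, h x = y

/-- Orbifold atlases: the charts cover `X`, and two points of charts with the same image are related
by a local biholomorphism over `X`. -/
structure IsOrbifoldAtlas {d : ℕ} {X : Type} [TopologicalSpace X]
    (A : Set (OrbifoldChart d X)) : Prop where
  cover : ∀ p : X, ∃ c ∈ A, ∃ x : c.domain, c.map x = p
  compatible : ∀ c ∈ A, ∀ c' ∈ A, ∀ (x : c.domain) (x' : c'.domain), c.map x = c'.map x' →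
    ∃ h : OpenPartialHomeomorph (Fin d → ℂ) (Fin d → ℂ),
      (x : Fin d → ℂ) ∈ h.source ∧ h x = x' ∧ h.source ⊆ c.domain ∧ h.target ⊆ c'.domain ∧
      DifferentiableOn ℂ h h.source ∧ DifferentiableOn ℂ h.symm h.target ∧
      ∀ (y : c.domain) (y' : c'.domain), (y : Fin d → ℂ) ∈ h.source → h y = y' →
        c'.map y' = c.map y

/-- The atlas is compatible with the complex structure of the parameters: near each configuration,
`Λ' ↦ [N_Λ']` lifts to a chart by a holomorphic submersion. -/
def AtlasCompatible (Λ : Config m n) {d : ℕ} (A : Set (OrbifoldChart d (Moduli Λ))) : Prop :=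
  ∀ Λ₀ : moduliConfig Λ, ∃ c ∈ A, ∃ O : Set (Config m n), IsOpen O ∧ Λ₀.1 ∈ O ∧
    ∃ s : Config m n → Fin d → ℂ, DifferentiableOn ℂ s O ∧
      (∀ Λ' ∈ O, Function.Surjective (fderiv ℂ s Λ')) ∧
      ∀ Λ' : moduliConfig Λ, Λ'.1 ∈ O →
        ∃ x : c.domain, (x : Fin d → ℂ) = s Λ'.1 ∧ c.map x = Moduli.mk Λ Λ'

end LVM

/-! In logarithmic coordinates the acting group is the exponential of the space `leafSpace Λ` of
vectors `(c + ⟨Λ_i, T⟩)_i`. Admissibility implies that its only real vectors are the constant ones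
(`Admissible.const_of_im_eq_zero`). Hence every holomorphic homomorphism `G_Λ → G_Λ'` comes from an
integer matrix (`Admissible.exists_torusMap_of_holomorphic`), and a matrix inducing the identity is
the identity plus a constant in each column (`Admissible.isScalarTrivial_iff`).

An equivariant biholomorphism permutes the invariant divisors `z_i = 0`, which are nonempty exactly
for the dispensable indices. So, after constants are subtracted from the columns, its matrix has
basis vectors as columns of index at least `k` (`MonomialData.exists_col`,
`IsEquivariantBiholomorphism.exists_rel`). Conversely, such a matrix has exponents 0 and 1 at all
coordinates that can vanish, and its monomial map extends to `S_Λ`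
(`Rel.isEquivariantBiholomorphism`). The classification thus reduces to integer matrices carrying
one leaf space to another and respecting the combinatorial type `Supp`, which is locally constant.

The leaf space depends on `Λ` only up to affine maps. Sending the first `m + 1` vectors to the
canonical basis and `0` leaves `m (n - m - 1)` coordinates, a chart of a Grassmannian, on which
symmetries act by partially defined holomorphic maps `move`. As `k ≤ m`, the columns of a symmetry
that are not basis vectors are among the first `m`; modulo constants they stay bounded when the
symmetry relates points near `(b, b')`. Only finitely many matrices modulo constants remain, and all
of them relate `b` to `b'` (`eventually_carries`). This gives the Hausdorff property and chart
domains on which only the symmetries of the centre act.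

A symmetry of `Λ` with trivial permutation acts trivially on `G_Λ`, so isotropy groups are finite
permutation groups. A symmetry fixing an open set of coordinates also acts trivially on `G_Λ`
(`isScalarTrivial_of_carries_self`), so the stabilizers in the charts are the isotropy groups. -/

namespace LVM

variable {m n : ℕ}

/-! ### Convex geometry of admissible configurations -/

/-- The sets of indices `I` such that `0` lies in the convex hull of the `Λ_i`, `i ∈ I`. -/
def Supp (Λ : Config m n) : Set (Set (Fin n)) :=
  {I | (0 : Fin m → ℂ) ∈ convexHull ℝ (Λ '' I)}

lemma supp_mono {Λ : Config m n} {I J : Set (Fin n)} (hI : I ∈ Supp Λ) (h : I ⊆ J) : J ∈ Supp Λ :=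
  convexHull_mono (Set.image_mono h) hI

lemma admissible_iff {Λ : Config m n} : Admissible Λ ↔ Set.univ ∈ Supp Λ ∧
    ∀ J : Finset (Fin n), J.card = 2 * m → (J : Set (Fin n)) ∉ Supp Λ := by
  simp [Admissible, AdmissibleOn, Supp]

lemma Admissible.univ_mem {Λ : Config m n} (hΛ : Admissible Λ) : Set.univ ∈ Supp Λ :=
  (admissible_iff.1 hΛ).1

/-- A smaller set could be enlarged to exactly `2 * m` indices, since `n > 2m`, and `Supp` is stable
under enlargement. -/
lemma Admissible.lt_card {Λ : Config m n} (hn : 2 * m < n) (hΛ : Admissible Λ) {J : Finset (Fin n)}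
    (hJ : (J : Set (Fin n)) ∈ Supp Λ) : 2 * m < J.card := by
  by_contra! h
  obtain ⟨t, ht, hc⟩ := Finset.exists_superset_card_eq h (by simpa using hn.le)
  exact (admissible_iff.1 hΛ).2 t hc (supp_mono hJ (by exact_mod_cast ht))

/-- Weak hyperbolicity passes to subconfigurations, so removing a point can only destroy the Siegel
condition. -/
lemma Admissible.indispensable_iff {Λ : Config m n} (hΛ : Admissible Λ) (i : Fin n) :
    Indispensable Λ i ↔ {i}ᶜ ∉ Supp Λ := by
  refine not_congr ⟨fun h => h.1, fun h => ⟨h, fun J _ hJ => (admissible_iff.1 hΛ).2 J hJ⟩⟩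

lemma Admissible.mem_of_indispensable {Λ : Config m n} (hΛ : Admissible Λ) {i : Fin n}
    (hi : Indispensable Λ i) {I : Set (Fin n)} (hI : I ∈ Supp Λ) : i ∈ I := by
  by_contra h
  exact (hΛ.indispensable_iff i).1 hi (supp_mono hI fun j hj hji => h (by
    rw [Set.mem_singleton_iff] at hji
    exact hji ▸ hj))

lemma Admissible.exists_ne {Λ : Config m n} (hm : 0 < m) (hn : 2 * m < n) (hΛ : Admissible Λ)
    {I : Set (Fin n)} (hI : I ∈ Supp Λ) (i : Fin n) : ∃ j ∈ I, j ≠ i := by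
  by_contra! h
  have h1 : ((({i} : Finset (Fin n)) : Set (Fin n))) ∈ Supp Λ :=
    supp_mono hI fun j hj => by simp [h j hj]
  have := hΛ.lt_card hn h1
  simp at this
  omega

lemma mem_siegel_iff {Λ : Config m n} {z : Fin n → ℂ} :
    z ∈ siegel Λ ↔ {i | z i ≠ 0} ∈ Supp Λ := Iff.rfl

/-- A real linear form which is nonnegative on the `Λ_i`, `i ∈ I`, vanishes if `0` is in their
convex hull. -/
lemma Admissible.functional_eq_zero {Λ : Config m n} (hn : 2 * m < n) (hΛ : Admissible Λ)
    {I : Set (Fin n)} (hI : I ∈ Supp Λ) (f : (Fin m → ℂ) →ₗ[ℝ] ℝ) (hf : ∀ i ∈ I, 0 ≤ f (Λ i)) :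
    f = 0 := by
  classical
  by_contra hf0
  have hI' : (0 : Fin m → ℂ) ∈ convexHull ℝ (Λ '' I) := hI
  -- Carathéodory: `0` is a convex combination of affinely independent points. Applying `f`,
  -- nonnegative on them, shows that all positive weights sit on `ker f`.
  rw [convexHull_eq_union] at hI'
  simp only [Set.mem_iUnion] at hI'
  obtain ⟨t, htI, hti, h0⟩ := hI'
  obtain ⟨w, hw0, hw1, hw⟩ := Finset.mem_convexHull.1 h0
  rw [Finset.centerMass_eq_of_sum_1 _ _ hw1] at hw
  have hft : ∀ y ∈ t, 0 ≤ f y := by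
    intro y hy
    obtain ⟨i, hi, rfl⟩ := htI hy
    exact hf i hi
  have hsum : ∑ y ∈ t, w y * f y = 0 := by
    have := congrArg f hw
    simpa [map_sum] using this
  have hz : ∀ y ∈ t, w y * f y = 0 :=
    (Finset.sum_eq_zero_iff_of_nonneg fun y hy => mul_nonneg (hw0 y hy) (hft y hy)).1 hsum
  set t' := t.filter (fun y => f y = 0) with ht'
  have hwz : ∀ y ∈ t, y ∉ t' → w y = 0 := by
    intro y hy hy'
    have : f y ≠ 0 := fun h => hy' (by simp [ht', hy, h])
    exact (mul_eq_zero.1 (hz y hy)).resolve_right this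
  have h0' : (0 : Fin m → ℂ) ∈ convexHull ℝ (t' : Set (Fin m → ℂ)) := by
    have hs1 : ∑ y ∈ t', w y = 1 := by
      rw [← hw1]; exact Finset.sum_subset (Finset.filter_subset _ _) hwz
    refine Finset.mem_convexHull.2 ⟨w, fun y hy => hw0 y (Finset.filter_subset _ _ hy), hs1, ?_⟩
    rw [Finset.centerMass_eq_of_sum_1 _ _ hs1, ← hw]
    exact Finset.sum_subset (Finset.filter_subset _ _) fun y hy hy' => by simp [hwz y hy hy']
  have hti' : AffineIndependent ℝ (Subtype.val : t' → (Fin m → ℂ)) :=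
    AffineIndependent.mono (s := ((t' : Finset _) : Set (Fin m → ℂ))) hti
      (by exact_mod_cast Finset.filter_subset _ _)
  have hcard := hti'.card_le_finrank_succ
  -- Affinely independent points of `ker f`, of real dimension `2m - 1`, number at most `2m`, which
  -- `lt_card` excludes.
  have hspan : vectorSpan ℝ (Set.range (Subtype.val : t' → (Fin m → ℂ))) ≤ LinearMap.ker f := by
    rw [vectorSpan_def, Submodule.span_le]
    rintro _ ⟨a, ⟨a, rfl⟩, b, ⟨b, rfl⟩, rfl⟩
    have ha := (Finset.mem_filter.1 a.2).2
    have hb := (Finset.mem_filter.1 b.2).2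
    simp [ha, hb]
  have hfr := Submodule.finrank_mono hspan
  have hrange : LinearMap.range f = ⊤ := LinearMap.range_eq_top.2 (LinearMap.surjective hf0)
  have hrk := LinearMap.finrank_range_add_finrank_ker f
  rw [hrange, finrank_top, Module.finrank_self] at hrk
  have hdim : Module.finrank ℝ (Fin m → ℂ) = 2 * m := by
    simp [Module.finrank_pi_fintype, Complex.finrank_real_complex, mul_comm]
  rw [hdim] at hrk
  rw [Fintype.card_coe] at hcard
  have ht'I : ∀ y ∈ t', ∃ i ∈ I, Λ i = y := fun y hy => htI (Finset.filter_subset _ _ hy)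
  have : NeZero n := ⟨by omega⟩
  choose! g hgI hg using ht'I
  have hJ : ((t'.image g : Finset (Fin n)) : Set (Fin n)) ∈ Supp Λ := by
    refine convexHull_mono ?_ h0'
    intro y hy
    exact ⟨g y, by exact_mod_cast Finset.mem_image_of_mem g hy, hg y hy⟩
  have := hΛ.lt_card hn hJ
  have := (Finset.card_image_le (s := t') (f := g))
  omega

/-- The real linear form `Z ↦ Re ⟨Z, T⟩`. -/
def reForm (T : Fin m → ℂ) : (Fin m → ℂ) →ₗ[ℝ] ℝ where
  toFun Z := (Z ⬝ᵥ T).re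
  map_add' Z W := by simp [add_dotProduct]
  map_smul' r Z := by simp [smul_dotProduct]

@[simp] lemma reForm_apply (T Z : Fin m → ℂ) : reForm T Z = (Z ⬝ᵥ T).re := rfl

lemma eq_zero_of_reForm_eq_zero {T : Fin m → ℂ} (h : reForm T = 0) : T = 0 := by
  funext j
  have := LinearMap.congr_fun h (Pi.single j (starRingEnd ℂ (T j)))
  simp only [reForm_apply, single_dotProduct, LinearMap.zero_apply] at this
  rw [← Complex.normSq_eq_conj_mul_self, Complex.ofReal_re] at this
  simpa using this

/-- The form `Re ⟨·, T⟩` is constant on the points, so it or its negative is nonnegative there and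
`functional_eq_zero` applies. -/
lemma Admissible.eq_zero_of_re_const {Λ : Config m n} (hn : 2 * m < n) (hΛ : Admissible Λ)
    {I : Set (Fin n)} (hI : I ∈ Supp Λ) {r : ℝ} {T : Fin m → ℂ}
    (h : ∀ i ∈ I, r + (Λ i ⬝ᵥ T).re = 0) : r = 0 ∧ T = 0 := by
  have key : ∀ (r : ℝ) (T : Fin m → ℂ), r ≤ 0 → (∀ i ∈ I, r + (Λ i ⬝ᵥ T).re = 0) → T = 0 := by
    intro r T hr h
    refine eq_zero_of_reForm_eq_zero (hΛ.functional_eq_zero hn hI _ fun i hi => ?_)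
    have := h i hi
    simp only [reForm_apply]
    linarith
  have hT : T = 0 := by
    rcases le_total r 0 with hr | hr
    · exact key r T hr h
    · refine neg_eq_zero.1 (key (-r) (-T) (by linarith) fun i hi => ?_)
      have := h i hi
      simp only [dotProduct_neg, Complex.neg_re]
      linarith
  refine ⟨?_, hT⟩
  have hne : I.Nonempty := by
    rw [Set.nonempty_iff_ne_empty]
    rintro rfl
    simp [Supp] at hI
  obtain ⟨i, hi⟩ := hne
  simpa [hT] using h i hi

/-- Quantitative form of `eq_zero_of_re_const`: an injective linear map between finite-dimensional
spaces is antilipschitz. It bounds leaf parameters by their effect on one set of `Supp Λ`. -/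
lemma Admissible.exists_bound {Λ : Config m n} (hn : 2 * m < n) (hΛ : Admissible Λ)
    {I : Set (Fin n)} (hI : I ∈ Supp Λ) : ∃ K : ℝ, 0 < K ∧ ∀ (r : ℝ) (T : Fin m → ℂ) (M : ℝ), 0 ≤ M →
      (∀ i ∈ I, |r + (Λ i ⬝ᵥ T).re| ≤ M) → |r| ≤ K * M ∧ ∀ i, ‖Λ i ⬝ᵥ T‖ ≤ K * M := by
  classical
  let L : (ℝ × (Fin m → ℂ)) →ₗ[ℝ] (Fin n → ℝ) :=
    { toFun := fun p i => if i ∈ I then p.1 + (Λ i ⬝ᵥ p.2).re else 0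
      map_add' := fun p q => by
        funext i
        by_cases hi : i ∈ I <;> simp [hi, dotProduct_add]
        ring
      map_smul' := fun r p => by
        funext i
        by_cases hi : i ∈ I <;> simp [hi, dotProduct_smul]
        ring }
  have hker : LinearMap.ker L = ⊥ := by
    refine LinearMap.ker_eq_bot'.2 fun p hp => ?_
    have h := hΛ.eq_zero_of_re_const hn hI (r := p.1) (T := p.2) fun i hi => by
      have := congrFun hp i
      simpa [L, hi] using this
    exact Prod.ext h.1 h.2
  obtain ⟨K, hK, hL⟩ := L.exists_antilipschitzWith hker
  let D : (Fin m → ℂ) →L[ℂ] (Fin n → ℂ) := LinearMap.toContinuousLinearMap (Matrix.mulVecLin Λ)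
  have hD : ∀ T i, D T i = Λ i ⬝ᵥ T := fun T i => rfl
  refine ⟨K * (1 + ‖D‖), by positivity, fun r T M hM h => ?_⟩
  have h1 : ‖((r, T) : ℝ × (Fin m → ℂ))‖ ≤ K * M := by
    have h2 := hL.le_mul_dist (r, T) 0
    rw [map_zero, dist_zero_right, dist_zero_right] at h2
    refine h2.trans (mul_le_mul_of_nonneg_left ?_ K.2)
    refine (pi_norm_le_iff_of_nonneg hM).2 fun i => ?_
    by_cases hi : i ∈ I
    · simpa [L, hi] using h i hi
    · simpa [L, hi] using hM
  have hKM : 0 ≤ K * M := mul_nonneg K.2 hM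
  have hr : |r| ≤ K * M := (norm_fst_le ((r, T) : ℝ × (Fin m → ℂ))).trans h1
  have hT : ‖T‖ ≤ K * M := (norm_snd_le ((r, T) : ℝ × (Fin m → ℂ))).trans h1
  refine ⟨?_, fun i => ?_⟩
  · nlinarith [norm_nonneg D]
  · have := (norm_le_pi_norm (D T) i).trans (D.le_opNorm T)
    rw [hD] at this
    nlinarith [norm_nonneg D, mul_le_mul_of_nonneg_left hT (norm_nonneg D)]

/-- The set `Supp Λ` is locally constant on the set of admissible configurations. -/
lemma Admissible.eventually_supp_eq {Λ : Config m n} (hn : 2 * m < n) (hΛ : Admissible Λ) :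
    ∀ᶠ Λ' in 𝓝 Λ, Supp Λ' = Supp Λ := by
  have key : ∀ I : Set (Fin n), ∀ᶠ Λ' in 𝓝 Λ, I ∈ Supp Λ' ↔ I ∈ Supp Λ := by
    intro I
    by_cases hI : I ∈ Supp Λ
    -- Every `f` of norm one is negative at some `Λ i`, `i ∈ I`, by `functional_eq_zero`.
    -- Compactness of the dual sphere makes this persist for nearby configurations, where it forbids
    -- separating `0` from the hull.
    · have hK : IsCompact (Metric.sphere (0 : (Fin m → ℂ) →L[ℝ] ℝ) 1) := isCompact_sphere _ _
      have : ∀ᶠ Λ' in 𝓝 Λ, ∀ f ∈ Metric.sphere (0 : (Fin m → ℂ) →L[ℝ] ℝ) 1,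
          ∃ i ∈ I, f (Λ' i) < 0 := by
        refine hK.eventually_forall_of_forall_eventually fun f hf => ?_
        have hf0 : (f : (Fin m → ℂ) →ₗ[ℝ] ℝ) ≠ 0 := by
          intro h
          have : f = 0 := ContinuousLinearMap.coe_injective h
          simp [this] at hf
        have : ∃ i ∈ I, f (Λ i) < 0 := by
          by_contra! h
          exact hf0 (hΛ.functional_eq_zero hn hI _ h)
        obtain ⟨i, hi, hfi⟩ := this
        have hc : Continuous fun p : Config m n × ((Fin m → ℂ) →L[ℝ] ℝ) => p.2 (p.1 i) := by
          fun_prop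
        filter_upwards [hc.continuousAt.eventually_lt (continuousAt_const (y := (0 : ℝ))) hfi]
          with p hp using ⟨i, hi, hp⟩
      filter_upwards [this] with Λ' hΛ'
      refine iff_of_true ?_ hI
      by_contra h
      obtain ⟨f, u, hu, hf⟩ := geometric_hahn_banach_point_closed (convex_convexHull ℝ (Λ' '' I))
        (((Set.toFinite (Λ' '' I)).isClosed_convexHull ℝ)) h
      rw [map_zero] at hu
      have hpos : ∀ i ∈ I, 0 < f (Λ' i) := fun i hi =>
        hu.trans (hf _ (subset_convexHull _ _ ⟨i, hi, rfl⟩))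
      have hfne : f ≠ 0 := by
        rintro rfl
        have hne : I.Nonempty := by
          rw [Set.nonempty_iff_ne_empty]
          rintro rfl
          simp [Supp] at hI
        obtain ⟨i, hi⟩ := hne
        simpa using hpos i hi
      obtain ⟨i, hi, hlt⟩ := hΛ' (‖f‖⁻¹ • f) (by simp [norm_smul, hfne])
      have : 0 < ‖f‖⁻¹ * f (Λ' i) := mul_pos (by positivity) (hpos i hi)
      simp at hlt
      linarith
    -- Strict separation of `0` from finitely many points persists nearby.
    · obtain ⟨f, u, hu, hf⟩ := geometric_hahn_banach_point_closed (convex_convexHull ℝ (Λ '' I))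
        (((Set.toFinite (Λ '' I)).isClosed_convexHull ℝ)) hI
      rw [map_zero] at hu
      have hev : ∀ i : Fin n, ∀ᶠ Λ' in 𝓝 Λ, i ∈ I → 0 < f (Λ' i) := by
        intro i
        by_cases hi : i ∈ I
        · have hc : Continuous fun Λ' : Config m n => f (Λ' i) := by fun_prop
          filter_upwards [(continuousAt_const (y := (0 : ℝ))).eventually_lt hc.continuousAt
            (hu.trans (hf _ (subset_convexHull _ _ ⟨i, hi, rfl⟩)))] with Λ' h _ using h
        · exact Filter.Eventually.of_forall fun _ h => absurd h hi
      filter_upwards [Filter.eventually_all.2 hev] with Λ' hΛ'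
      refine iff_of_false (fun h => ?_) hI
      have hsub : convexHull ℝ (Λ' '' I) ⊆ {Z | 0 < f Z} := by
        refine convexHull_min ?_ (convex_halfSpace_gt f.toLinearMap.isLinear 0)
        rintro _ ⟨i, hi, rfl⟩
        exact hΛ' i hi
      simpa using hsub h
  filter_upwards [Filter.eventually_all.2 key] with Λ' h using Set.ext h

/-! ### The exponential description of the groups `G_Λ` -/

/-- The coordinatewise exponential `ℂ^n → (ℂ^*)^n`. -/
noncomputable def torusExp (x : Fin n → ℂ) : Fin n → ℂˣ :=
  fun i => Units.mk0 (Complex.exp (x i)) (Complex.exp_ne_zero _)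

@[simp] lemma torusExp_val (x : Fin n → ℂ) (i : Fin n) :
    ((torusExp x i : ℂˣ) : ℂ) = Complex.exp (x i) := rfl

lemma torusExp_sub (x y : Fin n → ℂ) : torusExp (x - y) = torusExp x * (torusExp y)⁻¹ := by
  funext i; ext; simp [Complex.exp_sub, div_eq_mul_inv]

lemma torusExp_nsmul (k : ℕ) (x : Fin n → ℂ) : torusExp (k • x) = torusExp x ^ k := by
  funext i; ext; simp [← Complex.exp_nat_mul]

lemma torusExp_surjective : Function.Surjective (torusExp : (Fin n → ℂ) → _) := fun u =>
  ⟨fun i => Complex.log (u i), by funext i; ext; simp [Complex.exp_log]⟩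

/-- The tangent space `{(c + ⟨Λ_i, T⟩)_i}` of the group `leafGroup Λ`. -/
def leafSpace (Λ : Config m n) : Submodule ℂ (Fin n → ℂ) where
  carrier := {x | ∃ (c : ℂ) (T : Fin m → ℂ), ∀ i, x i = c + Λ i ⬝ᵥ T}
  zero_mem' := ⟨0, 0, fun i => by simp⟩
  add_mem' := by
    rintro x y ⟨c, T, hx⟩ ⟨d, S, hy⟩
    exact ⟨c + d, T + S, fun i => by simp only [Pi.add_apply, hx i, hy i, dotProduct_add]; ring⟩
  smul_mem' := by
    rintro a x ⟨c, T, hx⟩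
    exact ⟨a * c, a • T, fun i => by
      simp only [Pi.smul_apply, hx i, dotProduct_smul, smul_eq_mul]; ring⟩

lemma const_mem_leafSpace (Λ : Config m n) {x : Fin n → ℂ} {c : ℂ} (h : ∀ i, x i = c) :
    x ∈ leafSpace Λ := ⟨c, 0, fun i => by simp [h i]⟩

lemma mem_leafGroup_iff {Λ : Config m n} {u : Fin n → ℂˣ} :
    u ∈ leafGroup Λ ↔ ∃ x ∈ leafSpace Λ, torusExp x = u := by
  constructor
  · rintro ⟨c, T, h⟩
    refine ⟨fun i => Complex.log c + Λ i ⬝ᵥ T, ⟨_, T, fun i => rfl⟩, ?_⟩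
    funext i
    ext
    rw [h i, torusExp_val, Complex.exp_add, Complex.exp_log (Units.ne_zero c)]
    rfl
  · rintro ⟨x, ⟨c, T, h⟩, rfl⟩
    refine ⟨Units.mk0 (Complex.exp c) (Complex.exp_ne_zero _), T, fun i => ?_⟩
    rw [torusExp_val, h i, Complex.exp_add]
    rfl

lemma torusExp_mem {Λ : Config m n} {x : Fin n → ℂ} (hx : x ∈ leafSpace Λ) :
    torusExp x ∈ leafGroup Λ := mem_leafGroup_iff.2 ⟨x, hx, rfl⟩

/-- The class in `G_Λ` of a point of the torus. -/
def toG (Λ : Config m n) : (Fin n → ℂˣ) →* G Λ := QuotientGroup.mk' (leafGroup Λ)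

lemma toG_surjective (Λ : Config m n) : Function.Surjective (toG Λ) :=
  QuotientGroup.mk'_surjective _

lemma toG_eq_one {Λ : Config m n} {u : Fin n → ℂˣ} : toG Λ u = 1 ↔ u ∈ leafGroup Λ :=
  QuotientGroup.eq_one_iff u

lemma toG_smul_proj (Λ : Config m n) (u : Fin n → ℂˣ) (z : siegel Λ) :
    toG Λ u • proj Λ z = proj Λ (u • z) := rfl

/-- Replacing `T` by `-I T` turns imaginary parts into real parts, so `eq_zero_of_re_const` gives `T
= 0`. -/
lemma Admissible.const_of_im_eq_zero {Λ : Config m n} (hn : 2 * m < n) (hΛ : Admissible Λ)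
    {I : Set (Fin n)} (hI : I ∈ Supp Λ) {x : Fin n → ℂ} (hx : x ∈ leafSpace Λ)
    (h : ∀ i ∈ I, (x i).im = 0) : ∃ c : ℂ, ∀ i, x i = c := by
  obtain ⟨c, T, hx⟩ := hx
  have := hΛ.eq_zero_of_re_const hn hI (r := c.im) (T := (-Complex.I) • T) fun i hi => by
    have := h i hi
    rw [hx i] at this
    simpa [dotProduct_smul] using this
  have hT : T = 0 := by simpa using this.2
  exact ⟨c, fun i => by simp [hx i, hT]⟩

/-- Small real parts on `I` force a small `T` by `exists_bound`; the differences of the periods are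
then multiples of `2πi` too small to be nonzero. This lets relations modulo the leaf group be lifted
to `ℂ^n`. -/
lemma Admissible.exists_discrete {Λ : Config m n} (hn : 2 * m < n) (hΛ : Admissible Λ)
    {I : Set (Fin n)} (hI : I ∈ Supp Λ) : ∃ ε : ℝ, 0 < ε ∧ ∀ v ∈ leafSpace Λ, ∀ p : Fin n → ℤ,
      (∀ i ∈ I, ‖v i + p i * (2 * Real.pi * Complex.I)‖ < ε) → ∃ c, ∀ i ∈ I, p i = c := by
  obtain ⟨K, hK, hb⟩ := hΛ.exists_bound hn hI
  -- Two terms below `ε` and two terms at most `K ε` will add up to less than `2`, hence less than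
  -- `2π`.
  refine ⟨1 / (1 + K), by positivity, ?_⟩
  rintro v ⟨c, T, hv⟩ p hp
  have hre : ∀ i ∈ I, |c.re + (Λ i ⬝ᵥ T).re| ≤ 1 / (1 + K) := by
    intro i hi
    have := (Complex.abs_re_le_norm _).trans (hp i hi).le
    rw [hv i] at this
    simpa using this
  have hT := (hb c.re T _ (by positivity) hre).2
  have hne : I.Nonempty := by
    rw [Set.nonempty_iff_ne_empty]
    rintro rfl
    simp [Supp] at hI
  obtain ⟨i, hi⟩ := hne
  refine ⟨p i, fun j hj => ?_⟩
  have h1 : ((p j - p i : ℤ) : ℂ) * (2 * Real.pi * Complex.I) =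
      (v j + p j * (2 * Real.pi * Complex.I)) - (v i + p i * (2 * Real.pi * Complex.I)) +
        (Λ i ⬝ᵥ T - Λ j ⬝ᵥ T) := by
    rw [hv i, hv j]; push_cast; ring
  have h2 : ‖((p j - p i : ℤ) : ℂ) * (2 * Real.pi * Complex.I)‖ < 2 := by
    rw [h1]
    refine (norm_add_le _ _).trans_lt ?_
    have e1 := norm_sub_le (v j + p j * (2 * Real.pi * Complex.I))
      (v i + p i * (2 * Real.pi * Complex.I))
    have e2 := norm_sub_le (Λ i ⬝ᵥ T) (Λ j ⬝ᵥ T)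
    have e3 := hp i hi
    have e4 := hp j hj
    have e5 := hT i
    have e6 := hT j
    have e7 : 2 * (1 / (1 + K)) + 2 * (K * (1 / (1 + K))) = 2 := by field_simp
    linarith
  have h3 : ‖((p j - p i : ℤ) : ℂ)‖ < 1 := by
    rw [norm_mul] at h2
    have : ‖(2 * Real.pi * Complex.I : ℂ)‖ = 2 * Real.pi := by
      simp [abs_of_pos Real.pi_pos]
    rw [this] at h2
    have := Real.pi_gt_three
    by_contra! h
    nlinarith
  rw [Complex.norm_intCast] at h3
  have : |p j - p i| < 1 := by exact_mod_cast h3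
  have := Int.abs_lt_one_iff.1 this
  omega

/-- For one small `t > 0`, `exists_discrete` makes the periods between `t y` and `v` constant on
`I`; constants lie in the leaf space, and one divides by `t`. -/
lemma Admissible.exists_leafSpace_eq {Λ : Config m n} (hn : 2 * m < n) (hΛ : Admissible Λ)
    {I : Set (Fin n)} (hI : I ∈ Supp Λ) {y : Fin n → ℂ}
    (h : ∀ t : ℂ, ∃ v ∈ leafSpace Λ, ∀ i ∈ I, Complex.exp (t * y i) = Complex.exp (v i)) :
    ∃ v ∈ leafSpace Λ, ∀ i ∈ I, y i = v i := by
  obtain ⟨ε, hε, hd⟩ := hΛ.exists_discrete hn hI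
  obtain ⟨t, ht0, ht⟩ : ∃ t : ℝ, 0 < t ∧ t * ‖y‖ < ε :=
    ⟨ε / (2 * (1 + ‖y‖)), by positivity, by
      rw [div_mul_eq_mul_div, div_lt_iff₀ (by positivity)]
      nlinarith [norm_nonneg y]⟩
  obtain ⟨v, hv, hvt⟩ := h t
  have : ∀ i, ∃ p : ℤ, i ∈ I → t * y i = v i + p * (2 * Real.pi * Complex.I) := by
    intro i
    by_cases hi : i ∈ I
    · obtain ⟨p, hp⟩ := Complex.exp_eq_exp_iff_exists_int.1 (hvt i hi)
      exact ⟨p, fun _ => hp⟩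
    · exact ⟨0, fun h => absurd h hi⟩
  choose p hp using this
  obtain ⟨c, hc⟩ := hd v hv p fun i hi => by
    rw [← hp i hi, norm_mul, Complex.norm_real, Real.norm_of_nonneg ht0.le]
    exact (mul_le_mul_of_nonneg_left (norm_le_pi_norm y i) ht0.le).trans_lt ht
  have ht' : (t : ℂ) ≠ 0 := by exact_mod_cast ht0.ne'
  refine ⟨(t : ℂ)⁻¹ • (v + fun _ => c * (2 * Real.pi * Complex.I)),
    Submodule.smul_mem _ _ (add_mem hv (const_mem_leafSpace _ fun _ => rfl)), fun i hi => ?_⟩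
  simp only [Pi.smul_apply, Pi.add_apply, smul_eq_mul]
  rw [← hc i hi, ← hp i hi, inv_mul_cancel_left₀ ht']

/-- Integer vectors are real, so `const_of_im_eq_zero` applies. Relations modulo the leaf space
thereby become relations between integers. -/
lemma Admissible.int_const {Λ : Config m n} (hn : 2 * m < n) (hΛ : Admissible Λ)
    {I : Set (Fin n)} (hI : I ∈ Supp Λ) {a : Fin n → ℤ}
    (h : ∃ v ∈ leafSpace Λ, ∀ i ∈ I, (a i : ℂ) = v i) : ∃ c, ∀ i ∈ I, a i = c := by
  obtain ⟨v, hv, hav⟩ := h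
  obtain ⟨c, hc⟩ := hΛ.const_of_im_eq_zero hn hI hv fun i hi => by simp [← hav i hi]
  have hne : I.Nonempty := by
    rw [Set.nonempty_iff_ne_empty]
    rintro rfl
    simp [Supp] at hI
  obtain ⟨i, hi⟩ := hne
  refine ⟨a i, fun j hj => ?_⟩
  have : (a j : ℂ) = a i := by rw [hav i hi, hav j hj, hc i, hc j]
  exact_mod_cast this

lemma Admissible.mem_leafSpace_of_torusExp {Λ : Config m n} (hn : 2 * m < n) (hΛ : Admissible Λ)
    {y : Fin n → ℂ} (h : ∀ t : ℂ, torusExp (t • y) ∈ leafGroup Λ) : y ∈ leafSpace Λ := by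
  obtain ⟨v, hv, hyv⟩ := hΛ.exists_leafSpace_eq hn hΛ.univ_mem (y := y) fun t => by
    obtain ⟨v, hv, hvt⟩ := mem_leafGroup_iff.1 (h t)
    refine ⟨v, hv, fun i _ => ?_⟩
    have := congrArg (fun u : Fin n → ℂˣ => (u i : ℂ)) hvt
    simpa using this.symm
  have : y = v := funext fun i => hyv i trivial
  exact this ▸ hv

/-! ### Monomial maps -/

/-- The action of an integer matrix on `ℂ^n`. -/
def complexify (g : Matrix (Fin n) (Fin n) ℤ) : Matrix (Fin n) (Fin n) ℂ :=
  (Int.castRingHom ℂ).mapMatrix g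

@[simp] lemma complexify_apply (g : Matrix (Fin n) (Fin n) ℤ) (i j : Fin n) :
    complexify g i j = g i j := rfl

lemma complexify_mul (g h : Matrix (Fin n) (Fin n) ℤ) :
    complexify (g * h) = complexify g * complexify h := map_mul _ _ _

@[simp] lemma complexify_one : complexify (1 : Matrix (Fin n) (Fin n) ℤ) = 1 := map_one _

lemma complexify_mulVec_apply (g : Matrix (Fin n) (Fin n) ℤ) (x : Fin n → ℂ) (j : Fin n) :
    (complexify g).mulVec x j = ∑ i, (g j i : ℂ) * x i := rfl

lemma complexify_mulVec_intCast (g : Matrix (Fin n) (Fin n) ℤ) (a : Fin n → ℤ) :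
    (complexify g).mulVec (fun i => (a i : ℂ)) = fun i => ((g.mulVec a i : ℤ) : ℂ) := by
  funext j
  simp [Matrix.mulVec, dotProduct]

/-- The monomial endomorphism of the torus defined by an integer matrix. -/
def torusMap (g : Matrix (Fin n) (Fin n) ℤ) : (Fin n → ℂˣ) →* (Fin n → ℂˣ) where
  toFun u j := ∏ i, u i ^ g j i
  map_one' := by funext j; simp
  map_mul' u v := by funext j; simp [mul_zpow, Finset.prod_mul_distrib]

lemma torusMap_apply (g : Matrix (Fin n) (Fin n) ℤ) (u : Fin n → ℂˣ) (j : Fin n) :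
    torusMap g u j = ∏ i, u i ^ g j i := rfl

lemma torusMap_exp (g : Matrix (Fin n) (Fin n) ℤ) (x : Fin n → ℂ) :
    torusMap g (torusExp x) = torusExp ((complexify g).mulVec x) := by
  funext j
  ext
  rw [torusMap_apply, torusExp_val, complexify_mulVec_apply, Complex.exp_sum, Units.coe_prod]
  refine Finset.prod_congr rfl fun i _ => ?_
  rw [Units.val_zpow_eq_zpow_val, torusExp_val, ← Complex.exp_int_mul]

lemma torusMap_mul (g h : Matrix (Fin n) (Fin n) ℤ) (u : Fin n → ℂˣ) :
    torusMap (g * h) u = torusMap g (torusMap h u) := by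
  obtain ⟨x, rfl⟩ := torusExp_surjective u
  rw [torusMap_exp, torusMap_exp, torusMap_exp, complexify_mul, Matrix.mulVec_mulVec]

@[simp] lemma torusMap_one (u : Fin n → ℂˣ) : torusMap 1 u = u := by
  obtain ⟨x, rfl⟩ := torusExp_surjective u
  rw [torusMap_exp, complexify_one, Matrix.one_mulVec]

lemma torusMap_mem {Λ Λ' : Config m n} {g : Matrix (Fin n) (Fin n) ℤ}
    (hg : ∀ x ∈ leafSpace Λ, (complexify g).mulVec x ∈ leafSpace Λ') {u : Fin n → ℂˣ}
    (hu : u ∈ leafGroup Λ) : torusMap g u ∈ leafGroup Λ' := by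
  obtain ⟨x, hx, rfl⟩ := mem_leafGroup_iff.1 hu
  rw [torusMap_exp]
  exact torusExp_mem (hg x hx)

lemma Admissible.mulVec_mem_leafSpace {Λ Λ' : Config m n} (hn : 2 * m < n) (hΛ' : Admissible Λ')
    {g : Matrix (Fin n) (Fin n) ℤ} (hg : ∀ u ∈ leafGroup Λ, torusMap g u ∈ leafGroup Λ')
    {x : Fin n → ℂ} (hx : x ∈ leafSpace Λ) : (complexify g).mulVec x ∈ leafSpace Λ' := by
  refine hΛ'.mem_leafSpace_of_torusExp hn fun t => ?_
  rw [← Matrix.mulVec_smul, ← torusMap_exp]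
  exact hg _ (torusExp_mem (Submodule.smul_mem _ t hx))

/-- The integer matrix `g` induces the identity of `ℂ^n / ℂ (1, …, 1)`. -/
def IsScalarTrivial (g : Matrix (Fin n) (Fin n) ℤ) : Prop :=
  ∀ x : Fin n → ℂ, ∃ c : ℂ, ∀ i, (complexify g).mulVec x i = x i + c

lemma IsScalarTrivial.exists_int {g : Matrix (Fin n) (Fin n) ℤ} (hg : IsScalarTrivial g)
    (a : Fin n → ℤ) : ∃ c : ℤ, ∀ i, g.mulVec a i = a i + c := by
  obtain ⟨c, hc⟩ := hg fun i => a i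
  simp only [complexify_mulVec_intCast] at hc
  rcases isEmpty_or_nonempty (Fin n) with h | ⟨⟨i⟩⟩
  · exact ⟨0, fun i => h.elim i⟩
  · refine ⟨g.mulVec a i - a i, fun j => ?_⟩
    have h1 := hc i
    have h2 := hc j
    have : ((g.mulVec a j : ℤ) : ℂ) = ((a j + (g.mulVec a i - a i) : ℤ) : ℂ) := by
      push_cast
      rw [h1, h2]; ring
    exact_mod_cast this

lemma isScalarTrivial_of_single {g : Matrix (Fin n) (Fin n) ℤ}
    (h : ∀ j, ∃ c : ℂ, ∀ i, (g i j : ℂ) = (if i = j then 1 else 0) + c) : IsScalarTrivial g := by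
  choose c hc using h
  refine fun x => ⟨∑ j, c j * x j, fun i => ?_⟩
  rw [complexify_mulVec_apply]
  simp [hc, add_mul, Finset.sum_add_distrib]

/-- Testing on the one-parameter groups of the basis vectors puts each column of `g - 1` in the leaf
space; integrality makes it constant. -/
lemma Admissible.isScalarTrivial_iff {Λ : Config m n} (hn : 2 * m < n) (hΛ : Admissible Λ)
    {g : Matrix (Fin n) (Fin n) ℤ} :
    IsScalarTrivial g ↔ ∀ u, toG Λ (torusMap g u) = toG Λ u := by
  have key : ∀ u, toG Λ (torusMap g u) = toG Λ u ↔ torusMap g u * u⁻¹ ∈ leafGroup Λ := by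
    intro u
    rw [← toG_eq_one, map_mul, map_inv, mul_inv_eq_one]
  constructor
  · intro h u
    rw [key]
    obtain ⟨x, rfl⟩ := torusExp_surjective u
    obtain ⟨c, hc⟩ := h x
    rw [torusMap_exp, ← torusExp_sub]
    exact torusExp_mem (const_mem_leafSpace Λ (c := c) fun i => by simp [hc i])
  · intro h
    refine isScalarTrivial_of_single fun j => ?_
    have h1 : (fun i => (((g - 1) i j : ℤ) : ℂ)) ∈ leafSpace Λ := by
      refine hΛ.mem_leafSpace_of_torusExp hn fun t => ?_
      have := (key (torusExp (t • Pi.single j 1))).1 (h _)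
      rw [torusMap_exp, ← torusExp_sub, Matrix.mulVec_smul, ← smul_sub] at this
      convert this using 3
      funext i
      simp [Matrix.one_apply, Pi.single_apply]
    obtain ⟨c, hc⟩ := hΛ.int_const hn hΛ.univ_mem ⟨_, h1, fun i _ => rfl⟩
    refine ⟨c, fun i => ?_⟩
    have := hc i trivial
    rw [← this, Matrix.sub_apply, Matrix.one_apply]
    split_ifs <;> simp

/-! ### Holomorphic homomorphisms are monomial -/

/-- The logarithm `φ` of a local lift is compatible with halving modulo the leaf space. Its
derivative `L` at `0` therefore induces `ψ`, and the periods of the exponential make the columns of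
`L` integral modulo the leaf space. -/
lemma Admissible.exists_torusMap_of_holomorphic {Λ Λ' : Config m n} (hn : 2 * m < n)
    (hΛ' : Admissible Λ') (ψ : G Λ →* G Λ') (hψ : HolomorphicG Λ Λ' ψ) :
    ∃ g : Matrix (Fin n) (Fin n) ℤ, ∀ u, ψ (toG Λ u) = toG Λ' (torusMap g u) := by
  obtain ⟨O, hO, f, hf, hlift⟩ := hψ.2 1
  set e : (Fin n → ℂ) → Fin n → ℂ := fun x i => Complex.exp (x i) with he
  have he0 : e 0 = fun i => (((1 : Fin n → ℂˣ) i : ℂˣ) : ℂ) := by funext i; simp [he]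
  have hecont : Continuous e := by fun_prop
  have hO' : ∀ᶠ x in 𝓝 (0 : Fin n → ℂ), e x ∈ O := by
    refine hecont.continuousAt ?_
    rw [he0]; exact hO
  obtain ⟨u₁, hu₁, hψ₁⟩ := hlift 1 (mem_of_mem_nhds hO)
  have hu₁' : toG Λ' u₁ = 1 := hψ₁.symm.trans (map_one ψ)
  set φ : (Fin n → ℂ) → Fin n → ℂ := fun x i => Complex.log (f (e x) i / f (e 0) i) with hφ
  have hfe0 : ∀ i, f (e 0) i = u₁ i := fun i => by
    rw [he0]; exact (congrFun hu₁ i).symm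
  have hφ0 : φ 0 = 0 := by
    funext i
    simp [hφ, hfe0]
  have hψφ : ∀ᶠ x in 𝓝 (0 : Fin n → ℂ), ψ (toG Λ (torusExp x)) = toG Λ' (torusExp (φ x)) := by
    filter_upwards [hO'] with x hx
    obtain ⟨y, hy, hψy⟩ := hlift (torusExp x) hx
    have : torusExp (φ x) = y * u₁⁻¹ := by
      funext i
      ext
      have hyi : f (e x) i = y i := (congrFun hy i).symm
      rw [torusExp_val, hφ]
      simp only
      rw [hyi, hfe0, Complex.exp_log (div_ne_zero (Units.ne_zero _) (Units.ne_zero _))]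
      simp [div_eq_mul_inv]
    rw [this, map_mul, map_inv, hu₁', inv_one]
    exact hψy.trans (mul_one (toG Λ' y)).symm
  have hφd : DifferentiableAt ℂ φ 0 := by
    have hfd : DifferentiableAt ℂ f (e 0) := by
      rw [he0]
      exact hf.differentiableAt hO
    have hed : DifferentiableAt ℂ e 0 := by
      refine differentiableAt_pi.2 fun i => ?_
      have : DifferentiableAt ℂ (fun x : Fin n → ℂ => x i) 0 := by fun_prop
      exact this.cexp
    have hcomp : DifferentiableAt ℂ (fun x => f (e x)) 0 := hfd.comp 0 hed
    refine differentiableAt_pi.2 fun i => ?_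
    have h0 : DifferentiableAt ℂ (fun x => f (e x) i) 0 := (differentiableAt_pi.1 hcomp) i
    have h1 : DifferentiableAt ℂ (fun x => f (e x) i / f (e 0) i) 0 := by
      simp only [div_eq_mul_inv]
      exact h0.mul_const _
    refine h1.clog ?_
    rw [div_self (by rw [hfe0]; exact Units.ne_zero _)]
    exact Complex.one_mem_slitPlane
  obtain ⟨L, hL⟩ := hφd
  obtain ⟨ε, hε, hdisc⟩ := hΛ'.exists_discrete hn hΛ'.univ_mem
  have hhalf : Filter.Tendsto (fun x : Fin n → ℂ => (2 : ℂ)⁻¹ • x) (𝓝 0) (𝓝 0) := by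
    have : Continuous fun x : Fin n → ℂ => (2 : ℂ)⁻¹ • x := by fun_prop
    simpa using this.tendsto 0
  have hφc : Filter.Tendsto φ (𝓝 0) (𝓝 0) := by
    have := hL.continuousAt.tendsto
    rwa [hφ0] at this
  -- This difference exponentiates into the leaf group and tends to `0`, so `exists_discrete` places
  -- it in the leaf space.
  have hstep : ∀ᶠ x in 𝓝 (0 : Fin n → ℂ), φ x - (2 : ℂ) • φ ((2 : ℂ)⁻¹ • x) ∈ leafSpace Λ' := by
    have hsmall : Filter.Tendsto (fun x => φ x - (2 : ℂ) • φ ((2 : ℂ)⁻¹ • x)) (𝓝 0) (𝓝 0) := by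
      have := hφc.sub ((hφc.comp hhalf).const_smul (2 : ℂ))
      simpa using this
    have hsm : ∀ᶠ x in 𝓝 (0 : Fin n → ℂ), ‖φ x - (2 : ℂ) • φ ((2 : ℂ)⁻¹ • x)‖ < ε := by
      have := hsmall (Metric.ball_mem_nhds 0 hε)
      filter_upwards [this] with x hx
      simpa using hx
    filter_upwards [hψφ, hhalf hψφ, hsm] with x hx hx2 hxs
    have h1 : torusExp (φ x - (2 : ℂ) • φ ((2 : ℂ)⁻¹ • x)) ∈ leafGroup Λ' := by
      rw [← toG_eq_one, torusExp_sub, map_mul, map_inv, mul_inv_eq_one]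
      have e2 : ((2 : ℂ) • φ ((2 : ℂ)⁻¹ • x)) = (2 : ℕ) • φ ((2 : ℂ)⁻¹ • x) := by
        rw [← Nat.cast_smul_eq_nsmul ℂ]; norm_num
      have e3 : torusExp x = torusExp ((2 : ℂ)⁻¹ • x) ^ 2 := by
        rw [← torusExp_nsmul, ← Nat.cast_smul_eq_nsmul ℂ, smul_smul]; norm_num
      have hx2' : ψ (toG Λ (torusExp ((2 : ℂ)⁻¹ • x))) =
        toG Λ' (torusExp (φ ((2 : ℂ)⁻¹ • x))) := hx2
      rw [e2, torusExp_nsmul, map_pow, ← hx, ← hx2', e3, map_pow, map_pow]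
    obtain ⟨v, hv, hvx⟩ := mem_leafGroup_iff.1 h1
    have : ∀ i, ∃ p : ℤ, (φ x - (2 : ℂ) • φ ((2 : ℂ)⁻¹ • x)) i =
        v i + p * (2 * Real.pi * Complex.I) := fun i => by
      have := congrArg (fun u : Fin n → ℂˣ => (u i : ℂ)) hvx
      exact Complex.exp_eq_exp_iff_exists_int.1 this.symm
    choose p hp using this
    obtain ⟨c, hc⟩ := hdisc v hv p fun i _ => by
      rw [← hp i]
      exact (norm_le_pi_norm _ i).trans_lt hxs
    have : φ x - (2 : ℂ) • φ ((2 : ℂ)⁻¹ • x) = v + fun _ => c * (2 * Real.pi * Complex.I) := by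
      funext i
      rw [hp i, hc i trivial]; rfl
    rw [this]
    exact add_mem hv (const_mem_leafSpace _ fun _ => rfl)
  obtain ⟨δ, hδ, hball⟩ := Metric.eventually_nhds_iff_ball.1 (hstep.and hψφ)
  have hscale : ∀ x ∈ Metric.ball (0 : Fin n → ℂ) δ, ∀ k : ℕ,
      ((2 : ℂ) ^ k)⁻¹ • x ∈ Metric.ball (0 : Fin n → ℂ) δ := by
    intro x hx k
    rw [mem_ball_zero_iff] at hx ⊢
    rw [norm_smul, norm_inv, norm_pow, Complex.norm_ofNat]
    refine lt_of_le_of_lt ?_ hx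
    exact mul_le_of_le_one_left (norm_nonneg _) (inv_le_one_of_one_le₀ (one_le_pow₀ (by norm_num)))
  have hφL : ∀ x ∈ Metric.ball (0 : Fin n → ℂ) δ, φ x - L x ∈ leafSpace Λ' := by
    intro x hx
    -- Modulo the leaf space, which is closed, `2 ^ k φ(x / 2 ^ k)` does not depend on `k`, and it
    -- tends to `L x`.
    have hk : ∀ k : ℕ, φ x - (2 : ℂ) ^ k • φ (((2 : ℂ) ^ k)⁻¹ • x) ∈ leafSpace Λ' := by
      intro k
      induction k with
      | zero => simp
      | succ k ih =>
        have h1 := Submodule.smul_mem _ ((2 : ℂ) ^ k) (hball _ (hscale x hx k)).1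
        have h2 := add_mem ih h1
        convert h2 using 1
        rw [smul_sub, smul_smul, smul_smul, ← pow_succ, pow_succ', mul_inv]
        abel
    have hlim := hL.lim x (c := fun k : ℕ => (2 : ℂ) ^ k) (l := Filter.atTop) (by
      simp only [norm_pow, Complex.norm_ofNat]
      exact tendsto_pow_atTop_atTop_of_one_lt (by norm_num))
    simp only [zero_add, hφ0, sub_zero] at hlim
    have hcl : IsClosed (leafSpace Λ' : Set (Fin n → ℂ)) := Submodule.closed_of_finiteDimensional _
    exact hcl.mem_of_tendsto ((tendsto_const_nhds (x := φ x)).sub hlim)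
      (Filter.Eventually.of_forall hk)
  have hψL : ∀ x : Fin n → ℂ, ψ (toG Λ (torusExp x)) = toG Λ' (torusExp (L x)) := by
    intro x
    obtain ⟨k, hk⟩ : ∃ k : ℕ, ((2 : ℂ) ^ k)⁻¹ • x ∈ Metric.ball (0 : Fin n → ℂ) δ := by
      have : Filter.Tendsto (fun k : ℕ => ((2 : ℂ)⁻¹ ^ k) • x) Filter.atTop (𝓝 ((0 : ℂ) • x)) :=
        (tendsto_pow_atTop_nhds_zero_of_norm_lt_one (by norm_num)).smul_const x
      rw [zero_smul] at this
      obtain ⟨k, hk⟩ := (this.eventually (Metric.ball_mem_nhds 0 hδ)).exists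
      exact ⟨k, by rwa [← inv_pow]⟩
    set y := ((2 : ℂ) ^ k)⁻¹ • x with hy
    have hxy : x = (2 ^ k : ℕ) • y := by
      rw [← Nat.cast_smul_eq_nsmul ℂ, hy, smul_smul]
      push_cast
      rw [mul_inv_cancel₀ (pow_ne_zero _ two_ne_zero), one_smul]
    have h1 : ψ (toG Λ (torusExp y)) = toG Λ' (torusExp (L y)) := by
      rw [(hball y hk).2]
      have := toG_eq_one.2 (torusExp_mem (hφL y hk))
      rwa [torusExp_sub, map_mul, map_inv, mul_inv_eq_one] at this
    rw [hxy, torusExp_nsmul, map_pow, map_pow, h1, map_nsmul, torusExp_nsmul, map_pow]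
  -- The vector `2πi e_i` exponentiates to `1`, so its image under `L` is a period modulo the leaf
  -- space.
  have hcol : ∀ i : Fin n, ∃ a : Fin n → ℤ,
      L (Pi.single i 1) - (fun j => (a j : ℂ)) ∈ leafSpace Λ' := by
    intro i
    have h1 : torusExp (Pi.single i (2 * Real.pi * Complex.I) : Fin n → ℂ) = 1 := by
      funext j
      ext
      rcases eq_or_ne j i with rfl | hj
      · simp [Complex.exp_two_pi_mul_I]
      · simp [hj]
    have h2 := hψL (Pi.single i (2 * Real.pi * Complex.I))
    rw [h1, map_one, map_one] at h2
    obtain ⟨v, hv, hvx⟩ := mem_leafGroup_iff.1 (toG_eq_one.1 h2.symm)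
    have : ∀ j, ∃ p : ℤ, L (Pi.single i (2 * Real.pi * Complex.I)) j =
        v j + p * (2 * Real.pi * Complex.I) := fun j => by
      have := congrArg (fun u : Fin n → ℂˣ => (u j : ℂ)) hvx
      exact Complex.exp_eq_exp_iff_exists_int.1 this.symm
    choose p hp using this
    refine ⟨p, ?_⟩
    have h3 : (Pi.single i (2 * Real.pi * Complex.I) : Fin n → ℂ) =
        (2 * Real.pi * Complex.I) • Pi.single i 1 := by
      rw [← Pi.single_smul]; simp
    have hne : (2 * Real.pi * Complex.I : ℂ) ≠ 0 := Complex.two_pi_I_ne_zero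
    have h4 : L (Pi.single i 1) - (fun j => (p j : ℂ)) = (2 * Real.pi * Complex.I : ℂ)⁻¹ • v := by
      funext j
      have := hp j
      rw [h3, map_smul] at this
      simp only [Pi.smul_apply, smul_eq_mul, Pi.sub_apply] at this ⊢
      rw [eq_inv_mul_iff_mul_eq₀ hne, mul_sub, this]
      ring
    rw [h4]
    exact Submodule.smul_mem _ _ hv
  choose a ha using hcol
  refine ⟨Matrix.of fun j i => a i j, fun u => ?_⟩
  obtain ⟨x, rfl⟩ := torusExp_surjective u
  rw [hψL, torusMap_exp, ← mul_inv_eq_one, ← map_inv, ← map_mul, ← torusExp_sub, toG_eq_one]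
  refine torusExp_mem ?_
  have hx : L x - (complexify (Matrix.of fun j i => a i j)).mulVec x =
      ∑ i, x i • (L (Pi.single i 1) - fun j => (a i j : ℂ)) := by
    have hxs : x = ∑ i, x i • (Pi.single i (1 : ℂ) : Fin n → ℂ) := pi_eq_sum_univ' x
    conv_lhs => rw [hxs]
    simp only [map_sum, map_smul]
    rw [← hxs]
    funext j
    simp only [Pi.sub_apply, Finset.sum_apply, Pi.smul_apply, smul_eq_mul, mul_sub,
      Finset.sum_sub_distrib, complexify_mulVec_apply, Matrix.of_apply]
    congr 1
    exact Finset.sum_congr rfl fun i _ => mul_comm _ _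
  rw [hx]
  exact sum_mem fun i _ => Submodule.smul_mem _ _ (ha i)

/-! ### Equivariant biholomorphisms permute the invariant divisors -/

lemma smul_val (Λ : Config m n) (u : Fin n → ℂˣ) (z : siegel Λ) (i : Fin n) :
    (u • z).1 i = (u i : ℂ) * z.1 i := rfl

instance (Λ : Config m n) : ContinuousConstSMul (Fin n → ℂˣ) (siegel Λ) where
  continuous_const_smul u := by
    refine Continuous.subtype_mk (continuous_pi fun i => ?_) _
    exact continuous_const.mul ((continuous_apply i).comp continuous_subtype_val)

instance (Λ : Config m n) : ContinuousConstSMul (leafGroup Λ) (siegel Λ) :=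
  ⟨fun u => continuous_const_smul (u : Fin n → ℂˣ)⟩

lemma isOpenMap_proj (Λ : Config m n) : IsOpenMap (proj Λ) :=
  isOpenMap_quotient_mk'_mul (Γ := leafGroup Λ)

lemma continuous_proj (Λ : Config m n) : Continuous (proj Λ) := continuous_quotient_mk'

lemma proj_surjective (Λ : Config m n) : Function.Surjective (proj Λ) := Quotient.mk_surjective

lemma toG_smul_proj_eq_iff {Λ : Config m n} {u : Fin n → ℂˣ} {z : siegel Λ} :
    toG Λ u • proj Λ z = proj Λ z ↔ ∃ l ∈ leafGroup Λ, ∀ i, z.1 i ≠ 0 → u i = l i := by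
  rw [toG_smul_proj, proj_eq_iff]
  refine exists_congr fun l => and_congr_right fun _ => ?_
  rw [Subtype.ext_iff, funext_iff]
  refine forall_congr' fun i => ?_
  rw [smul_val, smul_val]
  rcases eq_or_ne (z.1 i) 0 with h | h
  · simp [h]
  · simp only [mul_eq_mul_right_iff, h, or_false, ne_eq, not_false_eq_true, forall_const,
      Units.val_inj]
    exact eq_comm

lemma not_single_const (hn : 1 < n) (i : Fin n) :
    ¬ ∃ c : ℤ, ∀ l, (Pi.single i 1 : Fin n → ℤ) l = c := by
  rintro ⟨c, hc⟩
  have : Nontrivial (Fin n) := Fin.nontrivial_iff_two_le.2 hn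
  obtain ⟨j, hj⟩ := exists_ne i
  have h1 := hc i
  have h2 := hc j
  simp [hj] at h1 h2
  omega

/-- An equivariant biholomorphism given on the groups by the matrix `g`, whose inverse is given
by `g'`. -/
structure MonomialData (Λ Λ' : Config m n) (ψ : G Λ ≃* G Λ') (F : Manifold Λ ≃ Manifold Λ')
    (g g' : Matrix (Fin n) (Fin n) ℤ) : Prop where
  biholo : IsEquivariantBiholomorphism Λ Λ' ψ F
  admissible : Admissible Λ
  admissible' : Admissible Λ'
  map_toG : ∀ u, ψ (toG Λ u) = toG Λ' (torusMap g u)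
  symm_toG : ∀ u, ψ.symm (toG Λ' u) = toG Λ (torusMap g' u)

namespace MonomialData

variable {Λ Λ' : Config m n} {ψ : G Λ ≃* G Λ'} {F : Manifold Λ ≃ Manifold Λ'}
  {g g' : Matrix (Fin n) (Fin n) ℤ}

lemma symm (D : MonomialData Λ Λ' ψ F g g') : MonomialData Λ' Λ ψ.symm F.symm g' g :=
  ⟨D.biholo.symm, D.admissible', D.admissible, D.symm_toG, D.map_toG⟩

lemma isScalarTrivial (D : MonomialData Λ Λ' ψ F g g') (hn : 2 * m < n) :
    IsScalarTrivial (g' * g) := by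
  refine (D.admissible.isScalarTrivial_iff hn).2 fun u => ?_
  rw [torusMap_mul, ← D.symm_toG, ← D.map_toG, MulEquiv.symm_apply_apply]

lemma mulVec_mem (D : MonomialData Λ Λ' ψ F g g') (hn : 2 * m < n) {x : Fin n → ℂ}
    (hx : x ∈ leafSpace Λ) : (complexify g).mulVec x ∈ leafSpace Λ' := by
  refine D.admissible'.mulVec_mem_leafSpace hn (fun u hu => ?_) hx
  rw [← toG_eq_one, ← D.map_toG, toG_eq_one.2 hu, map_one]

lemma mulVec_const (D : MonomialData Λ Λ' ψ F g g') (hn : 2 * m < n) {a : Fin n → ℤ}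
    (ha : ∃ c, ∀ i, a i = c) : ∃ c, ∀ i, g.mulVec a i = c := by
  obtain ⟨c, hc⟩ := ha
  have h1 := D.mulVec_mem hn (const_mem_leafSpace Λ (x := fun i => (a i : ℂ)) (c := c)
    fun i => by simp [hc i])
  rw [complexify_mulVec_intCast] at h1
  obtain ⟨d, hd⟩ := D.admissible'.int_const hn D.admissible'.univ_mem ⟨_, h1, fun i _ => rfl⟩
  exact ⟨d, fun i => hd i trivial⟩

/-- The matrix `g'` preserves constant vectors and inverts `g` up to constants. -/
lemma const_of_mulVec_const (D : MonomialData Λ Λ' ψ F g g') (hn : 2 * m < n) {a : Fin n → ℤ}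
    (ha : ∃ c, ∀ i, g.mulVec a i = c) : ∃ c, ∀ i, a i = c := by
  obtain ⟨c, hc⟩ := D.symm.mulVec_const hn ha
  obtain ⟨d, hd⟩ := (D.isScalarTrivial hn).exists_int a
  refine ⟨c - d, fun i => ?_⟩
  rw [Matrix.mulVec_mulVec] at hc
  have := hc i
  have := hd i
  omega

/-- The one-parameter group of `e_i` fixes `[z]`, so its image, generated by the `i`-th column of
`g`, fixes `[w]`. On the support of `w` this column agrees with a leaf vector, and integrality makes
it constant there. -/
lemma col_const (D : MonomialData Λ Λ' ψ F g g') (hn : 2 * m < n) {z : siegel Λ} {w : siegel Λ'}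
    (hF : F (proj Λ z) = proj Λ' w) {i : Fin n} (hi : z.1 i = 0) :
    ∃ c, ∀ l, w.1 l ≠ 0 → g l i = c := by
  have hw : {l | w.1 l ≠ 0} ∈ Supp Λ' := w.2
  refine D.admissible'.int_const hn hw
    (D.admissible'.exists_leafSpace_eq hn hw (y := fun l => (g l i : ℂ)) fun t => ?_)
  have h1 : toG Λ (torusExp (t • Pi.single i 1)) • proj Λ z = proj Λ z := by
    refine toG_smul_proj_eq_iff.2 ⟨1, one_mem _, fun l hl => ?_⟩
    have : l ≠ i := fun h => hl (h ▸ hi)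
    ext
    simp [this]
  have h2 := congrArg F h1
  rw [D.biholo.equivariant, hF, D.map_toG, torusMap_exp, toG_smul_proj_eq_iff] at h2
  obtain ⟨u, hu, hul⟩ := h2
  obtain ⟨v, hv, rfl⟩ := mem_leafGroup_iff.1 hu
  refine ⟨v, hv, fun l hl => ?_⟩
  have := congrArg Units.val (hul l hl)
  simpa [Matrix.mulVec_smul] using this

/-- By `col_const` for the inverse map, a vanishing `w_j` would make the whole `j`-th column of `g'`
constant. -/
lemma ne_zero_of_open_orbit (D : MonomialData Λ Λ' ψ F g g') (hm : 0 < m) (hn : 2 * m < n)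
    {z : siegel Λ} (hz : ∀ i, z.1 i ≠ 0) {w : siegel Λ'} (hF : F (proj Λ z) = proj Λ' w)
    (j : Fin n) : w.1 j ≠ 0 := by
  intro hj
  obtain ⟨c, hc⟩ := D.symm.col_const hn (z := w) (w := z) (by rw [← hF, Equiv.symm_apply_apply]) hj
  refine not_single_const (by omega) j (D.symm.const_of_mulVec_const hn ⟨c, fun i => ?_⟩)
  rw [Matrix.mulVec_single_one]
  exact hc i (hz i)

/-- If the divisor `z_i = 0` is mapped to the stratum through `w`, then the `i`-th column of `g` is,
up to a constant vector, positive at the vanishing coordinates of `w`. -/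
lemma lt_of_eq_zero (D : MonomialData Λ Λ' ψ F g g') (hm : 0 < m) (hn : 2 * m < n)
    {z : siegel Λ} {i : Fin n} (hz : ∀ l, z.1 l = if l = i then 0 else 1) {w : siegel Λ'}
    (hF : F (proj Λ z) = proj Λ' w) {a : ℤ} (ha : ∀ l, w.1 l ≠ 0 → g l i = a) {l : Fin n}
    (hl : w.1 l = 0) : a < g l i := by
  have hone : (fun _ => (1 : ℂ)) ∈ siegel Λ := by
    rw [mem_siegel_iff]
    simpa using D.admissible.univ_mem
  set o : siegel Λ := ⟨fun _ => 1, hone⟩ with ho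
  obtain ⟨w₀, hw₀⟩ := proj_surjective Λ' (F (proj Λ o))
  have hw₀ne := D.ne_zero_of_open_orbit hm hn (z := o) (fun _ => one_ne_zero) hw₀.symm
  -- A curve `p t → z` with `i`-th coordinate `t > 0` stays in the open orbit, so its image is `w₀`
  -- multiplied by `t` to the powers of the `i`-th column, up to the leaf group. Near `w`, the
  -- nonvanishing coordinates bound the leaf parameters, and the smallness of a vanishing coordinate
  -- must come from the power of `t`.
  obtain ⟨K, hK, hbound⟩ := D.admissible'.exists_bound hn (I := {l | w.1 l ≠ 0}) w.2
  set M : ℝ := ∑ l, (|Real.log (‖w.1 l‖ / 2 / ‖w₀.1 l‖)| + |Real.log (2 * ‖w.1 l‖ / ‖w₀.1 l‖)|)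
    with hM
  have hM0 : 0 ≤ M := Finset.sum_nonneg fun _ _ => by positivity
  -- The leaf factor will have modulus at least `exp (-2KM)` at every index: `K M` for the constant
  -- and `K M` for the term in `T`.
  set A : Set (siegel Λ') := {y | ∀ l, (w.1 l ≠ 0 → ‖w.1 l‖ / 2 < ‖y.1 l‖ ∧ ‖y.1 l‖ < 2 * ‖w.1 l‖) ∧
    (w.1 l = 0 → ‖y.1 l‖ < Real.exp (-(2 * (K * M))) * ‖w₀.1 l‖)} with hA
  have hAw : A ∈ 𝓝 w := by
    refine Filter.eventually_all.2 fun l => ?_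
    have hc : ContinuousAt (fun y : siegel Λ' => ‖y.1 l‖) w :=
      ((continuous_apply l).comp continuous_subtype_val).norm.continuousAt
    rcases eq_or_ne (w.1 l) 0 with h | h
    · have : ‖w.1 l‖ < Real.exp (-(2 * (K * M))) * ‖w₀.1 l‖ := by
        rw [h, norm_zero]
        exact mul_pos (Real.exp_pos _) (norm_pos_iff.2 (hw₀ne l))
      filter_upwards [hc.eventually_lt continuousAt_const this] with y hy
      exact ⟨fun h' => absurd h h', fun _ => hy⟩
    · have h0 : 0 < ‖w.1 l‖ := norm_pos_iff.2 h
      have h1 : ‖w.1 l‖ / 2 < ‖w.1 l‖ := by linarith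
      have h2 : ‖w.1 l‖ < 2 * ‖w.1 l‖ := by linarith
      filter_upwards [continuousAt_const.eventually_lt hc h1,
        hc.eventually_lt continuousAt_const h2] with y hy1 hy2
      exact ⟨fun _ => ⟨hy1, hy2⟩, fun h' => absurd h' h⟩
  have hAF : proj Λ' '' A ∈ 𝓝 (F (proj Λ z)) := by
    rw [hF]
    exact (isOpenMap_proj Λ').image_mem_nhds hAw
  let p : ℝ → (Fin n → ℂ) := fun t l => if l = i then (t : ℂ) else 1
  have hps : ∀ t, p t ∈ siegel Λ := by
    intro t
    have : {l | z.1 l ≠ 0} ⊆ {l | p t l ≠ 0} := by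
      intro l hl
      have hli : l ≠ i := fun h => hl (by simp [hz, h])
      simp [p, hli]
    exact supp_mono z.2 this
  have hpc : Continuous fun t => F (proj Λ ⟨p t, hps t⟩) := by
    refine D.biholo.holo.1.comp ((continuous_proj Λ).comp (Continuous.subtype_mk ?_ _))
    refine continuous_pi fun l => ?_
    by_cases h : l = i
    · simp only [p, h, if_true]
      exact Complex.continuous_ofReal
    · simp only [p, h, if_false]
      exact continuous_const
  have hp0 : (⟨p 0, hps 0⟩ : siegel Λ) = z := Subtype.ext (funext fun l => by simp [p, hz])
  have hev : ∀ᶠ t in 𝓝 (0 : ℝ), F (proj Λ ⟨p t, hps t⟩) ∈ proj Λ' '' A := by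
    have := hpc.continuousAt (x := 0)
    rw [ContinuousAt, hp0] at this
    exact this hAF
  obtain ⟨t, ⟨ht0, ht1⟩, y, hyA, hy⟩ :=
    (Filter.Eventually.and (Ioo_mem_nhdsGT (zero_lt_one (α := ℝ)))
      (hev.filter_mono (nhdsWithin_le_nhds (s := Set.Ioi 0)))).exists
  have hpt : (⟨p t, hps t⟩ : siegel Λ) = torusExp (Real.log t • Pi.single i (1 : ℂ)) • o := by
    refine Subtype.ext (funext fun l => ?_)
    rw [smul_val, torusExp_val]
    by_cases h : l = i
    · subst h
      simp only [p, ho, if_true, Pi.smul_apply, Pi.single_eq_same, mul_one, Complex.real_smul]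
      rw [← Complex.ofReal_exp, Real.exp_log ht0]
    · simp [p, h, ho]
  rw [hpt, ← toG_smul_proj, D.biholo.equivariant, ← hw₀, D.map_toG, toG_smul_proj] at hy
  obtain ⟨u, hu, huy⟩ := (proj_eq_iff Λ' _ _).1 hy
  obtain ⟨v, hv, rfl⟩ := mem_leafGroup_iff.1 hu
  -- The common factor `t ^ a` is absorbed into the constant of the leaf vector.
  have hv' : v + (fun _ => (a : ℂ) * Real.log t) ∈ leafSpace Λ' :=
    add_mem hv (const_mem_leafSpace _ fun _ => rfl)
  obtain ⟨c, T, hcT⟩ := hv'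
  have hyl : ∀ l, ‖y.1 l‖ = Real.exp (c.re + (Λ' l ⬝ᵥ T).re) * (t ^ (g l i - a) * ‖w₀.1 l‖) := by
    intro l
    have hvl : v l = c + Λ' l ⬝ᵥ T - a * Real.log t := by
      rw [← hcT l]; simp
    have h1 := congrArg (fun s : siegel Λ' => ‖s.1 l‖) huy
    simp only [smul_val, torusMap_exp, torusExp_val, norm_mul, Complex.norm_exp] at h1
    have h2 : (complexify g).mulVec (Real.log t • Pi.single i (1 : ℂ)) l = g l i * Real.log t := by
      rw [Matrix.mulVec_smul, Matrix.mulVec_single_one]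
      simp [mul_comm]
    have h3 : t ^ (g l i - a) = Real.exp ((g l i - a) * Real.log t) := by
      rw [← Real.rpow_intCast, Real.rpow_def_of_pos ht0, mul_comm]
      push_cast
      rfl
    have e1 : (c + Λ' l ⬝ᵥ T - (a : ℂ) * (Real.log t : ℝ)).re =
        c.re + (Λ' l ⬝ᵥ T).re + -(a * Real.log t) := by simp; ring
    have e2 : ((g l i : ℂ) * (Real.log t : ℝ)).re = g l i * Real.log t := by simp
    rw [sub_mul, sub_eq_add_neg (_ * Real.log t), Real.exp_add] at h3
    rw [← h1, h2, hvl, h3, e1, e2, Real.exp_add _ (-(a * Real.log t))]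
    ring
  have hre : ∀ l ∈ {l | w.1 l ≠ 0}, |c.re + (Λ' l ⬝ᵥ T).re| ≤ M := by
    intro l hl
    obtain ⟨h1, h2⟩ := (hyA l).1 hl
    have hwl : 0 < ‖w.1 l‖ := norm_pos_iff.2 hl
    have hw₀l : 0 < ‖w₀.1 l‖ := norm_pos_iff.2 (hw₀ne l)
    rw [hyl l, ha l hl, sub_self, zpow_zero, one_mul] at h1 h2
    rw [← div_lt_iff₀ hw₀l] at h1
    rw [← lt_div_iff₀ hw₀l] at h2
    have h3 := Real.log_lt_log (by positivity) h1
    have h4 := Real.log_lt_log (Real.exp_pos _) h2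
    rw [Real.log_exp] at h3 h4
    have h5 : |Real.log (‖w.1 l‖ / 2 / ‖w₀.1 l‖)| + |Real.log (2 * ‖w.1 l‖ / ‖w₀.1 l‖)| ≤ M :=
      Finset.single_le_sum (f := fun l => |Real.log (‖w.1 l‖ / 2 / ‖w₀.1 l‖)| +
        |Real.log (2 * ‖w.1 l‖ / ‖w₀.1 l‖)|) (fun _ _ => by positivity) (Finset.mem_univ l)
    rw [abs_le]
    have h6 := neg_abs_le (Real.log (‖w.1 l‖ / 2 / ‖w₀.1 l‖))
    have h7 := le_abs_self (Real.log (2 * ‖w.1 l‖ / ‖w₀.1 l‖))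
    have h8 := abs_nonneg (Real.log (‖w.1 l‖ / 2 / ‖w₀.1 l‖))
    have h9 := abs_nonneg (Real.log (2 * ‖w.1 l‖ / ‖w₀.1 l‖))
    constructor <;> linarith
  obtain ⟨hcr, hcT'⟩ := hbound c.re T M hM0 hre
  have hlow : -(2 * (K * M)) ≤ c.re + (Λ' l ⬝ᵥ T).re := by
    have h1 := (abs_le.1 hcr).1
    have h2 := (abs_le.1 ((Complex.abs_re_le_norm _).trans (hcT' l))).1
    linarith
  have hlt := (hyA l).2 hl
  rw [hyl l] at hlt
  have hw₀l : 0 < ‖w₀.1 l‖ := norm_pos_iff.2 (hw₀ne l)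
  by_contra! hle
  have h1 : 1 ≤ t ^ (g l i - a) := one_le_zpow_of_nonpos₀ ht0 ht1.le (by omega)
  have h2 := Real.exp_le_exp.2 hlow
  have h3 : Real.exp (-(2 * (K * M))) * ‖w₀.1 l‖ ≤
      Real.exp (c.re + (Λ' l ⬝ᵥ T).re) * (t ^ (g l i - a) * ‖w₀.1 l‖) :=
    mul_le_mul h2 (le_mul_of_one_le_left hw₀l.le h1) hw₀l.le (Real.exp_pos _).le
  linarith

/-- The generator of the isotropy group of a divisor `z_i = 0` is mapped to such a generator. -/
lemma exists_col (D : MonomialData Λ Λ' ψ F g g') (hm : 0 < m) (hn : 2 * m < n) {i : Fin n}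
    (hi : {i}ᶜ ∈ Supp Λ) :
    ∃ j, {j}ᶜ ∈ Supp Λ' ∧ ∃ c, ∀ l, g l i = (if l = j then 1 else 0) + c := by
  have hzs : (fun l => if l = i then (0 : ℂ) else 1) ∈ siegel Λ := by
    rw [mem_siegel_iff]
    convert hi using 1
    ext l
    simp
  set z : siegel Λ := ⟨_, hzs⟩ with hz
  have hzl : ∀ l, z.1 l = if l = i then 0 else 1 := fun l => rfl
  obtain ⟨w, hw⟩ := proj_surjective Λ' (F (proj Λ z))
  obtain ⟨a, ha⟩ := D.col_const hn hw.symm (i := i) (by simp [hzl])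
  have hpos : ∀ l, w.1 l = 0 → a < g l i := fun l hl => D.lt_of_eq_zero hm hn hzl hw.symm ha hl
  have hJ : ∃ j, w.1 j = 0 := by
    by_contra! h
    refine not_single_const (by omega) i (D.const_of_mulVec_const hn ⟨a, fun l => ?_⟩)
    rw [Matrix.mulVec_single_one]
    exact ha l (h l)
  have hb : ∀ j, w.1 j = 0 → ∃ b, ∀ l, l ≠ i → g' l j = b := by
    intro j hj
    obtain ⟨b, hb⟩ := D.symm.col_const hn (z := w) (w := z)
      (by rw [hw, Equiv.symm_apply_apply]) hj
    exact ⟨b, fun l hl => hb l (by simp [hzl, hl])⟩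
  obtain ⟨j, hj⟩ := hJ
  obtain ⟨b, hbj⟩ := hb j hj
  -- Two vanishing coordinates give two columns of `g'` that are constant off `i`. A combination
  -- cancelling their jumps at `i` is constant, so the same combination of `e_j` and `e_j'` is
  -- constant; at a third index, available as `n > 2`, it is `0`. A jump is therefore zero and a
  -- column of `g'` is constant, which is impossible.
  have huniq : ∀ j', w.1 j' = 0 → j' = j := by
    intro j' hj'
    by_contra hne
    obtain ⟨b', hbj'⟩ := hb j' hj'
    obtain ⟨c, hc⟩ := D.symm.const_of_mulVec_const hn
      (a := (g' i j' - b') • Pi.single j 1 - (g' i j - b) • Pi.single j' 1)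
      ⟨(g' i j' - b') * b - (g' i j - b) * b', fun l => by
        rw [Matrix.mulVec_sub, Matrix.mulVec_smul, Matrix.mulVec_smul, Matrix.mulVec_single_one,
          Matrix.mulVec_single_one]
        simp only [Pi.sub_apply, Pi.smul_apply, smul_eq_mul, Matrix.col_apply]
        rcases eq_or_ne l i with rfl | hl
        · ring
        · rw [hbj l hl, hbj' l hl]⟩
    obtain ⟨l, hl⟩ : ∃ l, l ∉ ({j, j'} : Finset (Fin n)) := by
      by_contra! h
      have h1 := Finset.card_le_card (fun l _ => h l : (Finset.univ : Finset (Fin n)) ⊆ {j, j'})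
      have h2 := Finset.card_le_two (a := j) (b := j')
      rw [Finset.card_univ, Fintype.card_fin] at h1
      omega
    simp only [Finset.mem_insert, Finset.mem_singleton, not_or] at hl
    have h1 := hc l
    have h2 := hc j
    simp [hl.1, hl.2] at h1
    simp [Ne.symm hne] at h2
    refine not_single_const (by omega) j' (D.symm.const_of_mulVec_const hn ⟨b', fun l => ?_⟩)
    rw [Matrix.mulVec_single_one, Matrix.col_apply]
    rcases eq_or_ne l i with rfl | hl
    · omega
    · exact hbj' l hl
  have hsupp : {l | w.1 l ≠ 0} = {j}ᶜ := by
    ext l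
    simp only [Set.mem_ofPred_eq, Set.mem_compl_iff, Set.mem_singleton_iff]
    exact not_congr ⟨huniq l, fun h => h ▸ hj⟩
  refine ⟨j, ?_, a, ?_⟩
  · rw [← hsupp]
    exact w.2
  have hal : ∀ l, l ≠ j → g l i = a := fun l hl => ha l fun h => hl (huniq l h)
  obtain ⟨c, hc⟩ := (D.isScalarTrivial hn).exists_int (Pi.single i 1)
  obtain ⟨d, hd⟩ := D.symm.mulVec_const hn (a := fun _ => a) ⟨a, fun _ => rfl⟩
  have hgi : g.mulVec (Pi.single i 1) = (fun _ => a) + (g j i - a) • Pi.single j 1 := by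
    funext l
    rw [Matrix.mulVec_single_one]
    rcases eq_or_ne l j with rfl | hl
    · simp
    · simp [hl, hal l hl]
  rw [← Matrix.mulVec_mulVec, hgi, Matrix.mulVec_add, Matrix.mulVec_smul,
    Matrix.mulVec_single_one] at hc
  have : Nontrivial (Fin n) := Fin.nontrivial_iff_two_le.2 (by omega)
  obtain ⟨l, hl⟩ := exists_ne i
  have h1 := hc l
  have h2 := hc i
  simp only [Pi.add_apply, Pi.smul_apply, smul_eq_mul, hd, Matrix.col_apply, hbj l hl,
    Pi.single_eq_same, Pi.single_eq_of_ne hl] at h1 h2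
  -- Comparing `g' g e_i` with `e_i` at `i` and at another index shows that the two jumps are
  -- inverse integers; positivity excludes `-1`.
  have h3 : (g j i - a) * (g' i j - b) = 1 := by rw [mul_sub]; omega
  have h4 := hpos j hj
  have h5 : g j i - a = 1 := by
    rcases Int.eq_one_or_neg_one_of_mul_eq_one h3 with h | h
    · exact h
    · omega
  intro l
  split_ifs with hlj
  · subst hlj
    omega
  · rw [hal l hlj, zero_add]

end MonomialData

/-! ### Monomial symmetries relating two configurations -/

/-- Pairs of an invertible integer matrix and a permutation. -/
abbrev Sym (n : ℕ) : Type := (Matrix (Fin n) (Fin n) ℤ)ˣ × Equiv.Perm (Fin n)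

/-- The integer matrix of a pair. -/
def Sym.mat (h : Sym n) : Matrix (Fin n) (Fin n) ℤ := h.1.1

@[simp] lemma Sym.mat_one : (1 : Sym n).mat = 1 := rfl

lemma Sym.mat_mul (h h' : Sym n) : (h * h').mat = h.mat * h'.mat := rfl

lemma Sym.inv_mat_mul (h : Sym n) : (h⁻¹).mat * h.mat = 1 := Units.inv_mul h.1

lemma Sym.mat_mul_inv (h : Sym n) : h.mat * (h⁻¹).mat = 1 := Units.mul_inv h.1

/-- The matrix fixes `(1, …, 1)`, and it permutes the basis vectors of index at least `k` by the
permutation, which fixes the other indices. -/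
structure IsMonomial (k : ℕ) (h : Sym n) : Prop where
  mulVec_one : h.mat.mulVec 1 = 1
  mulVec_single : ∀ i : Fin n, k ≤ i → h.mat.mulVec (Pi.single i 1) = Pi.single (h.2 i) 1
  fix : ∀ i : Fin n, (i : ℕ) < k → h.2 i = i

namespace IsMonomial

variable {k : ℕ} {h h' : Sym n}

lemma le_apply (H : IsMonomial k h) {i : Fin n} (hi : k ≤ i) : k ≤ h.2 i := by
  by_contra! hlt
  have := h.2.injective (H.fix _ hlt)
  rw [this] at hlt
  omega

lemma col (H : IsMonomial k h) {i : Fin n} (hi : k ≤ i) (l : Fin n) :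
    h.mat l i = if l = h.2 i then 1 else 0 := by
  have := congrFun (H.mulVec_single i hi) l
  rw [Matrix.mulVec_single_one] at this
  simpa [Pi.single_apply] using this

lemma one : IsMonomial k (1 : Sym n) :=
  ⟨by simp, fun i _ => by rw [Sym.mat_one, Matrix.one_mulVec]; rfl, fun i _ => rfl⟩

lemma mul (H : IsMonomial k h) (H' : IsMonomial k h') : IsMonomial k (h * h') := by
  refine ⟨?_, fun i hi => ?_, fun i hi => ?_⟩
  · rw [Sym.mat_mul, ← Matrix.mulVec_mulVec, H'.mulVec_one, H.mulVec_one]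
  · rw [Sym.mat_mul, ← Matrix.mulVec_mulVec, H'.mulVec_single i hi,
      H.mulVec_single _ (H'.le_apply hi)]
    rfl
  · change h.2 (h'.2 i) = i
    rw [H'.fix i hi, H.fix i hi]

lemma inv (H : IsMonomial k h) : IsMonomial k h⁻¹ := by
  have hfix : ∀ i : Fin n, (i : ℕ) < k → (h⁻¹).2 i = i := fun i hi =>
    (Equiv.symm_apply_eq h.2).2 (H.fix i hi).symm
  refine ⟨?_, fun i hi => ?_, hfix⟩
  · conv_lhs => rw [← H.mulVec_one]
    rw [Matrix.mulVec_mulVec, Sym.inv_mat_mul, Matrix.one_mulVec]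
  · have hle : k ≤ (h⁻¹).2 i := by
      by_contra! hlt
      have h1 := H.fix _ hlt
      have h2 : h.2 ((h⁻¹).2 i) = i := h.2.apply_symm_apply i
      rw [h2] at h1
      rw [← h1] at hlt
      omega
    have h1 := H.mulVec_single _ hle
    have h2 : h.2 ((h⁻¹).2 i) = i := h.2.apply_symm_apply i
    rw [h2] at h1
    rw [← h1, Matrix.mulVec_mulVec, Sym.inv_mat_mul, Matrix.one_mulVec]

lemma complexify_mulVec_const (H : IsMonomial k h) (c : ℂ) :
    (complexify h.mat).mulVec (fun _ => c) = fun _ => c := by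
  funext l
  have := congrFun H.mulVec_one l
  simp only [Matrix.mulVec, dotProduct, Pi.one_apply, mul_one] at this
  rw [complexify_mulVec_apply, ← Finset.sum_mul, ← Int.cast_sum, this]
  simp

end IsMonomial

lemma Sym.complexify_inv_mulVec (h : Sym n) (x : Fin n → ℂ) :
    (complexify (h⁻¹).mat).mulVec ((complexify h.mat).mulVec x) = x := by
  rw [Matrix.mulVec_mulVec, ← complexify_mul, Sym.inv_mat_mul, complexify_one, Matrix.one_mulVec]

lemma Sym.complexify_mulVec_inv (h : Sym n) (x : Fin n → ℂ) :
    (complexify h.mat).mulVec ((complexify (h⁻¹).mat).mulVec x) = x := by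
  rw [Matrix.mulVec_mulVec, ← complexify_mul, Sym.mat_mul_inv, complexify_one, Matrix.one_mulVec]

/-- The monomial symmetry `h` maps `Λ` to `Λ'`: it carries the tangent space of the first acting
group to that of the second one, and the open set `S_Λ` to `S_Λ'`. -/
structure Rel (k : ℕ) (h : Sym n) (Λ Λ' : Config m n) : Prop where
  isMonomial : IsMonomial k h
  mem_iff : ∀ x, (complexify h.mat).mulVec x ∈ leafSpace Λ' ↔ x ∈ leafSpace Λ
  supp_iff : ∀ I, h.2 '' I ∈ Supp Λ' ↔ I ∈ Supp Λ

namespace Rel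

variable {k : ℕ} {h h' : Sym n} {Λ Λ' Λ'' : Config m n}

lemma refl (k : ℕ) (Λ : Config m n) : Rel k 1 Λ Λ :=
  ⟨IsMonomial.one, fun x => by simp, fun I => by simp⟩

lemma trans (H : Rel k h Λ Λ') (H' : Rel k h' Λ' Λ'') : Rel k (h' * h) Λ Λ'' := by
  refine ⟨H'.isMonomial.mul H.isMonomial, fun x => ?_, fun I => ?_⟩
  · rw [Sym.mat_mul, complexify_mul, ← Matrix.mulVec_mulVec, H'.mem_iff, H.mem_iff]
  · rw [← H.supp_iff, ← H'.supp_iff, Set.image_image]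
    rfl

lemma symm (H : Rel k h Λ Λ') : Rel k h⁻¹ Λ' Λ := by
  refine ⟨H.isMonomial.inv, fun x => ?_, fun I => ?_⟩
  · rw [← H.mem_iff, Sym.complexify_mulVec_inv]
  · rw [← H.supp_iff, Set.image_image]
    have : (fun i => h.2 ((h⁻¹).2 i)) = id := funext fun i => h.2.apply_symm_apply i
    rw [this, Set.image_id]

end Rel

/-- The group of the monomial symmetries of a configuration. -/
def relGroup (k : ℕ) (Λ : Config m n) : Subgroup (Sym n) where
  carrier := {h | Rel k h Λ Λ}
  one_mem' := Rel.refl k Λ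
  mul_mem' H H' := Rel.trans H' H
  inv_mem' H := Rel.symm H

lemma mem_relGroup {k : ℕ} {Λ : Config m n} {h : Sym n} : h ∈ relGroup k Λ ↔ Rel k h Λ Λ := Iff.rfl

/-- Admissible configurations whose indispensable points are the first `k` ones. -/
structure Std (k : ℕ) (Λ : Config m n) : Prop where
  admissible : Admissible Λ
  indispensable_iff : ∀ i : Fin n, Indispensable Λ i ↔ (i : ℕ) < k

lemma Std.compl_mem_iff {k : ℕ} {Λ : Config m n} (S : Std k Λ) (i : Fin n) :
    {i}ᶜ ∈ Supp Λ ↔ k ≤ i := by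
  rw [← not_lt, ← S.indispensable_iff, S.admissible.indispensable_iff, not_not]

lemma Std.le_of_notMem {k : ℕ} {Λ : Config m n} (S : Std k Λ) {I : Set (Fin n)} (hI : I ∈ Supp Λ)
    {i : Fin n} (hi : i ∉ I) : k ≤ i := by
  by_contra! h
  exact hi (S.admissible.mem_of_indispensable ((S.indispensable_iff i).2 h) hI)

/-! ### Equivariant biholomorphisms come from monomial symmetries -/

/-- Constants subtracted from columns do not change the map on the groups. Columns of index at least
`k` become basis vectors, and one column of index below `k` absorbs the error in the row sums. If
there is none, the result is a permutation matrix, whose row sums are already `1`. -/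
lemma exists_normalization {k : ℕ} (g : Matrix (Fin n) (Fin n) ℤ) (σ : Equiv.Perm (Fin n))
    (hcol : ∀ i : Fin n, k ≤ i → ∃ c, ∀ l, g l i = (if l = σ i then 1 else 0) + c)
    (hone : ∃ c, ∀ l, ∑ i, g l i = c) :
    ∃ r : Fin n → ℤ, (∀ i : Fin n, k ≤ i → ∀ l, g l i - r i = if l = σ i then 1 else 0) ∧
      ∀ l, ∑ i, (g l i - r i) = 1 := by
  choose! a ha using hcol
  obtain ⟨c, hc⟩ := hone
  by_cases h : ∃ i : Fin n, (i : ℕ) < k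
  · obtain ⟨i₀, hi₀⟩ := h
    set r : Fin n → ℤ := fun i => if k ≤ i then a i else 0 with hr
    refine ⟨r + Pi.single i₀ (c - 1 - ∑ i, r i), fun i hi l => ?_, fun l => ?_⟩
    · have hne : i ≠ i₀ := by rintro rfl; omega
      simp [hr, hi, hne, ha i hi l]
    · rw [Finset.sum_sub_distrib, hc l]
      simp [Finset.sum_add_distrib]
  · push Not at h
    refine ⟨a, fun i hi l => by rw [ha i hi l]; ring, fun l => ?_⟩
    have : ∀ i, g l i - a i = if σ.symm l = i then 1 else 0 := fun i => by
      rw [ha i (h i) l, add_sub_cancel_right]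
      simp [Equiv.symm_apply_eq]
    simp [this]

namespace MonomialData

variable {Λ Λ' : Config m n} {ψ : G Λ ≃* G Λ'} {F : Manifold Λ ≃ Manifold Λ'}
  {g g' : Matrix (Fin n) (Fin n) ℤ}

/-- Up to constants, `g' g e_i` equals both `e_i` and `e_i'`. -/
lemma eq_of_col (D : MonomialData Λ Λ' ψ F g g') (hn : 2 * m < n) {i j i' : Fin n} {c c' : ℤ}
    (h : ∀ l, g l i = (if l = j then 1 else 0) + c)
    (h' : ∀ l, g' l j = (if l = i' then 1 else 0) + c') : i' = i := by
  by_contra hne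
  obtain ⟨d, hd⟩ := (D.isScalarTrivial hn).exists_int (Pi.single i 1)
  obtain ⟨e, he⟩ := D.symm.mulVec_const hn (a := fun _ => c) ⟨c, fun _ => rfl⟩
  have hgi : g.mulVec (Pi.single i 1) = Pi.single j 1 + (fun _ => c) := by
    funext l
    rw [Matrix.mulVec_single_one]
    simp [h l, Pi.single_apply]
  rw [← Matrix.mulVec_mulVec, hgi, Matrix.mulVec_add, Matrix.mulVec_single_one] at hd
  have h1 := hd i
  have h2 := hd i'
  simp [he, h', hne, Ne.symm hne] at h1 h2
  omega

lemma exists_perm (D : MonomialData Λ Λ' ψ F g g') (hm : 0 < m) (hn : 2 * m < n) {k : ℕ}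
    (S : Std k Λ) (S' : Std k Λ') : ∃ σ : Equiv.Perm (Fin n),
      (∀ i : Fin n, (i : ℕ) < k → σ i = i) ∧
      (∀ i : Fin n, k ≤ i → ∃ c, ∀ l, g l i = (if l = σ i then 1 else 0) + c) ∧
      ∀ i : Fin n, k ≤ i → ∃ c, ∀ l, g' l i = (if l = σ.symm i then 1 else 0) + c := by
  have h1 : ∀ i : Fin n, ∃ j : Fin n, ((i : ℕ) < k → j = i) ∧ (k ≤ i → k ≤ j ∧
      ∃ c, ∀ l, g l i = (if l = j then 1 else 0) + c) := by
    intro i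
    rcases lt_or_ge (i : ℕ) k with hi | hi
    · exact ⟨i, fun _ => rfl, fun h => absurd h (by omega)⟩
    · obtain ⟨j, hj, hc⟩ := D.exists_col hm hn ((S.compl_mem_iff i).2 hi)
      exact ⟨j, fun h => absurd h (by omega), fun _ => ⟨(S'.compl_mem_iff j).1 hj, hc⟩⟩
  have h2 : ∀ i : Fin n, ∃ j : Fin n, ((i : ℕ) < k → j = i) ∧ (k ≤ i → k ≤ j ∧
      ∃ c, ∀ l, g' l i = (if l = j then 1 else 0) + c) := by
    intro i
    rcases lt_or_ge (i : ℕ) k with hi | hi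
    · exact ⟨i, fun _ => rfl, fun h => absurd h (by omega)⟩
    · obtain ⟨j, hj, hc⟩ := D.symm.exists_col hm hn ((S'.compl_mem_iff i).2 hi)
      exact ⟨j, fun h => absurd h (by omega), fun _ => ⟨(S.compl_mem_iff j).1 hj, hc⟩⟩
  choose s hs hs' using h1
  choose t ht ht' using h2
  refine ⟨⟨s, t, fun i => ?_, fun i => ?_⟩, hs, fun i hi => (hs' i hi).2, fun i hi => (ht' i hi).2⟩
  · rcases lt_or_ge (i : ℕ) k with hi | hi
    · rw [hs i hi, ht i hi]
    · obtain ⟨hj, c, hc⟩ := hs' i hi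
      obtain ⟨-, c', hc'⟩ := ht' _ hj
      exact D.eq_of_col hn hc hc'
  · rcases lt_or_ge (i : ℕ) k with hi | hi
    · rw [ht i hi, hs i hi]
    · obtain ⟨hj, c, hc⟩ := ht' i hi
      obtain ⟨-, c', hc'⟩ := hs' _ hj
      exact D.symm.eq_of_col hn hc hc'

/-- Let `z` have support `I` and `[z]` have image `[w]`. If `w_l ≠ 0` with `σ⁻¹ l ∉ I`, then
`col_const` makes `e_l` constant on the support of `w`, which contains a second index. So the
support of `w` lies in `σ '' I`. -/
lemma image_mem_supp (D : MonomialData Λ Λ' ψ F g g') (hm : 0 < m) (hn : 2 * m < n) {k : ℕ}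
    (S : Std k Λ) {σ : Equiv.Perm (Fin n)}
    (hcol : ∀ i : Fin n, k ≤ i → ∃ c, ∀ l, g l i = (if l = σ i then 1 else 0) + c)
    {I : Set (Fin n)} (hI : I ∈ Supp Λ) : σ '' I ∈ Supp Λ' := by
  classical
  have hzI : {l | (if l ∈ I then (1 : ℂ) else 0) ≠ 0} = I := by ext l; simp
  set z : siegel Λ := ⟨fun l => if l ∈ I then (1 : ℂ) else 0, by
    rw [mem_siegel_iff, hzI]; exact hI⟩ with hz
  obtain ⟨w, hw⟩ := proj_surjective Λ' (F (proj Λ z))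
  refine supp_mono (w.2 : {l | w.1 l ≠ 0} ∈ Supp Λ') fun l hl => ?_
  refine ⟨σ.symm l, ?_, σ.apply_symm_apply l⟩
  by_contra hlI
  obtain ⟨c, hc⟩ := hcol _ (S.le_of_notMem hI hlI)
  obtain ⟨d, hd⟩ := D.col_const hn hw.symm (i := σ.symm l) (by simp [hz, hlI])
  obtain ⟨l', hl', hne⟩ := D.admissible'.exists_ne hm hn
    (w.2 : {l | w.1 l ≠ 0} ∈ Supp Λ') l
  have h1 := hd l hl
  have h2 := hd l' hl'
  rw [hc] at h1 h2
  simp [hne] at h1 h2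
  omega

lemma sub_const (D : MonomialData Λ Λ' ψ F g g') (r r' : Fin n → ℤ) :
    MonomialData Λ Λ' ψ F (g - Matrix.of fun _ i => r i) (g' - Matrix.of fun _ i => r' i) := by
  have key : ∀ (Λ : Config m n) (g : Matrix (Fin n) (Fin n) ℤ) (r : Fin n → ℤ) (u : Fin n → ℂˣ),
      toG Λ (torusMap (g - Matrix.of fun _ i => r i) u) = toG Λ (torusMap g u) := by
    intro Λ g r u
    obtain ⟨x, rfl⟩ := torusExp_surjective u
    rw [← mul_inv_eq_one, ← map_inv, ← map_mul, torusMap_exp, torusMap_exp, ← torusExp_sub,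
      toG_eq_one]
    refine torusExp_mem (const_mem_leafSpace Λ (c := -∑ i, r i * x i) fun l => ?_)
    simp [complexify_mulVec_apply, sub_mul]
  exact ⟨D.biholo, D.admissible, D.admissible', fun u => by rw [D.map_toG, key],
    fun u => by rw [D.symm_toG, key]⟩

/-- The matrix `g' * g - 1` has constant columns and zero row sums, hence square zero, so `g' * g`
is invertible. -/
lemma isUnit_of_sum_eq_one (D : MonomialData Λ Λ' ψ F g g') (hn : 2 * m < n)
    (h : ∀ l, ∑ i, g l i = 1) (h' : ∀ l, ∑ i, g' l i = 1) : IsUnit g := by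
  have hq : ∀ i, ∃ q : ℤ, ∀ l, (g' * g - 1) l i = q := by
    intro i
    obtain ⟨q, hq⟩ := (D.isScalarTrivial hn).exists_int (Pi.single i 1)
    refine ⟨q, fun l => ?_⟩
    have := hq l
    rw [Matrix.mulVec_single_one, Matrix.col_apply] at this
    rw [Matrix.sub_apply, this, Matrix.one_apply, Pi.single_apply]
    ring
  choose q hq using hq
  have hsum : ∀ l, ∑ i, (g' * g - 1) l i = 0 := by
    intro l
    have h1 : g.mulVec 1 = 1 := by
      funext l; simpa [Matrix.mulVec, dotProduct] using h l
    have h2 : g'.mulVec 1 = 1 := by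
      funext l; simpa [Matrix.mulVec, dotProduct] using h' l
    have h3 : (g' * g - 1).mulVec 1 = 0 := by
      rw [Matrix.sub_mulVec, ← Matrix.mulVec_mulVec, h1, h2, Matrix.one_mulVec, sub_self]
    have := congrFun h3 l
    simpa [Matrix.mulVec, dotProduct] using this
  have hsq : (g' * g - 1) * (g' * g - 1) = 0 := by
    ext l i
    rw [Matrix.mul_apply]
    have : ∑ j, (g' * g - 1) l j * (g' * g - 1) j i = (∑ j, (g' * g - 1) l j) * q i := by
      rw [Finset.sum_mul]
      exact Finset.sum_congr rfl fun j _ => by rw [hq i j]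
    rw [this, hsum, zero_mul, Matrix.zero_apply]
  have hinv : (g' * g) * (2 - g' * g) = 1 := by
    have : (g' * g) * (2 - g' * g) = 1 - (g' * g - 1) * (g' * g - 1) := by noncomm_ring
    rw [this, hsq, sub_zero]
  have hdet := congrArg Matrix.det hinv
  rw [Matrix.det_mul, Matrix.det_mul, Matrix.det_one] at hdet
  rw [Matrix.isUnit_iff_isUnit_det]
  exact IsUnit.of_mul_eq_one (g'.det * (2 - g' * g).det) (by rw [← hdet]; ring)

end MonomialData

/-- Every equivariant biholomorphism comes from a monomial symmetry. -/
theorem IsEquivariantBiholomorphism.exists_rel (hm : 0 < m) (hn : 2 * m < n) {k : ℕ}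
    {Λ Λ' : Config m n} (S : Std k Λ) (S' : Std k Λ') {ψ : G Λ ≃* G Λ'}
    {F : Manifold Λ ≃ Manifold Λ'} (H : IsEquivariantBiholomorphism Λ Λ' ψ F) :
    ∃ h : Sym n, Rel k h Λ Λ' ∧ ∀ u, ψ (toG Λ u) = toG Λ' (torusMap h.mat u) := by
  obtain ⟨g₀, hg₀⟩ := S'.admissible.exists_torusMap_of_holomorphic hn ψ.toMonoidHom H.group_holo
  obtain ⟨g₀', hg₀'⟩ :=
    S.admissible.exists_torusMap_of_holomorphic hn ψ.symm.toMonoidHom H.group_holo_symm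
  have D₀ : MonomialData Λ Λ' ψ F g₀ g₀' := ⟨H, S.admissible, S'.admissible, hg₀, hg₀'⟩
  obtain ⟨σ, hσ, hcol, hcol'⟩ := D₀.exists_perm hm hn S S'
  have hone : ∃ c, ∀ l, ∑ i, g₀ l i = c := by
    simpa [Matrix.mulVec, dotProduct] using D₀.mulVec_const hn (a := fun _ => 1) ⟨1, fun _ => rfl⟩
  have hone' : ∃ c, ∀ l, ∑ i, g₀' l i = c := by
    simpa [Matrix.mulVec, dotProduct] using
      D₀.symm.mulVec_const hn (a := fun _ => 1) ⟨1, fun _ => rfl⟩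
  obtain ⟨r, hr, hr1⟩ := exists_normalization g₀ σ hcol hone
  obtain ⟨r', hr', hr1'⟩ := exists_normalization g₀' σ.symm hcol' hone'
  have D := D₀.sub_const r r'
  obtain ⟨U, hU⟩ := D.isUnit_of_sum_eq_one hn hr1 hr1'
  have hmat : Sym.mat (U, σ) = g₀ - Matrix.of fun _ i => r i := hU
  refine ⟨(U, σ), ⟨⟨?_, fun i hi => ?_, hσ⟩, fun x => ?_, fun I => ?_⟩, fun u => ?_⟩
  · funext l
    rw [hmat]
    simpa [Matrix.mulVec, dotProduct] using hr1 l
  · rw [hmat, Matrix.mulVec_single_one]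
    funext l
    simpa [Pi.single_apply] using hr i hi l
  · rw [hmat]
    refine ⟨fun hx => ?_, D.mulVec_mem hn⟩
    have h1 := D.symm.mulVec_mem hn hx
    obtain ⟨c, hc⟩ := D.isScalarTrivial hn x
    rw [Matrix.mulVec_mulVec, ← complexify_mul] at h1
    have h2 := sub_mem h1 (const_mem_leafSpace Λ (x := fun _ => c) (c := c) fun _ => rfl)
    convert h2 using 1
    funext i
    simp only [Pi.sub_apply]
    rw [hc i, add_sub_cancel_right]
  · refine ⟨fun hI => ?_, D₀.image_mem_supp hm hn S hcol⟩
    have := D₀.symm.image_mem_supp hm hn S' hcol' hI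
    rwa [Set.image_image, show (fun i => σ.symm (σ i)) = id from funext σ.symm_apply_apply,
      Set.image_id] at this
  · rw [hmat]
    exact D.map_toG u

/-! ### Monomial symmetries induce equivariant biholomorphisms -/

/-- The monomial map `z ↦ (∏ z_i ^ g_{ji})_j`. -/
noncomputable def monoFun (g : Matrix (Fin n) (Fin n) ℤ) (z : Fin n → ℂ) : Fin n → ℂ :=
  fun j => ∏ i, z i ^ g j i

lemma monoFun_units (g : Matrix (Fin n) (Fin n) ℤ) (u : Fin n → ℂˣ) (j : Fin n) :
    monoFun g (fun i => (u i : ℂ)) j = torusMap g u j := by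
  simp [monoFun, torusMap_apply]

lemma monoFun_mul (g : Matrix (Fin n) (Fin n) ℤ) (u : Fin n → ℂˣ) (z : Fin n → ℂ) (j : Fin n) :
    monoFun g (fun i => (u i : ℂ) * z i) j = (torusMap g u j : ℂ) * monoFun g z j := by
  simp [monoFun, torusMap_apply, mul_zpow, Finset.prod_mul_distrib]

lemma monoFun_one (z : Fin n → ℂ) : monoFun 1 z = z := by
  funext j
  simp only [monoFun]
  rw [Finset.prod_eq_single j]
  · simp
  · intro i _ hi
    simp [Matrix.one_apply_ne hi.symm]
  · simp

namespace IsMonomial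

variable {k : ℕ} {h h' : Sym n}

/-- A coordinate that vanishes has index at least `k` and occurs only with exponents 0 and 1.
Negative exponents meet nonzero coordinates only, and `0 ^ 0 = 1` is the right convention. -/
lemma monoFun_eq_zero_iff (H : IsMonomial k h) {z : Fin n → ℂ} (hz : ∀ i, z i = 0 → k ≤ i)
    (i : Fin n) : monoFun h.mat z (h.2 i) = 0 ↔ z i = 0 := by
  simp only [monoFun, Finset.prod_eq_zero_iff, Finset.mem_univ, true_and]
  constructor
  · rintro ⟨j, hj⟩
    have hzj : z j = 0 := eq_zero_of_zpow_eq_zero hj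
    rw [hzj, H.col (hz j hzj)] at hj
    by_cases hij : h.2 i = h.2 j
    · rw [h.2.injective hij, hzj]
    · simp [hij] at hj
  · intro hi
    exact ⟨i, by rw [H.col (hz i hi)]; simp [hi]⟩

lemma support_monoFun (H : IsMonomial k h) {z : Fin n → ℂ} (hz : ∀ i, z i = 0 → k ≤ i) :
    {j | monoFun h.mat z j ≠ 0} = h.2 '' {i | z i ≠ 0} := by
  ext j
  obtain ⟨i, rfl⟩ := h.2.surjective j
  simp [H.monoFun_eq_zero_iff hz]

/-- Exponents combine as usual at a nonzero `z i`; at a zero `z i` only the intermediate index `h.2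
i` contributes. -/
lemma monoFun_comp (H : IsMonomial k h) {z : Fin n → ℂ} (hz : ∀ i, z i = 0 → k ≤ i) :
    monoFun h'.mat (monoFun h.mat z) = monoFun (h'.mat * h.mat) z := by
  funext l
  simp only [monoFun, ← Finset.prod_zpow]
  rw [Finset.prod_comm]
  refine Finset.prod_congr rfl fun i _ => ?_
  rw [Matrix.mul_apply]
  by_cases hi : z i = 0
  · have hk := hz i hi
    rw [Finset.prod_eq_single (h.2 i), Finset.sum_eq_single (h.2 i)]
    · simp [H.col hk]
    · intro j _ hj
      simp [H.col hk, hj]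
    · simp
    · intro j _ hj
      simp [H.col hk, hj]
    · simp
  · have : ∀ s : Finset (Fin n), ∏ j ∈ s, (z i ^ h.mat j i) ^ h'.mat l j =
        z i ^ ∑ j ∈ s, h'.mat l j * h.mat j i := by
      classical
      intro s
      induction s using Finset.induction_on with
      | empty => simp
      | insert j s hj ih =>
        rw [Finset.prod_insert hj, Finset.sum_insert hj, zpow_add₀ hi, ih, ← zpow_mul, mul_comm]
        ring_nf
    exact this _

lemma differentiableAt_monoFun (H : IsMonomial k h) {z : Fin n → ℂ}
    (hz : ∀ i, z i = 0 → k ≤ i) : DifferentiableAt ℂ (monoFun h.mat) z := by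
  refine differentiableAt_pi.2 fun j => ?_
  suffices hd : ∀ i, DifferentiableAt ℂ (fun z : Fin n → ℂ => z i ^ h.mat j i) z from
    (HasFDerivAt.finsetProd fun i _ => (hd i).hasFDerivAt).differentiableAt
  intro i
  have h1 : DifferentiableAt ℂ (fun z : Fin n → ℂ => z i) z := by fun_prop
  refine DifferentiableAt.comp z (g := fun w : ℂ => w ^ h.mat j i) ?_ h1
  refine differentiableAt_zpow.2 ?_
  by_cases hi : z i = 0
  · right
    rw [H.col (hz i hi)]
    split_ifs <;> simp
  · exact Or.inl hi

end IsMonomial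

lemma Std.zero_le {k : ℕ} {Λ : Config m n} (S : Std k Λ) (z : siegel Λ) (i : Fin n)
    (hi : z.1 i = 0) : k ≤ i :=
  S.le_of_notMem (I := {l | z.1 l ≠ 0}) z.2 (by simpa using hi)

namespace Rel

variable {k : ℕ} {h : Sym n} {Λ Λ' : Config m n}

/-- The monomial map `S_Λ → S_Λ'`. -/
noncomputable def siegelMap (H : Rel k h Λ Λ') (S : Std k Λ) (z : siegel Λ) : siegel Λ' :=
  ⟨monoFun h.mat z.1, by
    rw [mem_siegel_iff, H.isMonomial.support_monoFun (S.zero_le z), H.supp_iff]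
    exact z.2⟩

lemma siegelMap_smul (H : Rel k h Λ Λ') (S : Std k Λ) (u : Fin n → ℂˣ) (z : siegel Λ) :
    H.siegelMap S (u • z) = torusMap h.mat u • H.siegelMap S z :=
  Subtype.ext (funext fun j => monoFun_mul h.mat u z.1 j)

lemma siegelMap_symm (H : Rel k h Λ Λ') (S : Std k Λ) (S' : Std k Λ') (z : siegel Λ) :
    H.symm.siegelMap S' (H.siegelMap S z) = z := by
  refine Subtype.ext ?_
  change monoFun (h⁻¹).mat (monoFun h.mat z.1) = z.1
  rw [H.isMonomial.monoFun_comp (S.zero_le z), Sym.inv_mat_mul, monoFun_one]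

lemma symm_siegelMap (H : Rel k h Λ Λ') (S : Std k Λ) (S' : Std k Λ') (z : siegel Λ') :
    H.siegelMap S (H.symm.siegelMap S' z) = z := by
  refine Subtype.ext ?_
  change monoFun h.mat (monoFun (h⁻¹).mat z.1) = z.1
  rw [H.symm.isMonomial.monoFun_comp (S'.zero_le z), Sym.mat_mul_inv, monoFun_one]

lemma torusMap_mem_iff (H : Rel k h Λ Λ') {u : Fin n → ℂˣ} :
    torusMap h.mat u ∈ leafGroup Λ' ↔ u ∈ leafGroup Λ := by
  refine ⟨fun hu => ?_, torusMap_mem fun x => (H.mem_iff x).2⟩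
  have := torusMap_mem (fun x => (H.symm.mem_iff x).2) hu
  rwa [← torusMap_mul, Sym.inv_mat_mul, torusMap_one] at this

/-- The map `N_Λ → N_Λ'`. -/
noncomputable def manifoldMap (H : Rel k h Λ Λ') (S : Std k Λ) : Manifold Λ → Manifold Λ' :=
  Quotient.lift (fun z => proj Λ' (H.siegelMap S z)) fun z w hzw => by
    obtain ⟨u, hu, rfl⟩ := (proj_eq_iff Λ z w).1 (Quotient.sound hzw)
    exact (proj_eq_iff Λ' _ _).2 ⟨_, H.torusMap_mem_iff.2 hu, (H.siegelMap_smul S u w).symm⟩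

lemma manifoldMap_proj (H : Rel k h Λ Λ') (S : Std k Λ) (z : siegel Λ) :
    H.manifoldMap S (proj Λ z) = proj Λ' (H.siegelMap S z) := rfl

/-- The bijection `N_Λ → N_Λ'`. -/
noncomputable def manifoldEquiv (H : Rel k h Λ Λ') (S : Std k Λ) (S' : Std k Λ') :
    Manifold Λ ≃ Manifold Λ' where
  toFun := H.manifoldMap S
  invFun := H.symm.manifoldMap S'
  left_inv x := by
    obtain ⟨z, rfl⟩ := proj_surjective Λ x
    rw [manifoldMap_proj, manifoldMap_proj, siegelMap_symm]
  right_inv x := by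
    obtain ⟨z, rfl⟩ := proj_surjective Λ' x
    rw [manifoldMap_proj, manifoldMap_proj, symm_siegelMap]

lemma holomorphicN (H : Rel k h Λ Λ') (S : Std k Λ) : HolomorphicN Λ Λ' (H.manifoldMap S) := by
  have hd : ∀ z : siegel Λ, DifferentiableAt ℂ (monoFun h.mat) z.1 := fun z =>
    H.isMonomial.differentiableAt_monoFun (S.zero_le z)
  refine ⟨?_, fun z => ?_⟩
  · refine Continuous.quotient_lift ?_ _
    refine (continuous_proj Λ').comp (Continuous.subtype_mk ?_ _)
    refine continuous_iff_continuousAt.2 fun z => ?_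
    exact (hd z).continuousAt.comp continuous_subtype_val.continuousAt
  · have hO : ∀ i : Fin n, ∀ᶠ w in 𝓝 z.1, w i = 0 → k ≤ i := by
      intro i
      by_cases hi : k ≤ i
      · exact Filter.Eventually.of_forall fun _ _ => hi
      · have : z.1 i ≠ 0 := fun h => hi (S.zero_le z i h)
        filter_upwards [(continuous_apply i).continuousAt.eventually_ne this] with w hw h
        exact absurd h hw
    exact ⟨_, Filter.eventually_all.2 hO, monoFun h.mat, fun w hw =>
      (H.isMonomial.differentiableAt_monoFun hw).differentiableWithinAt,
      fun y _ => ⟨H.siegelMap S y, rfl, rfl⟩⟩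

/-- The isomorphism `G_Λ → G_Λ'`. -/
noncomputable def groupEquiv (H : Rel k h Λ Λ') : G Λ ≃* G Λ' :=
  QuotientGroup.congr (leafGroup Λ) (leafGroup Λ')
    { toFun := torusMap h.mat
      invFun := torusMap (h⁻¹).mat
      left_inv := fun u => by rw [← torusMap_mul, Sym.inv_mat_mul, torusMap_one]
      right_inv := fun u => by rw [← torusMap_mul, Sym.mat_mul_inv, torusMap_one]
      map_mul' := map_mul _ } (by
    ext u
    rw [Subgroup.mem_map]
    constructor
    · rintro ⟨v, hv, rfl⟩
      exact H.torusMap_mem_iff.2 hv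
    · intro hu
      refine ⟨torusMap (h⁻¹).mat u, H.symm.torusMap_mem_iff.2 hu, ?_⟩
      change torusMap h.mat (torusMap (h⁻¹).mat u) = u
      rw [← torusMap_mul, Sym.mat_mul_inv, torusMap_one])

lemma groupEquiv_toG (H : Rel k h Λ Λ') (u : Fin n → ℂˣ) :
    H.groupEquiv (toG Λ u) = toG Λ' (torusMap h.mat u) := rfl

lemma groupEquiv_symm (H : Rel k h Λ Λ') : H.groupEquiv.symm = H.symm.groupEquiv := rfl

lemma holomorphicG (H : Rel k h Λ Λ') : HolomorphicG Λ Λ' H.groupEquiv := by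
  refine ⟨?_, fun u => ?_⟩
  · refine (QuotientGroup.isQuotientMap_mk (leafGroup Λ)).continuous_iff.2 ?_
    change Continuous fun u => (QuotientGroup.mk (torusMap h.mat u) : G Λ')
    refine QuotientGroup.continuous_mk.comp (continuous_pi fun j => ?_)
    change Continuous fun u : Fin n → ℂˣ => ∏ i, u i ^ h.mat j i
    exact continuous_finsetProd _ fun i _ =>
      (continuous_zpow (G := ℂˣ) (h.mat j i)).comp (continuous_apply i)
  · have hO : ∀ᶠ w in 𝓝 (fun i => (u i : ℂ)), ∀ i, w i ≠ 0 := by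
      refine Filter.eventually_all.2 fun i => ?_
      exact (continuous_apply i).continuousAt.eventually_ne (u i).ne_zero
    refine ⟨_, hO, monoFun h.mat, fun w hw =>
      (H.isMonomial.differentiableAt_monoFun
        fun i hi => absurd hi (hw i)).differentiableWithinAt, fun y _ => ?_⟩
    exact ⟨torusMap h.mat y, funext fun j => (monoFun_units h.mat y j).symm, rfl⟩

theorem isEquivariantBiholomorphism (H : Rel k h Λ Λ') (S : Std k Λ) (S' : Std k Λ') :
    IsEquivariantBiholomorphism Λ Λ' H.groupEquiv (H.manifoldEquiv S S') where
  holo := H.holomorphicN S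
  holo_symm := H.symm.holomorphicN S'
  group_holo := H.holomorphicG
  group_holo_symm := by
    rw [groupEquiv_symm]
    exact H.symm.holomorphicG
  equivariant g x := by
    obtain ⟨u, rfl⟩ := toG_surjective Λ g
    obtain ⟨z, rfl⟩ := proj_surjective Λ x
    rw [groupEquiv_toG, toG_smul_proj]
    change H.manifoldMap S (proj Λ (u • z)) = _ • H.manifoldMap S (proj Λ z)
    rw [manifoldMap_proj, manifoldMap_proj, siegelMap_smul, toG_smul_proj]

end Rel

theorem gBiholomorphic_iff (hm : 0 < m) (hn : 2 * m < n) {k : ℕ} {Λ Λ' : Config m n}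
    (S : Std k Λ) (S' : Std k Λ') : GBiholomorphic Λ Λ' ↔ ∃ h : Sym n, Rel k h Λ Λ' := by
  constructor
  · rintro ⟨ψ, F, H⟩
    obtain ⟨h, hh, -⟩ := H.exists_rel hm hn S S'
    exact ⟨h, hh⟩
  · rintro ⟨h, hh⟩
    exact ⟨_, _, hh.isEquivariantBiholomorphism S S'⟩

/-! ### The isotropy groups -/

section Isotropy

variable {k : ℕ} {Λ Λ' : Config m n}

/-- The monomial symmetries of `Λ` act on `G_Λ` by elements of the isotropy group. -/
noncomputable def relGroupHom (S : Std k Λ) : relGroup k Λ →* isotropy Λ where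
  toFun h := ⟨(mem_relGroup.1 h.2).groupEquiv, _, (mem_relGroup.1 h.2).isEquivariantBiholomorphism S S⟩
  map_one' := by
    refine Subtype.ext (MulEquiv.ext fun g => ?_)
    obtain ⟨u, rfl⟩ := toG_surjective Λ g
    exact congrArg (toG Λ) (torusMap_one u)
  map_mul' h h' := by
    refine Subtype.ext (MulEquiv.ext fun g => ?_)
    obtain ⟨u, rfl⟩ := toG_surjective Λ g
    exact congrArg (toG Λ) (torusMap_mul h.1.mat h'.1.mat u)

lemma relGroupHom_toG (S : Std k Λ) (h : relGroup k Λ) (u : Fin n → ℂˣ) :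
    (relGroupHom S h).1 (toG Λ u) = toG Λ (torusMap h.1.mat u) := rfl

lemma relGroupHom_surjective (hm : 0 < m) (hn : 2 * m < n) (S : Std k Λ) :
    Function.Surjective (relGroupHom S) := by
  rintro ⟨ψ, F, H⟩
  obtain ⟨h, hh, hψ⟩ := H.exists_rel hm hn S S
  refine ⟨⟨h, hh⟩, Subtype.ext (MulEquiv.ext fun g => ?_)⟩
  obtain ⟨u, rfl⟩ := toG_surjective Λ g
  rw [relGroupHom_toG, hψ]

lemma relGroupHom_eq_one_iff (hn : 2 * m < n) (S : Std k Λ) (h : relGroup k Λ) :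
    relGroupHom S h = 1 ↔ IsScalarTrivial h.1.mat := by
  rw [S.admissible.isScalarTrivial_iff hn, Subtype.ext_iff, MulEquiv.ext_iff]
  constructor
  · intro H u
    exact H (toG Λ u)
  · intro H g
    obtain ⟨u, rfl⟩ := toG_surjective Λ g
    exact H u

lemma IsMonomial.perm_eq_one {h : Sym n} (H : IsMonomial k h)
    (ht : IsScalarTrivial h.mat) : h.2 = 1 := by
  refine Equiv.ext fun i => ?_
  rcases lt_or_ge (i : ℕ) k with hi | hi
  · exact H.fix i hi
  · obtain ⟨c, hc⟩ := ht.exists_int (Pi.single i 1)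
    rw [H.mulVec_single i hi] at hc
    by_contra hne
    have hne' : h.2 i ≠ i := hne
    have h1 := hc i
    have h2 := hc (h.2 i)
    simp [hne', Ne.symm hne'] at h1 h2
    omega

/-- The first `k` of the affine functions defined by the configuration can be prescribed. -/
lemma exists_leafSpace_of_affineIndependent (hk : k ≤ m + 1)
    (hΛ : AffineIndependent ℂ (fun i : {i : Fin n // (i : ℕ) < m + 1} => Λ i)) (x : Fin n → ℂ) :
    ∃ v ∈ leafSpace Λ, ∀ i : Fin n, (i : ℕ) < k → x i = v i := by
  rcases isEmpty_or_nonempty {i : Fin n // (i : ℕ) < m + 1} with he | ⟨⟨i₀⟩⟩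
  · exact ⟨0, zero_mem _, fun i hi => (he.false ⟨i, by omega⟩).elim⟩
  rw [affineIndependent_iff_linearIndependent_vsub ℂ _ i₀] at hΛ
  obtain ⟨f, hf⟩ := LinearMap.exists_extend
    ((Module.Basis.span hΛ).constr ℂ fun i => x i.1 - x i₀)
  replace hf : ∀ i : {i // i ≠ i₀}, f (Λ i.1 -ᵥ Λ i₀) = x i.1 - x i₀ := by
    intro i
    have := LinearMap.congr_fun hf (Module.Basis.span hΛ i)
    rw [Module.Basis.constr_basis] at this
    simpa [Module.Basis.span_apply] using this
  refine ⟨fun i => x i₀ + f (Λ i - Λ i₀), ?_, fun i hi => ?_⟩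
  · refine ⟨x i₀ - f (Λ i₀), fun j => f (Pi.single j 1), fun i => ?_⟩
    have : f (Λ i) = Λ i ⬝ᵥ fun j => f (Pi.single j 1) := by
      conv_lhs => rw [pi_eq_sum_univ' (Λ i)]
      rw [map_sum]
      simp [dotProduct]
    simp only [map_sub, ← this]
    ring
  · by_cases h : (⟨i, by omega⟩ : {i : Fin n // (i : ℕ) < m + 1}) = i₀
    · have : i = i₀ := congrArg Subtype.val h
      simp [this]
    · have := hf ⟨_, h⟩
      simp only [vsub_eq_sub] at this
      simp only [this]
      ring

/-- Modulo the leaf space every vector vanishes on the first `k` indices, by affine independence.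
The remaining basis vectors are fixed, so `h` moves every vector by an element of the leaf space. -/
lemma Rel.isScalarTrivial_of_perm_eq_one (hn : 2 * m < n) (S : Std k Λ) (hk : k ≤ m + 1)
    (hΛ : AffineIndependent ℂ (fun i : {i : Fin n // (i : ℕ) < m + 1} => Λ i)) {h : Sym n}
    (H : Rel k h Λ Λ) (h1 : h.2 = 1) : IsScalarTrivial h.mat := by
  have key : ∀ x : Fin n → ℂ, (complexify h.mat).mulVec x - x ∈ leafSpace Λ := by
    intro x
    obtain ⟨v, hv, hxv⟩ := exists_leafSpace_of_affineIndependent hk hΛ x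
    have h2 : (complexify h.mat).mulVec (x - v) = x - v := by
      funext l
      rw [complexify_mulVec_apply, Finset.sum_eq_single l]
      · rcases lt_or_ge (l : ℕ) k with hl | hl
        · simp [hxv l hl]
        · rw [H.isMonomial.col hl, h1]; simp
      · intro i _ hi
        rcases lt_or_ge (i : ℕ) k with hik | hik
        · simp [hxv i hik]
        · rw [H.isMonomial.col hik, h1]; simp [hi.symm]
      · simp
    have h3 : (complexify h.mat).mulVec x - x = (complexify h.mat).mulVec v - v := by
      rw [Matrix.mulVec_sub] at h2
      rw [sub_eq_sub_iff_sub_eq_sub, h2]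
    rw [h3]
    exact sub_mem ((H.mem_iff v).2 hv) hv
  refine (S.admissible.isScalarTrivial_iff hn).2 fun u => ?_
  obtain ⟨x, rfl⟩ := torusExp_surjective u
  rw [torusMap_exp, ← mul_inv_eq_one, ← map_inv, ← map_mul, ← torusExp_sub, toG_eq_one]
  exact torusExp_mem (key x)

/-- Isotropy groups, their permutation images and the chart groups are all quotients of groups
`relGroup`; they are identified by comparing kernels. -/
lemma exists_mulEquiv_of_ker_eq {A B C : Type*} [Group A] [Group B] [Group C] (f : A →* B)
    (g : A →* C) (hf : Function.Surjective f) (hg : Function.Surjective g)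
    (h : ∀ a, f a = 1 ↔ g a = 1) : ∃ e : B ≃* C, ∀ a, e (f a) = g a := by
  have hk : f.ker = g.ker := Subgroup.ext fun a => h a
  refine ⟨(QuotientGroup.quotientKerEquivOfSurjective f hf).symm.trans
    ((QuotientGroup.quotientMulEquivOfEq hk).trans
      (QuotientGroup.quotientKerEquivOfSurjective g hg)), fun a => ?_⟩
  have h1 : (QuotientGroup.quotientKerEquivOfSurjective f hf).symm (f a) = (a : A ⧸ f.ker) :=
    (MulEquiv.symm_apply_eq _).2 rfl
  simp only [MulEquiv.trans_apply, h1]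
  rfl

theorem isotropy_finite_embedding (hm : 0 < m) (hn : 2 * m < n) (S : Std k Λ) (hk : k ≤ m + 1)
    (hΛ : AffineIndependent ℂ (fun i : {i : Fin n // (i : ℕ) < m + 1} => Λ i)) :
    Finite (isotropy Λ) ∧ ∃ f : isotropy Λ →* Equiv.Perm {i : Fin n // ¬ Indispensable Λ i},
      Function.Injective f := by
  have hstab : ∀ (h : relGroup k Λ) (i : Fin n), ¬ Indispensable Λ i ↔ ¬ Indispensable Λ (h.1.2 i) := by
    intro h i
    rw [S.indispensable_iff, S.indispensable_iff, not_lt, not_lt]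
    refine ⟨fun hi => h.2.isMonomial.le_apply hi, fun hi => ?_⟩
    by_contra! hlt
    rw [h.2.isMonomial.fix i hlt] at hi
    omega
  let p : relGroup k Λ →* Equiv.Perm {i : Fin n // ¬ Indispensable Λ i} :=
    { toFun := fun h => h.1.2.subtypePerm fun i => (hstab h i).symm
      map_one' := Equiv.ext fun i => rfl
      map_mul' := fun h h' => Equiv.ext fun i => rfl }
  have hp : ∀ h, relGroupHom S h = 1 ↔ p.rangeRestrict h = 1 := by
    intro h
    rw [relGroupHom_eq_one_iff hn]
    constructor
    · intro ht
      have h1 := h.2.isMonomial.perm_eq_one ht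
      refine Subtype.ext (Equiv.ext fun i => Subtype.ext ?_)
      change h.1.2 i = i
      rw [h1]; rfl
    · intro h1
      refine Rel.isScalarTrivial_of_perm_eq_one hn S hk hΛ h.2 (Equiv.ext fun i => ?_)
      rcases lt_or_ge (i : ℕ) k with hi | hi
      · exact h.2.isMonomial.fix i hi
      · have h2 := congrArg Subtype.val (Equiv.ext_iff.1 (congrArg Subtype.val h1)
          ⟨i, by rw [S.indispensable_iff]; omega⟩)
        exact h2
  obtain ⟨e, -⟩ := exists_mulEquiv_of_ker_eq (relGroupHom S) p.rangeRestrict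
    (relGroupHom_surjective hm hn S) p.rangeRestrict_surjective hp
  exact ⟨Finite.of_injective e e.injective, p.range.subtype.comp e.toMonoidHom,
    (Subtype.val_injective).comp e.injective⟩

lemma isotropy_equiv_of_gBiholomorphic (H : GBiholomorphic Λ Λ') :
    Nonempty (isotropy Λ ≃* isotropy Λ') := by
  obtain ⟨ψ, F, H⟩ := H
  refine ⟨((MulAut.congr ψ).subgroupMap (isotropy Λ)).trans (MulEquiv.subgroupCongr ?_)⟩
  ext φ
  rw [Subgroup.mem_map]
  constructor
  · rintro ⟨φ, ⟨E, hE⟩, rfl⟩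
    exact ⟨_, (H.symm.trans hE).trans H⟩
  · rintro ⟨E, hE⟩
    refine ⟨(MulAut.congr ψ).symm φ, ⟨_, (H.trans hE).trans H.symm⟩, ?_⟩
    exact (MulAut.congr ψ).apply_symm_apply φ

end Isotropy

/-! ### Affine coordinates on the space of configurations -/

/-- The indices of the first `m` vectors. -/
def topIdx (hmn : m < n) (j : Fin m) : Fin n := ⟨j, by omega⟩

/-- The index of the vector number `m + 1`. -/
def midIdx (hmn : m < n) : Fin n := ⟨m, hmn⟩

/-- The indices of the last `n - m - 1` vectors. -/
def botIdx (i : Fin (n - m - 1)) : Fin n := ⟨m + 1 + i, by omega⟩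

lemma index_cases (hmn : m < n) {p : Fin n → Prop} (h1 : ∀ j, p (topIdx hmn j)) (h2 : p (midIdx hmn))
    (h3 : ∀ i : Fin (n - m - 1), p (botIdx i)) (l : Fin n) : p l := by
  rcases lt_trichotomy (l : ℕ) m with h | h | h
  · exact h1 ⟨l, h⟩
  · have : l = midIdx hmn := Fin.ext h
    rwa [this]
  · have : l = botIdx (m := m) ⟨l - m - 1, by omega⟩ := Fin.ext (by simp only [botIdx]; omega)
    rw [this]
    exact h3 _

/-- The configuration whose first `m` vectors are the canonical basis, whose vector number `m + 1`
is `0`, and whose last vectors have the given coordinates. -/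
def nf (x : Fin (m * (n - m - 1)) → ℂ) : Config m n := fun l j =>
  if (l : ℕ) < m then (if (l : ℕ) = j then 1 else 0)
  else if h : m < (l : ℕ) then x (finProdFinEquiv (j, ⟨l - m - 1, by omega⟩)) else 0

lemma nf_top (hmn : m < n) (x : Fin (m * (n - m - 1)) → ℂ) (j : Fin m) :
    nf x (topIdx hmn j) = Pi.single j 1 := by
  funext i
  rcases eq_or_ne i j with rfl | h
  · simp [nf, topIdx]
  · have : (j : ℕ) ≠ i := fun h' => h (Fin.ext h'.symm)
    simp [nf, topIdx, h, this]

lemma nf_mid (hmn : m < n) (x : Fin (m * (n - m - 1)) → ℂ) : nf x (midIdx hmn) = 0 := by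
  funext i
  simp [nf, midIdx]

lemma nf_bot (x : Fin (m * (n - m - 1)) → ℂ) (i : Fin (n - m - 1)) (j : Fin m) :
    nf x (botIdx i) j = x (finProdFinEquiv (j, i)) := by
  have h1 : ¬ (m + 1 + (i : ℕ) < m) := by omega
  have h2 : m < m + 1 + (i : ℕ) := by omega
  have h3 : m + 1 + (i : ℕ) - m - 1 = i := by omega
  simp [nf, botIdx, h1, h2, h3]

lemma differentiable_nf (l : Fin n) (j : Fin m) :
    Differentiable ℂ fun x : Fin (m * (n - m - 1)) → ℂ => nf x l j := by
  unfold nf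
  split_ifs <;> fun_prop

/-- The matrix whose columns are the differences of the first `m` vectors and the next one. -/
def frame (hmn : m < n) (Λ : Config m n) : Matrix (Fin m) (Fin m) ℂ :=
  Matrix.of fun a j => Λ (topIdx hmn j) a - Λ (midIdx hmn) a

/-- The coordinates of the last vectors in the affine frame of the first ones. -/
noncomputable def coord (hmn : m < n) (Λ : Config m n) : Fin (m * (n - m - 1)) → ℂ := fun e =>
  ((frame hmn Λ)⁻¹.mulVec (Λ (botIdx (finProdFinEquiv.symm e).2) - Λ (midIdx hmn)))
    (finProdFinEquiv.symm e).1

/-- The configuration with the given coordinates in the affine frame of `Λ`. -/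
def withFrame (hmn : m < n) (Λ : Config m n) (x : Fin (m * (n - m - 1)) → ℂ) : Config m n :=
  fun l => Λ (midIdx hmn) + (frame hmn Λ).mulVec (nf x l)

lemma frame_mulVec_single (hmn : m < n) (Λ : Config m n) (j : Fin m) :
    (frame hmn Λ).mulVec (Pi.single j 1) = Λ (topIdx hmn j) - Λ (midIdx hmn) := by
  rw [Matrix.mulVec_single_one]
  rfl

lemma nf_coord (hmn : m < n) {Λ : Config m n} (hΛ : (frame hmn Λ).det ≠ 0) (l : Fin n) :
    nf (coord hmn Λ) l = (frame hmn Λ)⁻¹.mulVec (Λ l - Λ (midIdx hmn)) := by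
  induction l using index_cases hmn with
  | h1 j =>
    rw [nf_top, ← frame_mulVec_single, Matrix.mulVec_mulVec,
      Matrix.nonsing_inv_mul _ (isUnit_iff_ne_zero.2 hΛ), Matrix.one_mulVec]
  | h2 => rw [nf_mid, sub_self, Matrix.mulVec_zero]
  | h3 i =>
    funext j
    rw [nf_bot, coord, Equiv.symm_apply_apply]

lemma withFrame_coord (hmn : m < n) {Λ : Config m n} (hΛ : (frame hmn Λ).det ≠ 0) :
    withFrame hmn Λ (coord hmn Λ) = Λ := by
  funext l
  rw [withFrame, nf_coord hmn hΛ, Matrix.mulVec_mulVec,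
    Matrix.mul_nonsing_inv _ (isUnit_iff_ne_zero.2 hΛ), Matrix.one_mulVec, add_sub_cancel]

lemma withFrame_top (hmn : m < n) (Λ : Config m n) (x : Fin (m * (n - m - 1)) → ℂ) (j : Fin m) :
    withFrame hmn Λ x (topIdx hmn j) = Λ (topIdx hmn j) := by
  rw [withFrame, nf_top, frame_mulVec_single, add_sub_cancel]

lemma withFrame_mid (hmn : m < n) (Λ : Config m n) (x : Fin (m * (n - m - 1)) → ℂ) :
    withFrame hmn Λ x (midIdx hmn) = Λ (midIdx hmn) := by
  rw [withFrame, nf_mid, Matrix.mulVec_zero, add_zero]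

lemma frame_withFrame (hmn : m < n) (Λ : Config m n) (x : Fin (m * (n - m - 1)) → ℂ) :
    frame hmn (withFrame hmn Λ x) = frame hmn Λ := by
  ext a j
  simp [frame, withFrame_top, withFrame_mid]

lemma coord_withFrame (hmn : m < n) {Λ : Config m n} (hΛ : (frame hmn Λ).det ≠ 0)
    (x : Fin (m * (n - m - 1)) → ℂ) : coord hmn (withFrame hmn Λ x) = x := by
  funext e
  rw [coord, frame_withFrame, withFrame_mid, withFrame, add_sub_cancel_left, Matrix.mulVec_mulVec,
    Matrix.nonsing_inv_mul _ (isUnit_iff_ne_zero.2 hΛ), Matrix.one_mulVec, nf_bot]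
  exact congrArg x (finProdFinEquiv.apply_symm_apply e)

/-- An affine change of the vectors is absorbed by a change of `c` and `T`. -/
lemma leafSpace_affine_le (Λ : Config m n) (p : Fin m → ℂ) (M : Matrix (Fin m) (Fin m) ℂ) :
    leafSpace (fun l => p + M.mulVec (Λ l)) ≤ leafSpace Λ := by
  rintro z ⟨c, T, hz⟩
  refine ⟨c + p ⬝ᵥ T, M.transpose.mulVec T, fun l => ?_⟩
  rw [hz l, add_dotProduct, Matrix.mulVec_transpose, ← add_assoc, dotProduct_comm (M.mulVec _),
    Matrix.dotProduct_mulVec, dotProduct_comm (Λ l)]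

lemma leafSpace_withFrame (hmn : m < n) {Λ : Config m n} (hΛ : (frame hmn Λ).det ≠ 0)
    (x : Fin (m * (n - m - 1)) → ℂ) : leafSpace (withFrame hmn Λ x) = leafSpace (nf x) := by
  refine le_antisymm (leafSpace_affine_le _ _ _) ?_
  have := leafSpace_affine_le (withFrame hmn Λ x) (-(frame hmn Λ)⁻¹.mulVec (Λ (midIdx hmn)))
    (frame hmn Λ)⁻¹
  convert this using 2
  funext l
  rw [withFrame, Matrix.mulVec_add, Matrix.mulVec_mulVec,
    Matrix.nonsing_inv_mul _ (isUnit_iff_ne_zero.2 hΛ), Matrix.one_mulVec, neg_add_cancel_left]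

lemma leafSpace_eq_nf (hmn : m < n) {Λ : Config m n} (hΛ : (frame hmn Λ).det ≠ 0) :
    leafSpace Λ = leafSpace (nf (coord hmn Λ)) := by
  conv_lhs => rw [← withFrame_coord hmn hΛ]
  exact leafSpace_withFrame hmn hΛ _

/-- The zero vector at `midIdx` reads off `c` and the canonical basis reads off `T`, so the leaf
space is a graph over the first `m + 1` entries. -/
lemma mem_leafSpace_nf (hmn : m < n) {x : Fin (m * (n - m - 1)) → ℂ} {z : Fin n → ℂ} :
    z ∈ leafSpace (nf x) ↔
      ∀ l, z l = z (midIdx hmn) + nf x l ⬝ᵥ fun j => z (topIdx hmn j) - z (midIdx hmn) := by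
  constructor
  · rintro ⟨c, T, hz⟩
    have hmid : z (midIdx hmn) = c := by rw [hz, nf_mid, zero_dotProduct, add_zero]
    have htop : (fun j => z (topIdx hmn j) - z (midIdx hmn)) = T := by
      funext j
      rw [hmid, hz, nf_top, single_dotProduct, one_mul, add_sub_cancel_left]
    rw [htop, hmid]
    exact hz
  · intro h
    exact ⟨_, _, h⟩

lemma eq_zero_of_mem_leafSpace_nf (hmn : m < n) {x : Fin (m * (n - m - 1)) → ℂ} {z : Fin n → ℂ}
    (hz : z ∈ leafSpace (nf x)) (h1 : ∀ j, z (topIdx hmn j) = 0) (h2 : z (midIdx hmn) = 0) :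
    z = 0 := by
  funext l
  rw [(mem_leafSpace_nf hmn).1 hz l]
  simp [h1, h2, dotProduct]

lemma nf_col_mem (x : Fin (m * (n - m - 1)) → ℂ) (j : Fin m) :
    (fun l : Fin n => nf x l j) ∈ leafSpace (nf x) :=
  ⟨0, Pi.single j 1, fun l => by simp⟩

/-- The `j`-th columns of `nf x` and `nf y` agree in the first `m + 1` entries, so they coincide
once both lie in the same graph. -/
lemma nf_injective_of_le (hmn : m < n) {x y : Fin (m * (n - m - 1)) → ℂ}
    (h : leafSpace (nf (n := n) x) ≤ leafSpace (nf (n := n) y)) : x = y := by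
  funext e
  obtain ⟨⟨j, i⟩, rfl⟩ := finProdFinEquiv.surjective e
  have h1 := sub_mem (h (nf_col_mem x j)) (nf_col_mem y j)
  have h2 := eq_zero_of_mem_leafSpace_nf hmn h1 (fun j' => by simp [nf_top]) (by simp [nf_mid])
  have h3 := congrFun h2 (botIdx i)
  simp only [Pi.sub_apply, nf_bot, Pi.zero_apply] at h3
  exact sub_eq_zero.1 h3

/-- The parameters `T` that express the columns of `nf y` as leaf vectors of `Λ` form an inverse of
the transposed frame. -/
lemma coord_eq_of_le (hmn : m < n) {y : Fin (m * (n - m - 1)) → ℂ} {Λ : Config m n}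
    (h : leafSpace (nf y) ≤ leafSpace Λ) : (frame hmn Λ).det ≠ 0 ∧ coord hmn Λ = y := by
  have h1 : ∀ j : Fin m, ∃ T : Fin m → ℂ, ∀ i : Fin m,
      (Λ (topIdx hmn i) - Λ (midIdx hmn)) ⬝ᵥ T = (1 : Matrix (Fin m) (Fin m) ℂ) i j := by
    intro j
    obtain ⟨c, T, hT⟩ := h (nf_col_mem y j)
    refine ⟨T, fun i => ?_⟩
    have e1 := hT (topIdx hmn i)
    have e2 := hT (midIdx hmn)
    simp only [nf_top, nf_mid, Pi.zero_apply] at e1 e2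
    rw [sub_dotProduct, Matrix.one_apply, ← add_sub_add_left_eq_sub _ _ c, ← e1, ← e2, sub_zero,
      Pi.single_apply]
    simp [eq_comm]
  choose T hT using h1
  have hinv : (frame hmn Λ).transpose * Matrix.of (fun a j => T j a) = 1 := by
    ext i j
    rw [← hT j i, Matrix.mul_apply]
    rfl
  have hdet : (frame hmn Λ).det ≠ 0 := by
    have := congrArg Matrix.det hinv
    rw [Matrix.det_mul, Matrix.det_transpose, Matrix.det_one] at this
    exact left_ne_zero_of_mul_eq_one this
  refine ⟨hdet, (nf_injective_of_le hmn ?_).symm⟩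
  rwa [← leafSpace_eq_nf hmn hdet]

/-! ### Differentiability -/

lemma DifferentiableAt.matrix_det {E ι : Type*} [NormedAddCommGroup E] [NormedSpace ℂ E]
    [Fintype ι] [DecidableEq ι] {A : E → Matrix ι ι ℂ} {x : E}
    (hA : ∀ i j, DifferentiableAt ℂ (fun e => A e i j) x) :
    DifferentiableAt ℂ (fun e => (A e).det) x := by
  simp only [Matrix.det_apply]
  refine DifferentiableAt.fun_sum fun σ _ => DifferentiableAt.const_smul ?_ _
  exact (HasFDerivAt.finsetProd fun i _ => (hA _ i).hasFDerivAt).differentiableAt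

lemma DifferentiableAt.matrix_inv {E ι : Type*} [NormedAddCommGroup E] [NormedSpace ℂ E]
    [Fintype ι] [DecidableEq ι] {A : E → Matrix ι ι ℂ} {x : E}
    (hA : ∀ i j, DifferentiableAt ℂ (fun e => A e i j) x) (hx : (A x).det ≠ 0) (i j : ι) :
    DifferentiableAt ℂ (fun e => (A e)⁻¹ i j) x := by
  simp only [Matrix.inv_def, Ring.inverse_eq_inv', Matrix.smul_apply, smul_eq_mul,
    Matrix.adjugate_apply]
  refine (DifferentiableAt.inv (DifferentiableAt.matrix_det hA) hx).mul
    (DifferentiableAt.matrix_det fun a b => ?_)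
  by_cases h : a = j
  · subst h
    simp
  · simpa [Matrix.updateRow_ne h] using hA a b

lemma differentiable_frame (hmn : m < n) (i j : Fin m) :
    Differentiable ℂ fun Λ : Config m n => frame hmn Λ i j := by
  simp only [frame, Matrix.of_apply]
  fun_prop

lemma differentiableAt_coord (hmn : m < n) {Λ : Config m n} (hΛ : (frame hmn Λ).det ≠ 0) :
    DifferentiableAt ℂ (coord hmn) Λ := by
  refine differentiableAt_pi.2 fun e => ?_
  simp only [coord, Matrix.mulVec, dotProduct]
  refine DifferentiableAt.fun_sum fun i _ => DifferentiableAt.mul ?_ ?_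
  · exact DifferentiableAt.matrix_inv (A := fun Λ => frame hmn Λ)
      (fun a b => (differentiable_frame hmn a b).differentiableAt) hΛ _ _
  · simp only [Pi.sub_apply]
    fun_prop

lemma differentiable_withFrame (hmn : m < n) (Λ : Config m n) :
    Differentiable ℂ (withFrame hmn Λ) := by
  refine differentiable_pi.2 fun l => differentiable_pi.2 fun a => ?_
  simp only [withFrame, Pi.add_apply, Matrix.mulVec, dotProduct]
  refine (differentiable_const _).add (Differentiable.fun_sum fun j _ => ?_)
  exact (differentiable_const _).mul (differentiable_nf l j)

lemma eventually_frame_det_ne_zero (hmn : m < n) {Λ : Config m n} (hΛ : (frame hmn Λ).det ≠ 0) :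
    ∀ᶠ Λ' in 𝓝 Λ, (frame hmn Λ').det ≠ 0 :=
  (DifferentiableAt.matrix_det (A := fun Λ => frame hmn Λ)
    fun a b => (differentiable_frame hmn a b).differentiableAt).continuousAt.eventually_ne hΛ

/-- The map `withFrame hmn Λ` is a holomorphic section of `coord` through `Λ`. -/
lemma surjective_fderiv_coord (hmn : m < n) {Λ : Config m n} (hΛ : (frame hmn Λ).det ≠ 0) :
    Function.Surjective (fderiv ℂ (coord hmn) Λ) := by
  have h1 := (differentiableAt_coord hmn hΛ).hasFDerivAt
  have h2 := ((differentiable_withFrame hmn Λ).differentiableAt (x := coord hmn Λ)).hasFDerivAt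
  rw [← withFrame_coord hmn hΛ] at h1
  have h3 := h1.comp _ h2
  rw [withFrame_coord hmn hΛ] at h3
  have h4 : coord hmn ∘ withFrame hmn Λ = id := funext fun x => coord_withFrame hmn hΛ x
  rw [h4] at h3
  have h5 := h3.unique (hasFDerivAt_id _)
  intro v
  exact ⟨fderiv ℂ (withFrame hmn Λ) (coord hmn Λ) v, by
    have := DFunLike.congr_fun h5 v
    simpa using this⟩

lemma affineIndependent_iff_frame (hmn : m < n) (Λ : Config m n) :
    AffineIndependent ℂ (fun i : {i : Fin n // (i : ℕ) < m + 1} => Λ i) ↔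
      (frame hmn Λ).det ≠ 0 := by
  let i₀ : {i : Fin n // (i : ℕ) < m + 1} := ⟨midIdx hmn, by simp [midIdx]⟩
  let e : Fin m ≃ {i : {i : Fin n // (i : ℕ) < m + 1} // i ≠ i₀} :=
    { toFun := fun j => ⟨⟨topIdx hmn j, by simp only [topIdx]; omega⟩, fun h => by
        have := congrArg (fun i : {i : Fin n // (i : ℕ) < m + 1} => (i.1 : ℕ)) h
        simp [topIdx, i₀, midIdx] at this
        omega⟩
      invFun := fun i => ⟨i.1.1, by
        have h1 := i.1.2
        have h2 : (i.1.1 : ℕ) ≠ m := fun h => i.2 (Subtype.ext (Fin.ext h))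
        omega⟩
      left_inv := fun j => rfl
      right_inv := fun i => rfl }
  rw [affineIndependent_iff_linearIndependent_vsub ℂ _ i₀, ← linearIndependent_equiv e,
    ← isUnit_iff_ne_zero, ← Matrix.isUnit_iff_isUnit_det, ← Matrix.linearIndependent_cols_iff_isUnit]
  rfl

/-! ### The action of monomial symmetries on the coordinates -/

/-- The action of integer matrices on configurations. -/
def mulConfig (g : Matrix (Fin n) (Fin n) ℤ) (Λ : Config m n) : Config m n :=
  fun l a => ∑ i, (g l i : ℂ) * Λ i a

/-- Constant vectors are fixed by a symmetry, so it acts on leaf vectors through the configuration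
alone. -/
lemma mulVec_leaf {k : ℕ} {h : Sym n} (H : IsMonomial k h) (Λ : Config m n) (c : ℂ)
    (T : Fin m → ℂ) : (complexify h.mat).mulVec (fun i => c + Λ i ⬝ᵥ T) =
      fun l => c + mulConfig h.mat Λ l ⬝ᵥ T := by
  have h1 : (fun i => c + Λ i ⬝ᵥ T) = (fun _ => c) + fun i => Λ i ⬝ᵥ T := rfl
  rw [h1, Matrix.mulVec_add, H.complexify_mulVec_const]
  funext l
  simp only [Pi.add_apply, complexify_mulVec_apply, mulConfig, dotProduct, Finset.mul_sum,
    Finset.sum_mul]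
  rw [Finset.sum_comm]
  simp only [mul_assoc]

lemma mem_leafSpace_mulConfig {k : ℕ} {h : Sym n} (H : IsMonomial k h) (Λ : Config m n)
    (z : Fin n → ℂ) :
    (complexify h.mat).mulVec z ∈ leafSpace (mulConfig h.mat Λ) ↔ z ∈ leafSpace Λ := by
  constructor
  · rintro ⟨c, T, hz⟩
    have h1 : (complexify h.mat).mulVec z = (complexify h.mat).mulVec (fun i => c + Λ i ⬝ᵥ T) := by
      rw [mulVec_leaf H]
      exact funext hz
    have h2 := congrArg (complexify (h⁻¹).mat).mulVec h1
    rw [Sym.complexify_inv_mulVec, Sym.complexify_inv_mulVec] at h2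
    exact ⟨c, T, congrFun h2⟩
  · rintro ⟨c, T, hz⟩
    refine ⟨c, T, fun l => ?_⟩
    rw [funext hz, mulVec_leaf H]

/-- The symmetry `h` carries the subspace with coordinates `x` to the one with coordinates `y`. -/
def Carries (m : ℕ) (h : Sym n) (x y : Fin (m * (n - m - 1)) → ℂ) : Prop :=
  ∀ z, (complexify h.mat).mulVec z ∈ leafSpace (nf (n := n) y) ↔ z ∈ leafSpace (nf (n := n) x)

/-- The action of a symmetry on the coordinates. -/
noncomputable def move (hmn : m < n) (h : Sym n) (x : Fin (m * (n - m - 1)) → ℂ) :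
    Fin (m * (n - m - 1)) → ℂ := coord hmn (mulConfig h.mat (nf x))

/-- The domain of definition of the action of a symmetry on the coordinates. -/
def Movable (hmn : m < n) (h : Sym n) (x : Fin (m * (n - m - 1)) → ℂ) : Prop :=
  (frame hmn (mulConfig h.mat (nf x))).det ≠ 0

namespace Carries

variable {k : ℕ} {h h' : Sym n} {x y z : Fin (m * (n - m - 1)) → ℂ}

lemma one (x : Fin (m * (n - m - 1)) → ℂ) : Carries m (1 : Sym n) x x := fun z => by simp

lemma trans (H : Carries m h x y) (H' : Carries m h' y z) : Carries m (h' * h) x z := fun w => by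
  rw [Sym.mat_mul, complexify_mul, ← Matrix.mulVec_mulVec, H' _, H _]

lemma symm (H : Carries m h x y) : Carries m h⁻¹ y x := fun w => by
  rw [← H _, Sym.complexify_mulVec_inv]

lemma iff_move (hmn : m < n) (H : IsMonomial k h) :
    Carries m h x y ↔ Movable hmn h x ∧ move hmn h x = y := by
  constructor
  · intro hc
    refine coord_eq_of_le hmn fun w hw => ?_
    rw [← Sym.complexify_mulVec_inv h w] at hw ⊢
    rw [mem_leafSpace_mulConfig H]
    exact (hc _).1 hw
  · rintro ⟨h1, rfl⟩ w
    rw [move, ← leafSpace_eq_nf hmn h1, mem_leafSpace_mulConfig H]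

lemma right_unique (hmn : m < n) (H : IsMonomial k h) (h1 : Carries m h x y)
    (h2 : Carries m h x z) : y = z :=
  ((iff_move hmn H).1 h1).2.symm.trans ((iff_move hmn H).1 h2).2

end Carries

lemma differentiable_mulConfig_nf (g : Matrix (Fin n) (Fin n) ℤ) :
    Differentiable ℂ fun x : Fin (m * (n - m - 1)) → ℂ => mulConfig g (nf x) := by
  refine differentiable_pi.2 fun l => differentiable_pi.2 fun a => ?_
  exact Differentiable.fun_sum fun i _ => (differentiable_const _).mul (differentiable_nf i a)

lemma differentiableAt_move (hmn : m < n) {h : Sym n} {x : Fin (m * (n - m - 1)) → ℂ}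
    (hx : Movable hmn h x) : DifferentiableAt ℂ (move hmn h) x :=
  (differentiableAt_coord hmn hx).comp x (differentiable_mulConfig_nf h.mat).differentiableAt

lemma eventually_movable (hmn : m < n) {h : Sym n} {x : Fin (m * (n - m - 1)) → ℂ}
    (hx : Movable hmn h x) : ∀ᶠ y in 𝓝 x, Movable hmn h y :=
  (differentiable_mulConfig_nf h.mat).continuous.continuousAt.eventually
    (eventually_frame_det_ne_zero hmn hx)

/-! ### Proper discontinuity -/

/-- The defect of a vector from lying in the subspace with coordinates `y`. -/
def defect (hmn : m < n) (y : Fin (m * (n - m - 1)) → ℂ) : (Fin n → ℂ) →ₗ[ℂ] (Fin n → ℂ) where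
  toFun z l := z l - z (midIdx hmn) - nf y l ⬝ᵥ fun j => z (topIdx hmn j) - z (midIdx hmn)
  map_add' z w := by
    funext l
    have : (fun j => (z + w) (topIdx hmn j) - (z + w) (midIdx hmn)) =
        (fun j => z (topIdx hmn j) - z (midIdx hmn)) +
          fun j => w (topIdx hmn j) - w (midIdx hmn) := by
      funext j; simp only [Pi.add_apply]; ring
    rw [this, dotProduct_add]
    simp only [Pi.add_apply]
    ring
  map_smul' a z := by
    funext l
    have : (fun j => (a • z) (topIdx hmn j) - (a • z) (midIdx hmn)) =
        a • fun j => z (topIdx hmn j) - z (midIdx hmn) := by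
      funext j; simp only [Pi.smul_apply, smul_eq_mul]; ring
    rw [this, dotProduct_smul]
    simp only [Pi.smul_apply, smul_eq_mul, RingHom.id_apply]
    ring

lemma defect_apply (hmn : m < n) (y : Fin (m * (n - m - 1)) → ℂ) (z : Fin n → ℂ) (l : Fin n) :
    defect hmn y z l =
      z l - z (midIdx hmn) - nf y l ⬝ᵥ fun j => z (topIdx hmn j) - z (midIdx hmn) := rfl

lemma defect_eq_zero_iff (hmn : m < n) {y : Fin (m * (n - m - 1)) → ℂ} {z : Fin n → ℂ} :
    defect hmn y z = 0 ↔ z ∈ leafSpace (nf y) := by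
  rw [mem_leafSpace_nf hmn, funext_iff]
  refine forall_congr' fun l => ?_
  rw [defect_apply, Pi.zero_apply, sub_sub, sub_eq_zero]

lemma continuous_nf_apply (l : Fin n) (j : Fin m) :
    Continuous fun x : Fin (m * (n - m - 1)) → ℂ => nf x l j :=
  (differentiable_nf l j).continuous

lemma continuous_defect {X : Type*} [TopologicalSpace X] (hmn : m < n)
    {f : X → Fin (m * (n - m - 1)) → ℂ} {g : X → Fin n → ℂ} (hf : Continuous f)
    (hg : Continuous g) : Continuous fun p => defect hmn (f p) (g p) := by
  have hg' : ∀ l, Continuous fun p => g p l := fun l => (continuous_apply l).comp hg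
  refine continuous_pi fun l => ?_
  simp only [defect_apply, dotProduct]
  refine ((hg' l).sub (hg' _)).sub (continuous_finsetSum _ fun j _ => ?_)
  exact ((continuous_nf_apply l j).comp hf).mul ((hg' _).sub (hg' _))

/-- The subspace with coordinates `y` contains no real vectors but the constant ones. -/
def RealConst (m n : ℕ) (y : Fin (m * (n - m - 1)) → ℂ) : Prop :=
  ∀ v : Fin n → ℝ, (fun i => (v i : ℂ)) ∈ leafSpace (nf (n := n) y) → ∃ c, ∀ i, v i = c

/-- A real vector with zero defect at `b` and zero entry at `midIdx` is constant, hence zero.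
Compactness of the unit sphere gives a bound that survives near `b`. -/
lemma RealConst.exists_lower_bound (hmn : m < n) {b : Fin (m * (n - m - 1)) → ℂ}
    (hb : RealConst m n b) : ∃ δ : ℝ, 0 < δ ∧ ∀ᶠ y in 𝓝 b, ∀ v : Fin n → ℝ,
      v (midIdx hmn) = 0 → δ * ‖v‖ ≤ ‖defect hmn y fun i => (v i : ℂ)‖ := by
  set S : Set (Fin n → ℝ) := Metric.sphere 0 1 ∩ {v | v (midIdx hmn) = 0} with hS
  have hSc : IsCompact S := (isCompact_sphere _ _).inter_right
    (isClosed_eq (continuous_apply _) continuous_const)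
  have hcast : Continuous fun v : Fin n → ℝ => fun i => (v i : ℂ) :=
    continuous_pi fun i => Complex.continuous_ofReal.comp (continuous_apply i)
  have hpos : ∀ v ∈ S, 0 < ‖defect hmn b fun i => (v i : ℂ)‖ := by
    rintro v ⟨hv1, hv2⟩
    rw [norm_pos_iff]
    intro h0
    obtain ⟨c, hc⟩ := hb v ((defect_eq_zero_iff hmn).1 h0)
    have hv0 : v = 0 := funext fun i => by rw [hc i, ← hc (midIdx hmn)]; exact hv2
    simp [hv0] at hv1
  obtain ⟨δ, hδ, hδS⟩ := hSc.exists_forall_le'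
    (continuous_defect hmn (continuous_const (y := b)) hcast).norm.continuousOn hpos
  refine ⟨δ / 2, by positivity, ?_⟩
  have hev : ∀ᶠ y in 𝓝 b, ∀ v ∈ S, δ / 2 < ‖defect hmn y fun i => (v i : ℂ)‖ := by
    refine hSc.eventually_forall_of_forall_eventually fun v hv => ?_
    have hc : Continuous fun p : (Fin (m * (n - m - 1)) → ℂ) × (Fin n → ℝ) =>
        ‖defect hmn p.1 fun i => (p.2 i : ℂ)‖ :=
      (continuous_defect hmn continuous_fst (hcast.comp continuous_snd)).norm
    refine continuousAt_const.eventually_lt hc.continuousAt ?_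
    have := hδS v hv
    simp only
    linarith
  filter_upwards [hev] with y hy v hv
  rcases eq_or_ne v 0 with rfl | hv0
  · simp
  have hvn : 0 < ‖v‖ := norm_pos_iff.2 hv0
  have h1 := hy (‖v‖⁻¹ • v) ⟨by simp [norm_smul, hvn.ne'], by simp [hv]⟩
  have h2 : (fun i => (((‖v‖⁻¹ • v) i : ℝ) : ℂ)) = ((‖v‖⁻¹ : ℝ) : ℂ) • fun i => (v i : ℂ) := by
    funext i; simp
  rw [h2, map_smul, norm_smul, Complex.norm_real, norm_inv, norm_norm, inv_mul_eq_div,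
    lt_div_iff₀ hvn] at h1
  exact h1.le

/-- The integer matrix with its row number `m + 1` subtracted from all the rows. -/
def reduced (hmn : m < n) (g : Matrix (Fin n) (Fin n) ℤ) : Matrix (Fin n) (Fin n) ℤ :=
  Matrix.of fun l i => g l i - g (midIdx hmn) i

lemma reduced_mulVec_mem_iff (hmn : m < n) (g : Matrix (Fin n) (Fin n) ℤ) (Λ : Config m n)
    (z : Fin n → ℂ) : (complexify (reduced hmn g)).mulVec z ∈ leafSpace Λ ↔
      (complexify g).mulVec z ∈ leafSpace Λ := by
  have h1 : (complexify g).mulVec z = (complexify (reduced hmn g)).mulVec z +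
      fun _ => (complexify g).mulVec z (midIdx hmn) := by
    funext l
    simp [complexify_mulVec_apply, reduced, sub_mul]
  rw [h1]
  exact (Submodule.add_mem_iff_left _ (const_mem_leafSpace _ fun _ => rfl)).symm

/-- For `i < k ≤ m`, the `i`-th column of `nf p.1` is `1` at `i` and `0` at the other indices up to
`midIdx`. As `h` carries it into the second leaf space, the defect of the `i`-th column of `h` is
minus a combination of defects of basis vectors, hence bounded near `(b, b')`. The reduced column is
real with zero entry at `midIdx`, so `exists_lower_bound` bounds it. -/
lemma eventually_abs_reduced_le (hmn : m < n) {k : ℕ} (hk : k ≤ m)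
    {b b' : Fin (m * (n - m - 1)) → ℂ} (hb' : RealConst m n b') :
    ∃ N : ℕ, ∀ᶠ p in 𝓝 (b, b'), ∀ h : Sym n, IsMonomial k h →
      (∀ z ∈ leafSpace (nf (n := n) p.1),
        (complexify h.mat).mulVec z ∈ leafSpace (nf (n := n) p.2)) →
      ∀ l i, |reduced hmn h.mat l i| ≤ N := by
  obtain ⟨δ, hδ, hlow⟩ := hb'.exists_lower_bound hmn
  let E : (Fin (m * (n - m - 1)) → ℂ) → ℝ := fun y => ∑ l : Fin n, ‖defect hmn y (Pi.single l 1)‖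
  let β : (Fin (m * (n - m - 1)) → ℂ) × (Fin (m * (n - m - 1)) → ℂ) → ℝ := fun p =>
    ∑ j : Fin m, ∑ i : Fin n, ‖nf p.1 i j‖ * E p.2
  have hβc : Continuous β := by
    refine continuous_finsetSum _ fun j _ => continuous_finsetSum _ fun i _ => ?_
    refine ((continuous_nf_apply i j).comp continuous_fst).norm.mul ?_
    exact continuous_finsetSum _ fun l _ =>
      (continuous_defect hmn continuous_snd continuous_const).norm
  -- The `1` serves the columns of index at least `k`, whose reduced entries are differences of
  -- zeros and ones.
  obtain ⟨N, hN⟩ := exists_nat_ge (max 1 ((β (b, b') + 1) / δ))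
  refine ⟨N, ?_⟩
  have hβ : ∀ᶠ p in 𝓝 (b, b'), β p < β (b, b') + 1 :=
    hβc.continuousAt.eventually_lt continuousAt_const (by linarith)
  have hlow' : ∀ᶠ p in 𝓝 (b, b'), ∀ v : Fin n → ℝ, v (midIdx hmn) = 0 →
      δ * ‖v‖ ≤ ‖defect hmn p.2 fun i => (v i : ℂ)‖ :=
    (continuous_snd.continuousAt (x := (b, b'))).eventually hlow
  filter_upwards [hβ, hlow'] with p hpβ hplow h H hmem l i
  have hE0 : 0 ≤ E p.2 := Finset.sum_nonneg fun _ _ => norm_nonneg _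
  rcases lt_or_ge (i : ℕ) k with hik | hik
  · obtain ⟨j, rfl⟩ : ∃ j, i = topIdx hmn j := ⟨⟨i, by omega⟩, rfl⟩
    set c : Fin n → Fin n → ℂ := fun i l => h.mat l i with hc
    have h1 : (complexify h.mat).mulVec (fun l => nf p.1 l j) = ∑ i, nf p.1 i j • c i := by
      funext l
      rw [complexify_mulVec_apply, Finset.sum_apply]
      exact Finset.sum_congr rfl fun i _ => mul_comm _ _
    have h2 : ∑ i, nf p.1 i j • defect hmn p.2 (c i) = 0 := by
      have := (defect_eq_zero_iff hmn).2 (hmem _ (nf_col_mem p.1 j))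
      rw [h1, map_sum] at this
      simpa using this
    rw [← Finset.add_sum_erase _ _ (Finset.mem_univ (topIdx hmn j)), nf_top, Pi.single_eq_same,
      one_smul, add_eq_zero_iff_eq_neg] at h2
    have hterm : ∀ i ∈ Finset.univ.erase (topIdx hmn j),
        ‖nf p.1 i j • defect hmn p.2 (c i)‖ ≤ ‖nf p.1 i j‖ * E p.2 := by
      intro i hi
      rw [norm_smul]
      induction i using index_cases hmn with
      | h1 j' =>
        have hne : j ≠ j' := fun h => (Finset.mem_erase.1 hi).1 (by rw [h])
        simp [nf_top, hne]
      | h2 => simp [nf_mid]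
      | h3 i =>
        refine mul_le_mul_of_nonneg_left ?_ (norm_nonneg _)
        have hci : c (botIdx i) = Pi.single (h.2 (botIdx i)) 1 := by
          funext l
          have hle : k ≤ (botIdx (m := m) i : Fin n) := by simp only [botIdx]; omega
          simp only [hc, H.col hle, Pi.single_apply]
          split_ifs <;> simp
        rw [hci]
        exact Finset.single_le_sum (f := fun l : Fin n => ‖defect hmn p.2 (Pi.single l 1)‖)
          (fun _ _ => norm_nonneg _) (Finset.mem_univ _)
    have h3 : ‖defect hmn p.2 (c (topIdx hmn j))‖ ≤ β p := by
      rw [h2, norm_neg]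
      refine (norm_sum_le _ _).trans ((Finset.sum_le_sum hterm).trans ?_)
      refine (Finset.sum_le_sum_of_subset_of_nonneg (Finset.erase_subset _ _)
        fun _ _ _ => mul_nonneg (norm_nonneg _) hE0).trans ?_
      exact Finset.single_le_sum (f := fun j : Fin m => ∑ i : Fin n, ‖nf p.1 i j‖ * E p.2)
        (fun _ _ => Finset.sum_nonneg fun _ _ => mul_nonneg (norm_nonneg _) hE0)
        (Finset.mem_univ j)
    set v : Fin n → ℝ := fun l => reduced hmn h.mat l (topIdx hmn j) with hv
    have h4 : (fun l => (v l : ℂ)) =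
        c (topIdx hmn j) - fun _ => c (topIdx hmn j) (midIdx hmn) := by
      funext l; simp [hv, hc, reduced]
    have h5 := hplow v (by simp [hv, reduced])
    rw [h4, map_sub, (defect_eq_zero_iff hmn).2 (const_mem_leafSpace _ fun _ => rfl),
      sub_zero] at h5
    have h6 : ‖v‖ ≤ (β (b, b') + 1) / δ := by
      rw [le_div_iff₀ hδ]
      linarith
    have h7 : |v l| ≤ N := (norm_le_pi_norm v l).trans (h6.trans ((le_max_right _ _).trans hN))
    have h8 : |((reduced hmn h.mat l (topIdx hmn j) : ℤ) : ℝ)| ≤ N := h7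
    exact_mod_cast h8
  · have hN1 : (1 : ℝ) ≤ N := (le_max_left _ _).trans hN
    have hN1' : (1 : ℤ) ≤ N := by exact_mod_cast hN1
    refine le_trans ?_ hN1'
    simp only [reduced, Matrix.of_apply, H.col hik]
    split_ifs <;> simp

lemma isClosed_mulVec_mem (hmn : m < n) (g : Matrix (Fin n) (Fin n) ℤ) :
    IsClosed {p : (Fin (m * (n - m - 1)) → ℂ) × (Fin (m * (n - m - 1)) → ℂ) |
      ∀ z ∈ leafSpace (nf (n := n) p.1),
        (complexify g).mulVec z ∈ leafSpace (nf (n := n) p.2)} := by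
  have : {p : (Fin (m * (n - m - 1)) → ℂ) × (Fin (m * (n - m - 1)) → ℂ) |
      ∀ z ∈ leafSpace (nf (n := n) p.1),
        (complexify g).mulVec z ∈ leafSpace (nf (n := n) p.2)} =
      ⋂ (c : ℂ) (T : Fin m → ℂ),
        {p | defect hmn p.2 ((complexify g).mulVec fun l => c + nf p.1 l ⬝ᵥ T) = 0} := by
    ext p
    simp only [Set.mem_ofPred_eq, Set.mem_iInter, defect_eq_zero_iff]
    constructor
    · exact fun h c T => h _ ⟨c, T, fun _ => rfl⟩
    · rintro h z ⟨c, T, hz⟩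
      rw [funext hz]
      exact h c T
  rw [this]
  refine isClosed_iInter fun c => isClosed_iInter fun T => isClosed_eq ?_ continuous_const
  refine continuous_defect hmn continuous_snd (continuous_pi fun l => ?_)
  simp only [complexify_mulVec_apply, dotProduct]
  refine continuous_finsetSum _ fun i _ => continuous_const.mul (continuous_const.add ?_)
  exact continuous_finsetSum _ fun j _ =>
    ((continuous_nf_apply i j).comp continuous_fst).mul continuous_const

/-- Reduction does not affect the inclusion, and only finitely many reduced matrices occur nearby.
Each inclusion is a closed condition, so those that fail at `(b, b')` fail around it. -/
lemma eventually_mulVec_mem (hmn : m < n) {k : ℕ} (hk : k ≤ m)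
    {b b' : Fin (m * (n - m - 1)) → ℂ} (hb' : RealConst m n b') :
    ∀ᶠ p in 𝓝 (b, b'), ∀ h : Sym n, IsMonomial k h →
      (∀ z ∈ leafSpace (nf (n := n) p.1),
        (complexify h.mat).mulVec z ∈ leafSpace (nf (n := n) p.2)) →
      ∀ z ∈ leafSpace (nf (n := n) b),
        (complexify h.mat).mulVec z ∈ leafSpace (nf (n := n) b') := by
  obtain ⟨N, hN⟩ := eventually_abs_reduced_le hmn hk (b := b) hb'
  set A : Set (Fin n → Fin n → ℤ) := Set.Icc (fun _ _ => -(N : ℤ)) (fun _ _ => N) with hA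
  have hfin : ∀ᶠ p in 𝓝 (b, b'), ∀ d ∈ A,
      (∀ z ∈ leafSpace (nf (n := n) p.1),
        (complexify (Matrix.of d)).mulVec z ∈ leafSpace (nf (n := n) p.2)) →
      ∀ z ∈ leafSpace (nf (n := n) b),
        (complexify (Matrix.of d)).mulVec z ∈ leafSpace (nf (n := n) b') := by
    refine (Filter.eventually_all_finite (Set.finite_Icc _ _)).2 fun d _ => ?_
    by_cases hd : ∀ z ∈ leafSpace (nf (n := n) b),
        (complexify (Matrix.of d)).mulVec z ∈ leafSpace (nf (n := n) b')
    · exact Filter.Eventually.of_forall fun _ _ => hd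
    · filter_upwards [(isClosed_mulVec_mem hmn (Matrix.of d)).isOpen_compl.mem_nhds
        (show (b, b') ∈ _ from hd)] with p hp h
      exact absurd h hp
  filter_upwards [hN, hfin] with p hp hpf h H hmem z hz
  rw [← reduced_mulVec_mem_iff hmn]
  refine hpf (reduced hmn h.mat) ?_ (fun z hz => (reduced_mulVec_mem_iff hmn _ _ _).2 (hmem z hz))
    z hz
  have := hp h H hmem
  exact ⟨fun l i => (abs_le.1 (this l i)).1, fun l i => (abs_le.1 (this l i)).2⟩

/-- This is the proper discontinuity behind both the Hausdorff property and the chart domains. The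
reverse inclusion is the previous lemma for `h⁻¹`, with the points exchanged. -/
lemma eventually_carries (hmn : m < n) {k : ℕ} (hk : k ≤ m)
    {b b' : Fin (m * (n - m - 1)) → ℂ} (hb : RealConst m n b) (hb' : RealConst m n b') :
    ∀ᶠ p in 𝓝 (b, b'), ∀ h : Sym n, IsMonomial k h → Carries m h p.1 p.2 → Carries m h b b' := by
  have h2 : ∀ᶠ p in 𝓝 (b, b'), ∀ h : Sym n, IsMonomial k h →
      (∀ z ∈ leafSpace (nf (n := n) p.2),
        (complexify h.mat).mulVec z ∈ leafSpace (nf (n := n) p.1)) →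
      ∀ z ∈ leafSpace (nf (n := n) b'),
        (complexify h.mat).mulVec z ∈ leafSpace (nf (n := n) b) :=
    (continuous_swap.continuousAt (x := (b, b'))).eventually (eventually_mulVec_mem hmn hk hb)
  filter_upwards [eventually_mulVec_mem hmn hk hb', h2] with p hp hp' h H hc z
  refine ⟨fun hz => ?_, hp h H (fun z => (hc z).2) z⟩
  rw [← Sym.complexify_inv_mulVec h z]
  exact hp' h⁻¹ H.inv (fun w => (hc.symm w).2) _ hz

/-! ### Effectiveness -/

lemma nf_add_single (x : Fin (m * (n - m - 1)) → ℂ) (t : ℂ) (j : Fin m) (i : Fin (n - m - 1))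
    (l : Fin n) (j' : Fin m) : nf (x + t • Pi.single (finProdFinEquiv (j, i)) 1) l j' =
      nf x l j' + if l = botIdx i ∧ j' = j then t else 0 := by
  have hmn : m < n := by have := i.2; omega
  induction l using index_cases hmn with
  | h1 a =>
    have : topIdx hmn a ≠ botIdx (m := m) i := fun h => by
      have := congrArg Fin.val h
      simp only [topIdx, botIdx] at this
      omega
    simp [nf_top, this]
  | h2 =>
    have : midIdx hmn ≠ botIdx (m := m) i := fun h => by
      have := congrArg Fin.val h
      simp only [midIdx, botIdx] at this
      omega
    simp [nf_mid, this]
  | h3 a =>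
    have hb : (botIdx (m := m) a : Fin n) = botIdx i ↔ a = i := by
      simp [botIdx, Fin.ext_iff]
    rw [nf_bot, nf_bot]
    simp only [hb, Pi.add_apply, Pi.smul_apply, Pi.single_apply, smul_eq_mul,
      EmbeddingLike.apply_eq_iff_eq, Prod.mk.injEq, and_comm, mul_ite, mul_one, mul_zero]

lemma defect_add_single (hmn : m < n) (x : Fin (m * (n - m - 1)) → ℂ) (t : ℂ) (j : Fin m)
    (i : Fin (n - m - 1)) (z : Fin n → ℂ) (l : Fin n) :
    defect hmn (x + t • Pi.single (finProdFinEquiv (j, i)) 1) z l = defect hmn x z l -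
      if l = botIdx i then t * (z (topIdx hmn j) - z (midIdx hmn)) else 0 := by
  simp only [defect_apply, dotProduct, nf_add_single, add_mul, Finset.sum_add_distrib]
  split_ifs with h
  · simp [h]
    ring
  · simp [h]

/-- Perturbing one coordinate of `x` at a time shows that `h` fixes the basis vectors of the last
indices and moves the columns of `nf x` by constants. Together with the constant vector these span
`ℂ^n`. -/
lemma isScalarTrivial_of_carries_self (hm : 0 < m) (hmn : m + 1 < n) {k : ℕ} (hk : k ≤ m)
    {h : Sym n} (H : IsMonomial k h) {D : Set (Fin (m * (n - m - 1)) → ℂ)} (hD : IsOpen D)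
    (hne : D.Nonempty) (hc : ∀ x ∈ D, Carries m h x x) : IsScalarTrivial h.mat := by
  have hmn' : m < n := by omega
  obtain ⟨x, hx⟩ := hne
  have hpert : ∀ e, ∃ t : ℂ, t ≠ 0 ∧ x + t • Pi.single e 1 ∈ D ∧ x + (-t) • Pi.single e 1 ∈ D := by
    intro e
    have h1 : ∀ᶠ t : ℂ in 𝓝 0, x + t • Pi.single e 1 ∈ D := by
      have : Continuous fun t : ℂ => x + t • (Pi.single e 1 : Fin (m * (n - m - 1)) → ℂ) := by
        fun_prop
      exact this.continuousAt.eventually (hD.mem_nhds (by simpa using hx))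
    have h2 : ∀ᶠ t : ℂ in 𝓝 0, x + (-t) • Pi.single e 1 ∈ D := by
      have : Filter.Tendsto (fun t : ℂ => -t) (𝓝 0) (𝓝 0) := by
        simpa using (continuous_neg (G := ℂ)).tendsto 0
      exact this.eventually h1
    obtain ⟨t, ⟨ht1, ht2⟩, ht0⟩ := (((h1.and h2).filter_mono nhdsWithin_le_nhds).and
      (self_mem_nhdsWithin (a := (0 : ℂ)) (s := {0}ᶜ))).exists
    exact ⟨t, ht0, ht1, ht2⟩
  set u : Fin m → Fin n → ℂ := fun j => (complexify h.mat).mulVec fun l => nf x l j with hu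
  have hu0 : ∀ j, defect hmn' x (u j) = 0 := fun j =>
    (defect_eq_zero_iff hmn').2 ((hc x hx _).2 (nf_col_mem x j))
  have hbk : ∀ i : Fin (n - m - 1), k ≤ (botIdx (m := m) i : Fin n) := fun i => by
    simp only [botIdx]; omega
  have hbot : ∀ i : Fin (n - m - 1), (complexify h.mat).mulVec (Pi.single (botIdx (m := m) i) 1) =
      Pi.single (h.2 (botIdx (m := m) i)) 1 := by
    intro i
    funext l
    rw [Matrix.mulVec_single_one, Matrix.col_apply, complexify_apply, H.col (hbk i),
      Pi.single_apply]
    split_ifs <;> simp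
  have key : ∀ i j, h.2 (botIdx (m := m) i) = botIdx i ∧
      u j (topIdx hmn' j) - u j (midIdx hmn') = 1 := by
    intro i j
    set s := h.2 (botIdx (m := m) i) with hs
    set es : Fin n → ℂ := Pi.single s 1 with hes
    -- The invariance at the perturbed point minus the invariance at `x`, divided by `t`.
    have hstar : ∀ j (t : ℂ), t ≠ 0 → x + t • Pi.single (finProdFinEquiv (j, i)) 1 ∈ D → ∀ l,
        defect hmn' x es l = if l = botIdx i then
          (u j (topIdx hmn' j) - u j (midIdx hmn')) +
            t * (es (topIdx hmn' j) - es (midIdx hmn')) else 0 := by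
      intro j t ht0 ht l
      have h1 := (hc _ ht _).2 (nf_col_mem _ j)
      have h2 : (fun l => nf (x + t • Pi.single (finProdFinEquiv (j, i)) 1) l j) =
          (fun l => nf x l j) + t • Pi.single (botIdx (m := m) i) 1 := by
        funext l
        rw [nf_add_single]
        simp [Pi.single_apply]
      rw [h2, Matrix.mulVec_add, Matrix.mulVec_smul, hbot, ← defect_eq_zero_iff hmn'] at h1
      have h3 := congrFun h1 l
      rw [defect_add_single, map_add, map_smul] at h3
      have h4 := congrFun (hu0 j) l
      simp only [Pi.add_apply, Pi.smul_apply, smul_eq_mul, Pi.zero_apply] at h3 h4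
      rw [h4, zero_add, sub_eq_zero] at h3
      split_ifs at h3 ⊢ with hl
      · have h5 := mul_left_cancel₀ ht0 h3
        rw [h5]
        ring
      · exact (mul_eq_zero.1 h3).resolve_left ht0
    -- Comparing `t` with `-t` isolates the second-order term. The vector `e_s` then has equal
    -- entries at the first `m + 1 ≥ 2` indices, so `s` is not among them.
    have hconst : ∀ j, es (topIdx hmn' j) = es (midIdx hmn') := by
      intro j
      obtain ⟨t, ht0, ht1, ht2⟩ := hpert (finProdFinEquiv (j, i))
      have h1 := hstar j t ht0 ht1 (botIdx i)
      have h2 := hstar j (-t) (neg_ne_zero.2 ht0) ht2 (botIdx i)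
      rw [h1, if_pos rfl, if_pos rfl] at h2
      have h3 : 2 * t * (es (topIdx hmn' j) - es (midIdx hmn')) = 0 := by linear_combination h2
      have h4 := (mul_eq_zero.1 h3).resolve_left (mul_ne_zero two_ne_zero ht0)
      exact sub_eq_zero.1 h4
    have htm : ∀ j, topIdx hmn' j ≠ midIdx hmn' := fun j h => by
      have := congrArg Fin.val h
      simp only [topIdx, midIdx] at this
      omega
    have hmid0 : es (midIdx hmn') = 0 := by
      by_contra h0
      have h1 : s = midIdx hmn' := by
        by_contra hne
        exact h0 (by simp [hes, Ne.symm hne])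
      have h2 := hconst ⟨0, hm⟩
      rw [hes, h1] at h2
      simp [htm] at h2
    obtain ⟨t, ht0, ht1, -⟩ := hpert (finProdFinEquiv (j, i))
    have h1 := hstar j t ht0 ht1 s
    have h2 : defect hmn' x es s = 1 := by
      have hss : es s = 1 := by simp [hes]
      rw [defect_apply]
      simp [hconst, hmid0, hss, dotProduct]
    rw [h2, hconst j, sub_self, mul_zero, add_zero] at h1
    split_ifs at h1 with hsb
    · exact ⟨hsb, h1.symm⟩
    · exact absurd h1 one_ne_zero
  -- Perturbing column `j'` leaves column `j` unchanged, so only the equations of the target leaf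
  -- space vary.
  have hoff : ∀ j j' : Fin m, j' ≠ j → u j (topIdx hmn' j') - u j (midIdx hmn') = 0 := by
    intro j j' hj
    have i : Fin (n - m - 1) := ⟨0, by omega⟩
    obtain ⟨t, ht0, ht, -⟩ := hpert (finProdFinEquiv (j', i))
    have h1 := (hc _ ht _).2 (nf_col_mem _ j)
    have h2 : (fun l => nf (x + t • Pi.single (finProdFinEquiv (j', i)) 1) l j) =
        (fun l : Fin n => nf x l j) := by
      funext l
      rw [nf_add_single]
      simp [hj.symm]
    rw [h2, ← defect_eq_zero_iff hmn'] at h1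
    have h3 := congrFun h1 (botIdx i)
    have h4 : (defect hmn' (x + t • Pi.single (finProdFinEquiv (j', i)) 1)) (u j) (botIdx i) = 0 :=
      h3
    rw [defect_add_single, hu0, if_pos rfl, Pi.zero_apply, zero_sub, neg_eq_zero] at h4
    exact (mul_eq_zero.1 h4).resolve_left ht0
  have hui : ∀ j l, u j l = nf x l j + u j (midIdx hmn') := by
    intro j l
    have h1 : u j - (fun l => nf x l j) - (fun _ => u j (midIdx hmn')) ∈ leafSpace (nf (n := n) x) :=
      sub_mem (sub_mem ((defect_eq_zero_iff hmn').1 (hu0 j)) (nf_col_mem x j))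
        (const_mem_leafSpace _ fun _ => rfl)
    have h2 := eq_zero_of_mem_leafSpace_nf hmn' h1 (fun j' => by
      simp only [Pi.sub_apply, nf_top]
      rcases eq_or_ne j' j with rfl | hj
      · have := (key ⟨0, by omega⟩ j').2
        rw [Pi.single_eq_same]
        linear_combination this
      · have := hoff j j' hj
        rw [Pi.single_eq_of_ne (Ne.symm hj)]
        linear_combination this) (by simp [nf_mid])
    have h3 := congrFun h2 l
    simp only [Pi.sub_apply, Pi.zero_apply] at h3
    linear_combination h3
  intro z
  set r : Fin n → ℂ := fun l => z l - (z (midIdx hmn') +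
    nf x l ⬝ᵥ fun j => z (topIdx hmn' j) - z (midIdx hmn')) with hr
  have hrtop : ∀ j, r (topIdx hmn' j) = 0 := fun j => by
    simp [hr, nf_top]
  have hrmid : r (midIdx hmn') = 0 := by simp [hr, nf_mid]
  have hgr : (complexify h.mat).mulVec r = r := by
    have h1 : ∀ i, r i ≠ 0 → ∀ l, (h.mat l i : ℂ) = if l = i then 1 else 0 := by
      intro i hi l
      induction i using index_cases hmn' with
      | h1 j => exact absurd (hrtop j) hi
      | h2 => exact absurd hrmid hi
      | h3 i =>
        rw [H.col (hbk i), (key i ⟨0, hm⟩).1]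
        split_ifs <;> simp
    funext l
    rw [complexify_mulVec_apply, Finset.sum_eq_single l]
    · by_cases hl : r l = 0
      · simp [hl]
      · simp [h1 l hl]
    · intro i _ hi
      by_cases hl : r i = 0
      · simp [hl]
      · simp [h1 i hl, hi.symm]
    · simp
  have hz : z = r + ((fun _ => z (midIdx hmn')) +
      ∑ j, (z (topIdx hmn' j) - z (midIdx hmn')) • fun l => nf x l j) := by
    funext l
    simp [hr, dotProduct, mul_comm]
  have hgz : (complexify h.mat).mulVec z = r + ((fun _ => z (midIdx hmn')) +
      ∑ j, (z (topIdx hmn' j) - z (midIdx hmn')) • u j) := by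
    conv_lhs => rw [hz]
    rw [Matrix.mulVec_add, Matrix.mulVec_add, hgr, H.complexify_mulVec_const, Matrix.mulVec_sum]
    simp only [Matrix.mulVec_smul, hu]
  refine ⟨∑ j, (z (topIdx hmn' j) - z (midIdx hmn')) * u j (midIdx hmn'), fun l => ?_⟩
  have hzl := congrFun hz l
  rw [hgz]
  simp only [Pi.add_apply, Finset.sum_apply, Pi.smul_apply, smul_eq_mul] at hzl ⊢
  have h1 : ∑ j, (z (topIdx hmn' j) - z (midIdx hmn')) * u j l =
      ∑ j, (z (topIdx hmn' j) - z (midIdx hmn')) * nf x l j +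
        ∑ j, (z (topIdx hmn' j) - z (midIdx hmn')) * u j (midIdx hmn') := by
    rw [← Finset.sum_add_distrib]
    refine Finset.sum_congr rfl fun j _ => ?_
    rw [← mul_add]
    exact congrArg _ (hui j l)
  rw [h1]
  linear_combination (-1 : ℂ) * hzl

/-! ### The configurations parametrizing the moduli space -/

lemma exists_perm_supp_iff {Λ Λ' : Config m n} (h : Λ' ∈ moduliConfig Λ) :
    ∃ σ : Equiv.Perm (Fin n), ∀ I, I ∈ Supp Λ' ↔ σ ⁻¹' I ∈ Supp Λ := by
  classical
  obtain ⟨-, -, σ, hσ⟩ := h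
  refine ⟨σ, fun I => ?_⟩
  have h1 := hσ fun i => if i ∈ I then 1 else 0
  rw [mem_siegel_iff, mem_siegel_iff] at h1
  have e1 : {i | (if i ∈ I then (1 : ℂ) else 0) ≠ 0} = I := by ext i; simp
  have e2 : {i | ((fun i => if i ∈ I then (1 : ℂ) else 0) ∘ σ) i ≠ 0} = σ ⁻¹' I := by
    ext i; simp
  rwa [e1, e2] at h1

/-- The permutation of coordinates matches indispensable points, so `k` is the same for the whole
family. -/
lemma std_of_mem_moduliConfig {Λ Λ' : Config m n} (hΛ : Admissible Λ) (h : Λ' ∈ moduliConfig Λ) :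
    Std (numIndispensable Λ) Λ' := by
  obtain ⟨σ, hσ⟩ := exists_perm_supp_iff h
  have hi : ∀ i, Indispensable Λ' i ↔ Indispensable Λ (σ.symm i) := by
    intro i
    rw [h.1.indispensable_iff, hΛ.indispensable_iff, hσ, not_iff_not]
    have : σ ⁻¹' {i}ᶜ = {σ.symm i}ᶜ := by
      ext j; simp [Equiv.eq_symm_apply]
    rw [this]
  have hnum : numIndispensable Λ' = numIndispensable Λ := by
    have : {i | Indispensable Λ' i} = σ '' {i | Indispensable Λ i} := by
      ext i; rw [Equiv.image_eq_preimage_symm]; exact hi i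
    rw [numIndispensable, this, Set.ncard_image_of_injective _ σ.injective, numIndispensable]
  exact ⟨h.1, fun i => by rw [← hnum]; exact h.2.1.2 i⟩

lemma frame_det_ne_zero_of_mem_moduliConfig (hmn : m < n) {Λ Λ' : Config m n}
    (h : Λ' ∈ moduliConfig Λ) : (frame hmn Λ').det ≠ 0 :=
  (affineIndependent_iff_frame hmn Λ').1 h.2.1.1

lemma admissible_congr {Λ Λ' : Config m n} (h : Supp Λ' = Supp Λ) :
    Admissible Λ' ↔ Admissible Λ := by
  rw [admissible_iff, admissible_iff, h]

lemma mem_moduliConfig_of_supp_eq (hmn : m < n) {Λ a b : Config m n} (ha : a ∈ moduliConfig Λ)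
    (h : Supp b = Supp a) (hb : (frame hmn b).det ≠ 0) : b ∈ moduliConfig Λ := by
  have hb' : Admissible b := (admissible_congr h).2 ha.1
  have hi : ∀ i, Indispensable b i ↔ Indispensable a i := fun i => by
    rw [hb'.indispensable_iff, ha.1.indispensable_iff, h]
  have hnum : numIndispensable b = numIndispensable a := by
    simp only [numIndispensable, hi]
  refine ⟨hb', ⟨(affineIndependent_iff_frame hmn b).2 hb, fun i => ?_⟩, ?_⟩
  · rw [hi, hnum]
    exact ha.2.1.2 i
  · obtain ⟨σ, hσ⟩ := ha.2.2
    refine ⟨σ, fun z => ?_⟩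
    rw [← hσ, mem_siegel_iff, mem_siegel_iff, h]

lemma Admissible.realConst_coord (hmn : m < n) (hn : 2 * m < n) {a : Config m n}
    (ha : Admissible a) (hdet : (frame hmn a).det ≠ 0) : RealConst m n (coord hmn a) := by
  intro v hv
  rw [← leafSpace_eq_nf hmn hdet] at hv
  obtain ⟨c, hc⟩ := ha.const_of_im_eq_zero hn (admissible_iff.1 ha).1 hv fun i _ =>
    Complex.ofReal_im _
  refine ⟨c.re, fun i => ?_⟩
  rw [← hc i, Complex.ofReal_re]

lemma rel_iff_carries (hmn : m < n) {k : ℕ} {h : Sym n} {a b : Config m n}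
    (ha : (frame hmn a).det ≠ 0) (hb : (frame hmn b).det ≠ 0) :
    Rel k h a b ↔ IsMonomial k h ∧ Carries m h (coord hmn a) (coord hmn b) ∧
      ∀ I, h.2 '' I ∈ Supp b ↔ I ∈ Supp a := by
  rw [Carries, ← leafSpace_eq_nf hmn ha, ← leafSpace_eq_nf hmn hb]
  exact ⟨fun H => ⟨H.1, H.2, H.3⟩, fun H => ⟨H.1, H.2.1, H.2.2⟩⟩

/-- `Rel` depends on configurations only through their coordinates and their `Supp`. -/
lemma Rel.congr_supp (hmn : m < n) {k : ℕ} {h : Sym n} {a b a' b' : Config m n}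
    (H : Rel k h a b) (ha : (frame hmn a).det ≠ 0) (hb : (frame hmn b).det ≠ 0)
    (ha' : (frame hmn a').det ≠ 0) (hb' : (frame hmn b').det ≠ 0)
    (hsa : Supp a' = Supp a) (hsb : Supp b' = Supp b)
    (hc : Carries m h (coord hmn a') (coord hmn b')) : Rel k h a' b' := by
  rw [rel_iff_carries hmn ha hb] at H
  rw [rel_iff_carries hmn ha' hb', hsa, hsb]
  exact ⟨H.1, hc, H.2.2⟩

/-- The configuration `a'` is built in the frame of `a` from the coordinates of `b'` moved back by
`h⁻¹`. This makes the projection to the moduli space open. -/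
lemma Rel.eventually_exists (hmn : m < n) (hn : 2 * m < n) {k : ℕ} {h : Sym n} {a b : Config m n}
    (H : Rel k h a b) (ha : Admissible a) (hb : Admissible b) (hda : (frame hmn a).det ≠ 0)
    (hdb : (frame hmn b).det ≠ 0) {U : Set (Config m n)} (hU : U ∈ 𝓝 a) :
    ∀ᶠ b' in 𝓝 b, ∃ a' ∈ U, Supp a' = Supp a ∧ (frame hmn a').det ≠ 0 ∧ Rel k h a' b' := by
  have hc := ((rel_iff_carries hmn hda hdb).1 H).2.1
  obtain ⟨hmov, hmove⟩ := (Carries.iff_move hmn H.isMonomial.inv).1 hc.symm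
  have hcb : ContinuousAt (coord hmn) b := (differentiableAt_coord hmn hdb).continuousAt
  have hmc : ContinuousAt (fun b' => move hmn h⁻¹ (coord hmn b')) b :=
    ContinuousAt.comp (g := move hmn h⁻¹) (differentiableAt_move hmn hmov).continuousAt hcb
  have hcont : ContinuousAt (fun b' => withFrame hmn a (move hmn h⁻¹ (coord hmn b'))) b :=
    ContinuousAt.comp (differentiable_withFrame hmn a).continuous.continuousAt hmc
  have hval : withFrame hmn a (move hmn h⁻¹ (coord hmn b)) = a := by
    rw [hmove, withFrame_coord hmn hda]
  have hev : ∀ᶠ a' in 𝓝 (withFrame hmn a (move hmn h⁻¹ (coord hmn b))),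
      a' ∈ U ∧ Supp a' = Supp a := by
    rw [hval]
    exact Filter.Eventually.and hU (ha.eventually_supp_eq hn)
  filter_upwards [hcont.eventually hev, hb.eventually_supp_eq hn,
    eventually_frame_det_ne_zero hmn hdb, hcb.eventually (eventually_movable hmn hmov)]
    with b' h1 h2 h3 h4
  refine ⟨_, h1.1, h1.2, by rwa [frame_withFrame], ?_⟩
  refine H.congr_supp hmn hda hdb (by rwa [frame_withFrame]) h3 h1.2 h2 ?_
  rw [coord_withFrame hmn hda]
  have := ((Carries.iff_move hmn H.isMonomial.inv).2 ⟨h4, rfl⟩).symm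
  rwa [inv_inv] at this

/-! ### The topology of the moduli space -/

section Moduli

variable {Λ : Config m n}

lemma Moduli.mk_eq_iff (hm : 0 < m) (hn : 2 * m < n) (hΛ : Admissible Λ)
    (a b : moduliConfig Λ) :
    Moduli.mk Λ a = Moduli.mk Λ b ↔ ∃ h : Sym n, Rel (numIndispensable Λ) h a.1 b.1 :=
  Quotient.eq.trans (gBiholomorphic_iff hm hn (std_of_mem_moduliConfig hΛ a.2)
    (std_of_mem_moduliConfig hΛ b.2))

lemma Moduli.continuous_mk : Continuous (Moduli.mk Λ) := continuous_quotient_mk'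

lemma Moduli.isOpenMap_mk (hm : 0 < m) (hn : 2 * m < n) (hΛ : Admissible Λ) :
    IsOpenMap (Moduli.mk Λ) := by
  have hmn : m < n := by omega
  intro U hU
  refine isOpen_coinduced.2 (isOpen_iff_mem_nhds.2 fun b hb => ?_)
  obtain ⟨a, haU, hab⟩ := hb
  obtain ⟨h, H⟩ := (Moduli.mk_eq_iff hm hn hΛ a b).1 hab
  obtain ⟨V, hV, rfl⟩ := isOpen_induced_iff.1 hU
  have hev := H.eventually_exists hmn hn a.2.1 b.2.1
    (frame_det_ne_zero_of_mem_moduliConfig hmn a.2)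
    (frame_det_ne_zero_of_mem_moduliConfig hmn b.2) (hV.mem_nhds haU)
  filter_upwards [continuous_subtype_val.continuousAt.eventually hev] with b' hb'
  obtain ⟨a', ha'V, hs, hd, H'⟩ := hb'
  refine ⟨⟨a', mem_moduliConfig_of_supp_eq hmn a.2 hs hd⟩, ha'V, ?_⟩
  exact (Moduli.mk_eq_iff hm hn hΛ _ b').2 ⟨h, H'⟩

/-- For an open quotient map it suffices that the relation be closed, which follows from
`eventually_carries` and the local constancy of `Supp`. -/
lemma Moduli.t2Space (hm : 0 < m) (hn : 2 * m < n) (hΛ : Admissible Λ)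
    (hk : numIndispensable Λ ≤ m) : T2Space (Moduli Λ) := by
  have hmn : m < n := by omega
  have hq : IsOpenQuotientMap (Moduli.mk Λ) :=
    ⟨Quotient.mk_surjective, Moduli.continuous_mk, Moduli.isOpenMap_mk hm hn hΛ⟩
  rw [t2Space_iff_of_isOpenQuotientMap hq, ← isOpen_compl_iff, isOpen_iff_mem_nhds]
  rintro ⟨a, b⟩ hab
  have hda := frame_det_ne_zero_of_mem_moduliConfig hmn a.2
  have hdb := frame_det_ne_zero_of_mem_moduliConfig hmn b.2
  have hc1 : ContinuousAt (fun p : moduliConfig Λ × moduliConfig Λ => coord hmn p.1.1) (a, b) :=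
    ContinuousAt.comp (g := coord hmn) (f := fun p : moduliConfig Λ × moduliConfig Λ => p.1.1)
      (x := (a, b)) (differentiableAt_coord hmn hda).continuousAt
      (continuous_subtype_val.comp continuous_fst).continuousAt
  have hc2 : ContinuousAt (fun p : moduliConfig Λ × moduliConfig Λ => coord hmn p.2.1) (a, b) :=
    ContinuousAt.comp (g := coord hmn) (f := fun p : moduliConfig Λ × moduliConfig Λ => p.2.1)
      (x := (a, b)) (differentiableAt_coord hmn hdb).continuousAt
      (continuous_subtype_val.comp continuous_snd).continuousAt
  have h1 := (hc1.prodMk hc2).eventually (eventually_carries hmn hk (a.2.1.realConst_coord hmn hn hda)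
    (b.2.1.realConst_coord hmn hn hdb))
  have h2 := ((continuous_subtype_val.comp continuous_fst).continuousAt
    (x := ((a, b) : moduliConfig Λ × moduliConfig Λ))).eventually (a.2.1.eventually_supp_eq hn)
  have h3 := ((continuous_subtype_val.comp continuous_snd).continuousAt
    (x := ((a, b) : moduliConfig Λ × moduliConfig Λ))).eventually (b.2.1.eventually_supp_eq hn)
  filter_upwards [h1, h2, h3] with p hp1 hp2 hp3 hp
  obtain ⟨h, H⟩ := (Moduli.mk_eq_iff hm hn hΛ p.1 p.2).1 hp
  have hd1 := frame_det_ne_zero_of_mem_moduliConfig hmn p.1.2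
  have hd2 := frame_det_ne_zero_of_mem_moduliConfig hmn p.2.2
  refine hab ((Moduli.mk_eq_iff hm hn hΛ a b).2 ⟨h, ?_⟩)
  exact H.congr_supp hmn hd1 hd2 hda hdb hp2.symm hp3.symm
    (hp1 h H.isMonomial ((rel_iff_carries hmn hd1 hd2).1 H).2.1)

lemma Moduli.secondCountableTopology (hm : 0 < m) (hn : 2 * m < n) (hΛ : Admissible Λ) :
    SecondCountableTopology (Moduli Λ) :=
  TopologicalSpace.Quotient.secondCountableTopology (Moduli.isOpenMap_mk hm hn hΛ)

end Moduli

/-! ### Charts -/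

lemma IsScalarTrivial.carries_self {h : Sym n} (H : IsScalarTrivial h.mat)
    (x : Fin (m * (n - m - 1)) → ℂ) : Carries m h x x := by
  intro z
  obtain ⟨c, hc⟩ := H z
  have : (complexify h.mat).mulVec z = z + fun _ => c := funext hc
  rw [this]
  exact Submodule.add_mem_iff_left _ (const_mem_leafSpace _ fun _ => rfl)

/-- Connected open sets of coordinates, near those of `a`, on which the symmetries of `a` act, and
which no other symmetry relates to themselves. -/
structure IsChartDomain (hmn : m < n) (k : ℕ) (a : Config m n)
    (D : Set (Fin (m * (n - m - 1)) → ℂ)) : Prop where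
  isOpen : IsOpen D
  isConnected : IsConnected D
  coord_mem : coord hmn a ∈ D
  supp_eq : ∀ x ∈ D, Supp (withFrame hmn a x) = Supp a
  move_mem : ∀ h ∈ relGroup k a, ∀ x ∈ D, Movable hmn h x ∧ move hmn h x ∈ D
  symm_mem : ∀ x ∈ D, ∀ y ∈ D, ∀ h, Rel k h (withFrame hmn a x) (withFrame hmn a y) →
    h ∈ relGroup k a

/-- The group `relGroup k a` may be infinite, but elements with the same image in the finite
isotropy group act equally on coordinates. Finitely many representatives suffice. -/
lemma eventually_forall_move_mem (hm : 0 < m) (hn : 2 * m < n) (hmn : m < n) {k : ℕ}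
    {a : Config m n} (S : Std k a) (hk : k ≤ m) (hd : (frame hmn a).det ≠ 0)
    {U : Set (Fin (m * (n - m - 1)) → ℂ)} (hU : U ∈ 𝓝 (coord hmn a)) :
    ∀ᶠ x in 𝓝 (coord hmn a), ∀ h ∈ relGroup k a, Movable hmn h x ∧ move hmn h x ∈ U := by
  have hfin : Finite (isotropy a) := (isotropy_finite_embedding hm hn S (by omega)
    ((affineIndependent_iff_frame hmn a).2 hd)).1
  choose r hr using relGroupHom_surjective hm hn S
  have h1 : ∀ᶠ x in 𝓝 (coord hmn a), ∀ ψ : isotropy a,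
      Movable hmn (r ψ).1 x ∧ move hmn (r ψ).1 x ∈ U := by
    refine Filter.eventually_all.2 fun ψ => ?_
    have hR := (rel_iff_carries hmn hd hd).1 (mem_relGroup.1 (r ψ).2)
    obtain ⟨h2, h3⟩ := (Carries.iff_move hmn hR.1).1 hR.2.1
    refine (eventually_movable hmn h2).and
      ((differentiableAt_move hmn h2).continuousAt.eventually ?_)
    rw [h3]
    exact hU
  filter_upwards [h1] with x hx h hh
  set ψ := relGroupHom S ⟨h, hh⟩ with hψ
  have ht : relGroupHom S ((r ψ)⁻¹ * ⟨h, hh⟩) = 1 := by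
    rw [map_mul, map_inv, hr, ← hψ, inv_mul_cancel]
  have hs := ((relGroupHom_eq_one_iff hn S _).1 ht).carries_self x
  have hc := hs.trans ((Carries.iff_move hmn (mem_relGroup.1 (r ψ).2).isMonomial).2 ⟨(hx ψ).1, rfl⟩)
  have he : (r ψ).1 * ((r ψ)⁻¹ * (⟨h, hh⟩ : relGroup k a)).1 = h := by simp
  rw [he] at hc
  obtain ⟨h4, h5⟩ := (Carries.iff_move hmn (mem_relGroup.1 hh).isMonomial).1 hc
  exact ⟨h4, h5 ▸ (hx ψ).2⟩

lemma exists_isChartDomain (hm : 0 < m) (hn : 2 * m < n) (hmn : m < n) {k : ℕ}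
    {a : Config m n} (S : Std k a) (hk : k ≤ m) (hd : (frame hmn a).det ≠ 0) :
    ∃ D, IsChartDomain hmn k a D := by
  set b := coord hmn a with hb
  have hRC : RealConst m n b := S.admissible.realConst_coord hmn hn hd
  obtain ⟨V, hV, V', hV', hVV⟩ := Filter.mem_prod_iff.1
    (nhds_prod_eq (x := b) (y := b) ▸ eventually_carries hmn hk hRC hRC)
  have hsupp : ∀ᶠ x in 𝓝 b, Supp (withFrame hmn a x) = Supp a := by
    refine (differentiable_withFrame hmn a).continuous.continuousAt.eventually
      (p := fun c => Supp c = Supp a) ?_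
    rw [hb, withFrame_coord hmn hd]
    exact S.admissible.eventually_supp_eq hn
  have hself : ∀ h ∈ relGroup k a, Movable hmn h b ∧ move hmn h b = b := fun h hh => by
    have hR := (rel_iff_carries hmn hd hd).1 (mem_relGroup.1 hh)
    exact (Carries.iff_move hmn hR.1).1 hR.2.1
  have hU₀ : V ∩ V' ∩ {x | Supp (withFrame hmn a x) = Supp a} ∈ 𝓝 b :=
    Filter.inter_mem (Filter.inter_mem hV hV') hsupp
  obtain ⟨ε, hε, hball⟩ := Metric.eventually_nhds_iff_ball.1
    (eventually_forall_move_mem hm hn hmn S hk hd hU₀)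
  have hbb : b ∈ Metric.ball b ε := Metric.mem_ball_self hε
  -- The union of the translates of a small ball by the symmetries of `a` is invariant. It is
  -- connected because each translate is connected and contains the fixed point `b`.
  set D : Set (Fin (m * (n - m - 1)) → ℂ) :=
    {y | ∃ h ∈ relGroup k a, ∃ x ∈ Metric.ball b ε, move hmn h x = y} with hD
  have hDU : D ⊆ V ∩ V' ∩ {x | Supp (withFrame hmn a x) = Supp a} := by
    rintro y ⟨h, hh, x, hx, rfl⟩
    exact (hball x hx h hh).2
  have hbD : b ∈ D := ⟨1, one_mem _, b, hbb, (hself 1 (one_mem _)).2⟩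
  refine ⟨D, ⟨?_, ⟨⟨b, hbD⟩, ?_⟩, hbD, fun x hx => (hDU hx).2, ?_, ?_⟩⟩
  · refine isOpen_iff_mem_nhds.2 ?_
    rintro y ⟨h, hh, x, hx, hxy⟩
    have hM := (mem_relGroup.1 hh).isMonomial
    have hc := (Carries.iff_move hmn hM).2 ⟨(hball x hx h hh).1, hxy⟩
    obtain ⟨h1, h2⟩ := (Carries.iff_move hmn hM.inv).1 hc.symm
    have h3 : ∀ᶠ y' in 𝓝 y, move hmn h⁻¹ y' ∈ Metric.ball b ε := by
      refine (differentiableAt_move hmn h1).continuousAt.eventually ?_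
      rw [h2]
      exact Metric.isOpen_ball.mem_nhds hx
    filter_upwards [eventually_movable hmn h1, h3] with y' h4 h5
    have hc' := ((Carries.iff_move hmn hM.inv).2 ⟨h4, rfl⟩).symm
    rw [inv_inv] at hc'
    exact ⟨h, hh, _, h5, ((Carries.iff_move hmn hM).1 hc').2⟩
  · refine isPreconnected_of_forall b ?_
    rintro y ⟨h, hh, x, hx, hxy⟩
    refine ⟨move hmn h '' Metric.ball b ε, ?_, ⟨b, hbb, (hself h hh).2⟩, ⟨x, hx, hxy⟩, ?_⟩
    · rintro _ ⟨x', hx', rfl⟩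
      exact ⟨h, hh, x', hx', rfl⟩
    · exact (convex_ball b ε).isPreconnected.image _ fun x' hx' =>
        (differentiableAt_move hmn (hball x' hx' h hh).1).continuousAt.continuousWithinAt
  · rintro h' hh' y ⟨h, hh, x, hx, hxy⟩
    have hM := (mem_relGroup.1 hh).isMonomial
    have hM' := (mem_relGroup.1 hh').isMonomial
    have hc := (Carries.iff_move hmn hM).2 ⟨(hball x hx h hh).1, hxy⟩
    have hc' := (Carries.iff_move hmn (hM'.mul hM)).2
      ⟨(hball x hx _ (mul_mem hh' hh)).1, rfl⟩
    have hc'' := hc.symm.trans hc'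
    rw [mul_inv_cancel_right] at hc''
    obtain ⟨h1, h2⟩ := (Carries.iff_move hmn hM').1 hc''
    exact ⟨h1, h2 ▸ ⟨_, mul_mem hh' hh, x, hx, rfl⟩⟩
  · intro x hx y hy h H
    have hdx : (frame hmn (withFrame hmn a x)).det ≠ 0 := by rwa [frame_withFrame]
    have hdy : (frame hmn (withFrame hmn a y)).det ≠ 0 := by rwa [frame_withFrame]
    have hc := ((rel_iff_carries hmn hdx hdy).1 H).2.1
    rw [coord_withFrame hmn hd, coord_withFrame hmn hd] at hc
    have hmem : (x, y) ∈ V ×ˢ V' := ⟨(hDU hx).1.1, (hDU hy).1.2⟩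
    exact mem_relGroup.2 (H.congr_supp hmn hdx hdy hd hd (hDU hx).2.symm (hDU hy).2.symm
      (hVV hmem h H.isMonomial hc))

namespace IsChartDomain

variable {hmn : m < n} {k : ℕ} {a : Config m n} {D : Set (Fin (m * (n - m - 1)) → ℂ)}

lemma carries_move (hD : IsChartDomain hmn k a D) {h : Sym n} (hh : h ∈ relGroup k a)
    {x : Fin (m * (n - m - 1)) → ℂ} (hx : x ∈ D) : Carries m h x (move hmn h x) :=
  (Carries.iff_move hmn (mem_relGroup.1 hh).isMonomial).2 ⟨(hD.move_mem h hh x hx).1, rfl⟩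

/-- The action of the symmetries of `a` on the domain of the chart. -/
noncomputable def hom (hD : IsChartDomain hmn k a D) : relGroup k a →* Equiv.Perm D :=
  MonoidHom.mk' (fun h =>
    { toFun := fun x => ⟨move hmn h.1 x, (hD.move_mem h.1 h.2 x x.2).2⟩
      invFun := fun x => ⟨move hmn (h⁻¹).1 x, (hD.move_mem (h⁻¹).1 (h⁻¹).2 x x.2).2⟩
      left_inv := fun x => Subtype.ext (Carries.right_unique hmn
        (mem_relGroup.1 (h⁻¹).2).isMonomial
        (hD.carries_move (h⁻¹).2 (hD.move_mem h.1 h.2 x x.2).2) (hD.carries_move h.2 x.2).symm)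
      right_inv := fun x => Subtype.ext (Carries.right_unique hmn (mem_relGroup.1 h.2).isMonomial
        (hD.carries_move h.2 (hD.move_mem (h⁻¹).1 (h⁻¹).2 x x.2).2)
        (by simpa using (hD.carries_move (h⁻¹).2 x.2).symm)) })
    fun h h' => Equiv.ext fun x => Subtype.ext (Carries.right_unique hmn
      (mem_relGroup.1 (h * h').2).isMonomial (hD.carries_move (h * h').2 x.2)
      ((hD.carries_move h'.2 x.2).trans
        (hD.carries_move h.2 (hD.move_mem h'.1 h'.2 x x.2).2)))

lemma coe_hom_apply (hD : IsChartDomain hmn k a D) (h : relGroup k a) (x : D) :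
    (hD.hom h x : Fin (m * (n - m - 1)) → ℂ) = move hmn h.1 x := rfl

lemma hom_apply_eq_iff (hD : IsChartDomain hmn k a D) (h : relGroup k a) (x y : D) :
    hD.hom h x = y ↔ Carries m h.1 x.1 y.1 := by
  rw [Carries.iff_move hmn (mem_relGroup.1 h.2).isMonomial, Subtype.ext_iff, coe_hom_apply]
  exact ⟨fun H => ⟨(hD.move_mem h.1 h.2 x x.2).1, H⟩, fun H => H.2⟩

/-- By effectiveness the kernel is that of `relGroupHom`, so the chart group is the isotropy group
of the centre, hence finite. -/
lemma hom_eq_one_iff (hD : IsChartDomain hmn k a D) (hm : 0 < m) (hmn' : m + 1 < n) (hk : k ≤ m)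
    (h : relGroup k a) : hD.hom h = 1 ↔ IsScalarTrivial h.1.mat := by
  constructor
  · intro H
    refine isScalarTrivial_of_carries_self hm hmn' hk (mem_relGroup.1 h.2).isMonomial hD.isOpen
      ⟨_, hD.coord_mem⟩ fun x hx => ?_
    exact (hD.hom_apply_eq_iff h ⟨x, hx⟩ ⟨x, hx⟩).1 (by rw [H]; rfl)
  · exact fun H => Equiv.ext fun x => (hD.hom_apply_eq_iff h x x).2 (H.carries_self x.1)

lemma finite_range_hom (hD : IsChartDomain hmn k a D) (hm : 0 < m) (hn : 2 * m < n)
    (hmn' : m + 1 < n) (hk : k ≤ m) (S : Std k a) (hd : (frame hmn a).det ≠ 0) :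
    Finite hD.hom.range := by
  have hfin : Finite (isotropy a) := (isotropy_finite_embedding hm hn S (by omega)
    ((affineIndependent_iff_frame hmn a).2 hd)).1
  obtain ⟨e, -⟩ := exists_mulEquiv_of_ker_eq (relGroupHom S) hD.hom.rangeRestrict
    (relGroupHom_surjective hm hn S) hD.hom.rangeRestrict_surjective fun h => by
      rw [relGroupHom_eq_one_iff hn S, ← hD.hom_eq_one_iff hm hmn' hk, Subtype.ext_iff]
      rfl
  exact Finite.of_equiv _ e.toEquiv

/-- Inside a chart domain every symmetry between two points is one of the centre, so the fibres of
the chart map are the orbits. -/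
lemma rel_iff (hD : IsChartDomain hmn k a D) (hd : (frame hmn a).det ≠ 0) (h : Sym n) (x y : D) :
    Rel k h (withFrame hmn a x) (withFrame hmn a y) ↔
      ∃ hh : h ∈ relGroup k a, hD.hom ⟨h, hh⟩ x = y := by
  have hdx : ∀ x, (frame hmn (withFrame hmn a x)).det ≠ 0 := fun x => by rwa [frame_withFrame]
  constructor
  · intro H
    have hh := hD.symm_mem x x.2 y y.2 h H
    have hc := ((rel_iff_carries hmn (hdx x) (hdx y)).1 H).2.1
    rw [coord_withFrame hmn hd, coord_withFrame hmn hd] at hc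
    exact ⟨hh, (hD.hom_apply_eq_iff ⟨h, hh⟩ x y).2 hc⟩
  · rintro ⟨hh, hxy⟩
    have hc := (hD.hom_apply_eq_iff ⟨h, hh⟩ x y).1 hxy
    refine (mem_relGroup.1 hh).congr_supp hmn hd hd (hdx x) (hdx y) (hD.supp_eq x x.2)
      (hD.supp_eq y y.2) ?_
    rw [coord_withFrame hmn hd, coord_withFrame hmn hd]
    exact hc

/-- Both groups are quotients of the symmetry group of the point by the matrices acting trivially on
the torus modulo scalars. -/
lemma stabilizer_equiv (hD : IsChartDomain hmn k a D) (hm : 0 < m) (hn : 2 * m < n)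
    (hmn' : m + 1 < n) (hk : k ≤ m) (hd : (frame hmn a).det ≠ 0) (x : D)
    (S : Std k (withFrame hmn a x)) :
    Nonempty (MulAction.stabilizer hD.hom.range x ≃* isotropy (withFrame hmn a x)) := by
  have hle : relGroup k (withFrame hmn a x) ≤ relGroup k a := fun h hh =>
    hD.symm_mem x x.2 x x.2 h (mem_relGroup.1 hh)
  let f : relGroup k (withFrame hmn a x) →* MulAction.stabilizer hD.hom.range x :=
    (hD.hom.rangeRestrict.comp (Subgroup.inclusion hle)).codRestrict _ fun h =>
      MulAction.mem_stabilizer_iff.2 ((hD.rel_iff hd h.1 x x).1 (mem_relGroup.1 h.2)).2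
  have hf : Function.Surjective f := by
    rintro ⟨⟨_, ⟨h, rfl⟩⟩, hx⟩
    exact ⟨⟨h.1, mem_relGroup.2 ((hD.rel_iff hd h.1 x x).2
      ⟨h.2, MulAction.mem_stabilizer_iff.1 hx⟩)⟩, rfl⟩
  obtain ⟨e, -⟩ := exists_mulEquiv_of_ker_eq f (relGroupHom S) hf
    (relGroupHom_surjective hm hn S) fun h => by
      rw [relGroupHom_eq_one_iff hn S,
        show h.1.mat = (Subgroup.inclusion hle h).1.mat from rfl,
        ← hD.hom_eq_one_iff hm hmn' hk, Subtype.ext_iff, Subtype.ext_iff]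
      rfl
  exact ⟨e⟩

end IsChartDomain

/-! ### The atlas -/

lemma isOpen_setOf_move_mem (hmn : m < n) (h : Sym n) {D D' : Set (Fin (m * (n - m - 1)) → ℂ)}
    (hD : IsOpen D) (hD' : IsOpen D') :
    IsOpen {x | x ∈ D ∧ Movable hmn h x ∧ move hmn h x ∈ D'} := by
  refine isOpen_iff_mem_nhds.2 ?_
  rintro x ⟨h1, h2, h3⟩
  filter_upwards [hD.mem_nhds h1, eventually_movable hmn h2,
    (differentiableAt_move hmn h2).continuousAt.eventually (hD'.mem_nhds h3)] with y h4 h5 h6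
  exact ⟨h4, h5, h6⟩

/-- The action of a monomial symmetry as a homeomorphism between open sets of coordinates. -/
noncomputable def moveHomeomorph (hmn : m < n) {k : ℕ} {h : Sym n} (H : IsMonomial k h)
    {D D' : Set (Fin (m * (n - m - 1)) → ℂ)} (hD : IsOpen D) (hD' : IsOpen D') :
    OpenPartialHomeomorph (Fin (m * (n - m - 1)) → ℂ) (Fin (m * (n - m - 1)) → ℂ) where
  toFun := move hmn h
  invFun := move hmn h⁻¹
  source := {x | x ∈ D ∧ Movable hmn h x ∧ move hmn h x ∈ D'}
  target := {x | x ∈ D' ∧ Movable hmn h⁻¹ x ∧ move hmn h⁻¹ x ∈ D}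
  map_source' := by
    rintro x ⟨h1, h2, h3⟩
    obtain ⟨h4, h5⟩ := (Carries.iff_move hmn H.inv).1
      ((Carries.iff_move hmn H).2 ⟨h2, rfl⟩).symm
    exact ⟨h3, h4, h5.symm ▸ h1⟩
  map_target' := by
    rintro x ⟨h1, h2, h3⟩
    have hc := ((Carries.iff_move hmn H.inv).2 ⟨h2, rfl⟩).symm
    rw [inv_inv] at hc
    obtain ⟨h4, h5⟩ := (Carries.iff_move hmn H).1 hc
    exact ⟨h3, h4, h5.symm ▸ h1⟩
  left_inv' := by
    rintro x ⟨h1, h2, h3⟩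
    exact ((Carries.iff_move hmn H.inv).1 ((Carries.iff_move hmn H).2 ⟨h2, rfl⟩).symm).2
  right_inv' := by
    rintro x ⟨h1, h2, h3⟩
    have hc := ((Carries.iff_move hmn H.inv).2 ⟨h2, rfl⟩).symm
    rw [inv_inv] at hc
    exact ((Carries.iff_move hmn H).1 hc).2
  open_source := isOpen_setOf_move_mem hmn h hD hD'
  open_target := isOpen_setOf_move_mem hmn h⁻¹ hD' hD
  continuousOn_toFun := fun _ hx => (differentiableAt_move hmn hx.2.1).continuousAt.continuousWithinAt
  continuousOn_invFun := fun _ hx =>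
    (differentiableAt_move hmn hx.2.1).continuousAt.continuousWithinAt

namespace IsChartDomain

variable {hmn : m < n} {Λ : Config m n} {a : moduliConfig Λ}
  {D : Set (Fin (m * (n - m - 1)) → ℂ)}

/-- The configuration with given coordinates in the domain of a chart. -/
noncomputable def point (hD : IsChartDomain hmn (numIndispensable Λ) a.1 D) (x : D) :
    moduliConfig Λ :=
  ⟨withFrame hmn a.1 x, mem_moduliConfig_of_supp_eq hmn a.2 (hD.supp_eq x x.2) (by
    rw [frame_withFrame]; exact frame_det_ne_zero_of_mem_moduliConfig hmn a.2)⟩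

lemma coe_point (hD : IsChartDomain hmn (numIndispensable Λ) a.1 D) (x : D) :
    (hD.point x).1 = withFrame hmn a.1 x := rfl

lemma coord_point (hD : IsChartDomain hmn (numIndispensable Λ) a.1 D) (x : D) :
    coord hmn (hD.point x).1 = x :=
  coord_withFrame hmn (frame_det_ne_zero_of_mem_moduliConfig hmn a.2) _

lemma continuous_point (hD : IsChartDomain hmn (numIndispensable Λ) a.1 D) :
    Continuous hD.point :=
  ((differentiable_withFrame hmn a.1).continuous.comp continuous_subtype_val).subtype_mk _

/-- Equal coordinates and equal `Supp` make the identity a symmetry between the two configurations;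
the affine frame is irrelevant. -/
lemma mk_point (hD : IsChartDomain hmn (numIndispensable Λ) a.1 D) (hm : 0 < m) (hn : 2 * m < n)
    (hΛ : Admissible Λ) {x : D} {c : moduliConfig Λ} (hs : Supp c.1 = Supp a.1)
    (hc : coord hmn c.1 = x) : Moduli.mk Λ (hD.point x) = Moduli.mk Λ c := by
  refine (Moduli.mk_eq_iff hm hn hΛ _ _).2 ⟨1, (rel_iff_carries hmn
    (frame_det_ne_zero_of_mem_moduliConfig hmn (hD.point x).2)
    (frame_det_ne_zero_of_mem_moduliConfig hmn c.2)).2 ⟨IsMonomial.one, ?_, fun I => ?_⟩⟩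
  · rw [hD.coord_point, hc]
    exact Carries.one _
  · rw [hs, coe_point, hD.supp_eq x x.2]
    simp

/-- The image of `W` is also the image of the open set of all configurations with coordinates in `W`
and the same `Supp` as `a`. -/
lemma isOpenMap_mk_point (hD : IsChartDomain hmn (numIndispensable Λ) a.1 D) (hm : 0 < m)
    (hn : 2 * m < n) (hΛ : Admissible Λ) : IsOpenMap fun x => Moduli.mk Λ (hD.point x) := by
  intro W hW
  have hW' : IsOpen (Subtype.val '' W) := hD.isOpen.isOpenMap_subtype_val W hW
  have himg : (fun x => Moduli.mk Λ (hD.point x)) '' W = Moduli.mk Λ ''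
      {c | Supp c.1 = Supp a.1 ∧ coord hmn c.1 ∈ Subtype.val '' W} := by
    ext p
    constructor
    · rintro ⟨x, hx, rfl⟩
      exact ⟨hD.point x, ⟨hD.supp_eq x x.2, x, hx, (hD.coord_point x).symm⟩, rfl⟩
    · rintro ⟨c, ⟨hs, x, hx, hxc⟩, rfl⟩
      exact ⟨x, hx, hD.mk_point hm hn hΛ hs hxc.symm⟩
  rw [himg]
  refine Moduli.isOpenMap_mk hm hn hΛ _ (isOpen_iff_mem_nhds.2 ?_)
  rintro c ⟨hs, hc⟩
  have h1 := (differentiableAt_coord hmn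
    (frame_det_ne_zero_of_mem_moduliConfig hmn c.2)).continuousAt.eventually (hW'.mem_nhds hc)
  filter_upwards [continuous_subtype_val.continuousAt.eventually (c.2.1.eventually_supp_eq hn),
    continuous_subtype_val.continuousAt.eventually h1] with c' h2 h3
  exact ⟨h2.trans hs, h3⟩

/-- The orbifold chart with given domain. -/
noncomputable def chart (hD : IsChartDomain hmn (numIndispensable Λ) a.1 D) (hm : 0 < m)
    (hn : 2 * m < n) (hΛ : Admissible Λ) (hk : numIndispensable Λ ≤ m) :
    OrbifoldChart (m * (n - m - 1)) (Moduli Λ) where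
  domain := D
  isOpen_domain := hD.isOpen
  isConnected_domain := hD.isConnected
  group := hD.hom.range
  finite_group := hD.finite_range_hom hm hn (by omega) hk (std_of_mem_moduliConfig hΛ a.2)
    (frame_det_ne_zero_of_mem_moduliConfig hmn a.2)
  holomorphic := by
    rintro _ ⟨h, rfl⟩
    exact ⟨move hmn h.1, fun x hx => (differentiableAt_move hmn
      (hD.move_mem h.1 h.2 x hx).1).differentiableWithinAt, fun x => rfl⟩
  map := fun x => Moduli.mk Λ (hD.point x)
  continuous_map := Moduli.continuous_mk.comp hD.continuous_point
  isOpenMap_map := hD.isOpenMap_mk_point hm hn hΛ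
  map_eq_iff := fun x y => by
    rw [Moduli.mk_eq_iff hm hn hΛ]
    constructor
    · rintro ⟨h, H⟩
      obtain ⟨hh, hxy⟩ :=
        (hD.rel_iff (frame_det_ne_zero_of_mem_moduliConfig hmn a.2) h x y).1 H
      exact ⟨_, ⟨⟨h, hh⟩, rfl⟩, hxy⟩
    · rintro ⟨_, ⟨h, rfl⟩, hxy⟩
      exact ⟨h.1, (hD.rel_iff (frame_det_ne_zero_of_mem_moduliConfig hmn a.2) h.1 x y).2
        ⟨h.2, hxy⟩⟩

/-- A symmetry relating the two points acts holomorphically on coordinates, and it relates nearby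
points too since `Supp` is constant on each chart domain. -/
lemma exists_transition {a' : moduliConfig Λ} {D' : Set (Fin (m * (n - m - 1)) → ℂ)}
    (hD : IsChartDomain hmn (numIndispensable Λ) a.1 D)
    (hD' : IsChartDomain hmn (numIndispensable Λ) a'.1 D') (hm : 0 < m) (hn : 2 * m < n)
    (hΛ : Admissible Λ) (x : D) (x' : D')
    (hx : Moduli.mk Λ (hD.point x) = Moduli.mk Λ (hD'.point x')) :
    ∃ h : OpenPartialHomeomorph (Fin (m * (n - m - 1)) → ℂ) (Fin (m * (n - m - 1)) → ℂ),
      (x : Fin (m * (n - m - 1)) → ℂ) ∈ h.source ∧ h x = x' ∧ h.source ⊆ D ∧ h.target ⊆ D' ∧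
      DifferentiableOn ℂ h h.source ∧ DifferentiableOn ℂ h.symm h.target ∧
      ∀ (y : D) (y' : D'), (y : Fin (m * (n - m - 1)) → ℂ) ∈ h.source → h y = y' →
        Moduli.mk Λ (hD'.point y') = Moduli.mk Λ (hD.point y) := by
  have hd : ∀ c : moduliConfig Λ, (frame hmn c.1).det ≠ 0 := fun c =>
    frame_det_ne_zero_of_mem_moduliConfig hmn c.2
  obtain ⟨h, H⟩ := (Moduli.mk_eq_iff hm hn hΛ _ _).1 hx
  have hc := ((rel_iff_carries hmn (hd _) (hd _)).1 H).2.1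
  rw [hD.coord_point, hD'.coord_point] at hc
  obtain ⟨h1, h2⟩ := (Carries.iff_move hmn H.isMonomial).1 hc
  refine ⟨moveHomeomorph hmn H.isMonomial hD.isOpen hD'.isOpen, ⟨x.2, h1, h2.symm ▸ x'.2⟩, h2,
    fun _ hy => hy.1, fun _ hy => hy.1,
    fun _ hy => (differentiableAt_move hmn hy.2.1).differentiableWithinAt,
    fun _ hy => (differentiableAt_move hmn hy.2.1).differentiableWithinAt, fun y y' hy hyy' => ?_⟩
  refine ((Moduli.mk_eq_iff hm hn hΛ _ _).2 ⟨h, ?_⟩).symm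
  refine H.congr_supp hmn (hd _) (hd _) (hd _) (hd _) ?_ ?_ ?_
  · rw [coe_point, coe_point, hD.supp_eq y y.2, hD.supp_eq x x.2]
  · rw [coe_point, coe_point, hD'.supp_eq y' y'.2, hD'.supp_eq x' x'.2]
  · rw [hD.coord_point, hD'.coord_point]
    exact (Carries.iff_move hmn H.isMonomial).2 ⟨hy.2.1, hyy'⟩

end IsChartDomain

lemma exists_isChartDomain_of_mem_moduliConfig (hm : 0 < m) (hn : 2 * m < n) (hmn : m < n)
    {Λ : Config m n} (hΛ : Admissible Λ) (hk : numIndispensable Λ ≤ m) (a : moduliConfig Λ) :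
    ∃ D, IsChartDomain hmn (numIndispensable Λ) a.1 D :=
  exists_isChartDomain hm hn hmn (std_of_mem_moduliConfig hΛ a.2) hk
    (frame_det_ne_zero_of_mem_moduliConfig hmn a.2)

/-- The charts of the moduli space. -/
def chartSet (hm : 0 < m) (hn : 2 * m < n) (hmn : m < n) {Λ : Config m n} (hΛ : Admissible Λ)
    (hk : numIndispensable Λ ≤ m) : Set (OrbifoldChart (m * (n - m - 1)) (Moduli Λ)) :=
  {c | ∃ (a : moduliConfig Λ) (D : Set (Fin (m * (n - m - 1)) → ℂ))
    (hD : IsChartDomain hmn (numIndispensable Λ) a.1 D), c = hD.chart hm hn hΛ hk}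

lemma isOrbifoldAtlas_chartSet (hm : 0 < m) (hn : 2 * m < n) (hmn : m < n) {Λ : Config m n}
    (hΛ : Admissible Λ) (hk : numIndispensable Λ ≤ m) :
    IsOrbifoldAtlas (chartSet hm hn hmn hΛ hk) := by
  constructor
  · intro p
    obtain ⟨a, rfl⟩ := Quotient.mk_surjective p
    obtain ⟨D, hD⟩ := exists_isChartDomain_of_mem_moduliConfig hm hn hmn hΛ hk a
    exact ⟨_, ⟨a, D, hD, rfl⟩, ⟨_, hD.coord_mem⟩, hD.mk_point hm hn hΛ rfl rfl⟩
  · rintro _ ⟨a, D, hD, rfl⟩ _ ⟨a', D', hD', rfl⟩ x x' hx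
    exact hD.exists_transition hD' hm hn hΛ x x' hx

lemma atlasCompatible_chartSet (hm : 0 < m) (hn : 2 * m < n) (hmn : m < n) {Λ : Config m n}
    (hΛ : Admissible Λ) (hk : numIndispensable Λ ≤ m) :
    AtlasCompatible Λ (chartSet hm hn hmn hΛ hk) := by
  intro a
  obtain ⟨D, hD⟩ := exists_isChartDomain_of_mem_moduliConfig hm hn hmn hΛ hk a
  have hd := frame_det_ne_zero_of_mem_moduliConfig hmn a.2
  have hev : ∀ᶠ c in 𝓝 a.1, Supp c = Supp a.1 ∧ (frame hmn c).det ≠ 0 ∧ coord hmn c ∈ D :=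
    (a.2.1.eventually_supp_eq hn).and ((eventually_frame_det_ne_zero hmn hd).and
      ((differentiableAt_coord hmn hd).continuousAt.eventually
        (hD.isOpen.mem_nhds hD.coord_mem)))
  obtain ⟨O, hO, hOo, haO⟩ := eventually_nhds_iff.1 hev
  refine ⟨_, ⟨a, D, hD, rfl⟩, O, hOo, haO, coord hmn,
    fun c hc => (differentiableAt_coord hmn (hO c hc).2.1).differentiableWithinAt,
    fun c hc => surjective_fderiv_coord hmn (hO c hc).2.1, fun c hc => ?_⟩
  exact ⟨⟨_, (hO c.1 hc).2.2⟩, rfl, hD.mk_point hm hn hΛ (hO c.1 hc).1 rfl⟩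

lemma stabilizer_equiv_isotropy (hm : 0 < m) (hn : 2 * m < n) (hmn : m < n) {Λ : Config m n}
    (hΛ : Admissible Λ) (hk : numIndispensable Λ ≤ m)
    {c : OrbifoldChart (m * (n - m - 1)) (Moduli Λ)} (hc : c ∈ chartSet hm hn hmn hΛ hk)
    (x : c.domain) (Λ' : moduliConfig Λ) (hx : c.map x = Moduli.mk Λ Λ') :
    Nonempty (MulAction.stabilizer c.group x ≃* isotropy Λ'.1) := by
  obtain ⟨a, D, hD, rfl⟩ := hc
  obtain ⟨e⟩ := hD.stabilizer_equiv hm hn (by omega) hk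
    (frame_det_ne_zero_of_mem_moduliConfig hmn a.2) x
    (std_of_mem_moduliConfig hΛ (hD.point x).2)
  have hG : GBiholomorphic (hD.point x).1 Λ'.1 := Quotient.exact hx
  obtain ⟨e'⟩ := isotropy_equiv_of_gBiholomorphic hG
  exact ⟨e.trans e'⟩

end LVM

theorem mainTheorem10 (m n : ℕ) (hm : 0 < m) (hn : 2 * m < n) (Λ : LVM.Config m n)
    (hΛ : LVM.Admissible Λ) (hk : LVM.numIndispensable Λ < m + 1) :
    T2Space (LVM.Moduli Λ) ∧ SecondCountableTopology (LVM.Moduli Λ) ∧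
    (∃ A : Set (LVM.OrbifoldChart (m * (n - m - 1)) (LVM.Moduli Λ)),
      LVM.IsOrbifoldAtlas A ∧ LVM.AtlasCompatible Λ A ∧
      ∀ c ∈ A, ∀ (x : c.domain) (Λ' : LVM.moduliConfig Λ), c.map x = LVM.Moduli.mk Λ Λ' →
        Nonempty (MulAction.stabilizer c.group x ≃* LVM.isotropy Λ'.1)) ∧
    ∀ Λ' : LVM.moduliConfig Λ, Finite (LVM.isotropy Λ'.1) ∧
      ∃ f : LVM.isotropy Λ'.1 →* Equiv.Perm {i : Fin n // ¬ LVM.Indispensable Λ'.1 i},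
        Function.Injective f := by
  have hmn : m < n := by omega
  have hk' : LVM.numIndispensable Λ ≤ m := by omega
  exact ⟨LVM.Moduli.t2Space hm hn hΛ hk', LVM.Moduli.secondCountableTopology hm hn hΛ,
    ⟨LVM.chartSet hm hn hmn hΛ hk', LVM.isOrbifoldAtlas_chartSet hm hn hmn hΛ hk',
      LVM.atlasCompatible_chartSet hm hn hmn hΛ hk', fun c hc x Λ' hx =>
        LVM.stabilizer_equiv_isotropy hm hn hmn hΛ hk' hc x Λ' hx⟩,
    fun Λ' => LVM.isotropy_finite_embedding hm hn (LVM.std_of_mem_moduliConfig hΛ Λ'.2)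
      (by omega) Λ'.2.2.1.1⟩
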